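/- **Conventions.** All structures are finite. A multi-sorted structure $\mathcal H=(\{H_i\}_{i\in[k]};R_1,\dots,R_m)$ has pairwise disjoint domains $H_i$ and relations $R_j\subseteq H_{i_1}\times\dots\times H_{i_\ell}$ of positive arity, where $(i_1,\dots,i_\ell)$ is the type of $R_j$. An instance $\mathcal P=(V,\mathcal C)$ of $\mathsf{CSP}(\mathcal H)$ has finitely many variables $v\in V$, each with a sort $\sigma(v)\in[k]$, and finitely many constraints $\langle\mathbf s,R_j\rangle$ with scopes $\mathbf s$ of matching type; a solution is a sort-preserving map of $V$ into $\mathcal H$ satisfying all constraints. Equivalently, $\mathcal P$ is a structure $\mathcal F$ on $V$ similar to $\mathcal H$, and solutions are the homomorphisms $\mathcal F\to\mathcal H$. The treewidth of a structure is that of its Gaifman graph. A structure $\mathcal A$ with a designated element $x$ defines in $\mathcal H$ the unary relation $\{\varphi(x)\mid\varphi:\mathcal A\to\mathcal H\text{ a homomorphism}\}$ on the domain of the sort of $x$. **Refinements of structures.** A refinement of $\mathcal H$ is a multi-sorted structure $\mathcal G=(\{G_i\}_{i\in[q]};Q_1,\dots,Q_t)$ with injective maps $\xi_i:G_i\to H_{i'}$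 such that each $Q_j$, of type $(i'_1,\dots,i'_\ell)$, is $\xi^{-1}(R)=\{\mathbf a\in G_{i'_1}\times\dots\times G_{i'_\ell}\mid \xi(\mathbf a)\in R\}$ for some relation $R$ of $\mathcal H$ of matching type with $\xi_{i'_r}(G_{i'_r})\subseteq\mathsf{pr}_rR$ for all $r$. It is the *full definable refinement* (respectively the *full width $d$ definable refinement*) if every $\xi_i(G_i)$ is pp-definable (respectively definable by a structure of treewidth at most $d$), every unary relation so definable equals some $\xi_i(G_i)$ (as a relation on the same domain of $\mathcal H$), and for every relation $R$ of $\mathcal H$ and all domains $G_{i'_1},\dots,G_{i'_\ell}$ of matching type with $\xi_{i'_r}(G_{i'_r})\subseteq\mathsf{pr}_rR$, the restriction $\xi^{-1}(R)$ of $R$ to these domains is a relation of $\mathcal G$ over them. **Refinements of instances.** A refinement for $\mathcal G$ of $\mathcal P=(V,\mathcal C)$ is an instance $\mathcal P'=(V,\mathcal C')$ of $\mathsf{CSP}(\mathcal G)$ with a sort function $\sigma':V\to[q]$ such that $\xi_{\sigma'(v)}$ maps into $H_{\sigma(v)}$, for every $\langle(v_1,\dots,v_\ell),R\rangle\in\mathcal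 C$ we have $\xi_{\sigma'(v_r)}(G_{\sigma'(v_r)})\subseteq\mathsf{pr}_rR$ for all $r$, and $\mathcal C'$ consists exactly of the constraints $\langle\mathbf s,\xi^{-1}(R)\rangle$, $\langle\mathbf s,R\rangle\in\mathcal C$. It is *lossless* if $\xi^{-1}\circ\varphi$ is a solution of $\mathcal P'$ for every solution $\varphi$ of $\mathcal P$. It is *minimal lossless* if it is lossless and, for every $v$, the set $\xi_{\sigma'(v)}(G_{\sigma'(v)})$ is inclusion-minimal among the sets assigned to $v$ in this way by lossless refinements of $\mathcal P$ for $\mathcal G$. It is *minimal lossless of width $d$* if it is lossless and, for every $v$, the set $\xi_{\sigma'(v)}(G_{\sigma'(v)})$ is inclusion-minimal among the unary relations defined in $\mathcal H$ by structures $\mathcal A$ of treewidth at most $d$ with a designated element $x$ that have a homomorphism to $\mathcal F$ taking $x$ to $v$. **Proposition.** Let $\mathcal H$ be a multi-sorted relational structure ($\mathcal H$, and below $d$ and $\mathcal G$, are fixed; only the instance $\mathcal P$ is the input). (1) Let $d\ge 0$ and let $\mathcal G$ be the full width $d$ definable refinement of $\mathcal H$. There is a polynomial time algorithm that, given any instance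 $\mathcal P$ of $\mathsf{CSP}(\mathcal H)$ which has a minimal lossless refinement of width $d$ for $\mathcal G$, finds one. If every relation of $\mathcal H$ has arity at most $d+1$, then every instance of $\mathsf{CSP}(\mathcal H)$ has one. (2) Suppose that every constant relation $\{a\}$, $a\in H$, is among the relations of $\mathcal H$ and that $\mathsf{CSP}(\mathcal H)$ is solvable in polynomial time, and let $\mathcal G$ be the full definable refinement of $\mathcal H$. There is a polynomial time algorithm that, given any instance $\mathcal P$ of $\mathsf{CSP}(\mathcal H)$, finds a minimal lossless refinement of $\mathcal P$ for $\mathcal G$. -/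

import Mathlib

/-! Finite multi-sorted relational structures.  A multi-sorted set is represented by its base set
together with the map giving the sort of each element (so that distinct sorts are disjoint), and a
tuple is represented by a list. -/

/-- A finite multi-sorted relational signature.  The type of a symbol is the list of the sorts of
its coordinates; its arity is the length of that list, and is positive. -/
structure Sig where
  sorts : ℕ
  rels : ℕ
  type : Fin rels → List (Fin sorts)
  type_ne_nil : ∀ j, type j ≠ []

/-- A finite multi-sorted relational structure. -/
structure Str (σ : Sig) where
  carrier : Type
  finite : Finite carrier
  sort : carrier → Fin σ.sorts
  rel : Fin σ.rels → Set (List carrier)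
  rel_type : ∀ j, ∀ a ∈ rel j, a.map sort = σ.type j

/-- Homomorphisms of multi-sorted structures. -/
def IsHom {σ : Sig} (A B : Str σ) (φ : A.carrier → B.carrier) : Prop :=
  (∀ x, B.sort (φ x) = A.sort x) ∧ ∀ j, ∀ a ∈ A.rel j, a.map φ ∈ B.rel j

/-- The projection of the relation `j` on the coordinate `r`. -/
def Str.proj {σ : Sig} (H : Str σ) (j : Fin σ.rels) (r : ℕ) : Set H.carrier :=
  {x | ∃ a ∈ H.rel j, a[r]? = some x}

/-- All constant relations are among the relations of `H`. -/
def Str.HasConstants {σ : Sig} (H : Str σ) : Prop :=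
  ∀ a : H.carrier, ∃ j, H.rel j = {[a]}

/-! Treewidth. -/

/-- The graph `Γ` has a tree decomposition of width at most `d`. -/
def TreewidthLE {V : Type} (Γ : SimpleGraph V) (d : ℕ) : Prop :=
  ∃ (m : ℕ) (T : SimpleGraph (Fin m)) (bag : Fin m → Finset V),
    T.IsTree ∧
    (∀ v, ∃ t, v ∈ bag t) ∧
    (∀ u v, Γ.Adj u v → ∃ t, u ∈ bag t ∧ v ∈ bag t) ∧
    (∀ v, (T.induce {t | v ∈ bag t}).Preconnected) ∧
    ∀ t, (bag t).card ≤ d + 1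

/-- The Gaifman graph: distinct elements are adjacent when they occur in a common tuple. -/
def Str.gaifman {σ : Sig} (A : Str σ) : SimpleGraph A.carrier :=
  SimpleGraph.fromRel fun x y => ∃ j, ∃ a ∈ A.rel j, x ∈ a ∧ y ∈ a

/-! Instances of the CSP. -/

/-- An instance with the variables `0, …, n - 1` over the signature `σ`: every variable has a sort,
and every constraint is a relation symbol with a scope of matching type. -/
structure Inst (σ : Sig) (n : ℕ) where
  sort : Fin n → Fin σ.sorts
  cons : List (Fin σ.rels × List (Fin n))
  typed : ∀ c ∈ cons, c.2.map sort = σ.type c.1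

/-- Instances with any number of variables. -/
abbrev AnyInst (σ : Sig) : Type := Σ n, Inst σ n

/-- `φ` is a solution of the instance `P` of CSP(`H`). -/
def IsSol {σ : Sig} (H : Str σ) {n : ℕ} (P : Inst σ n) (φ : Fin n → H.carrier) : Prop :=
  (∀ v, H.sort (φ v) = P.sort v) ∧ ∀ c ∈ P.cons, c.2.map φ ∈ H.rel c.1

/-- The instance viewed as a structure on its variables. -/
def Inst.toStr {σ : Sig} {n : ℕ} (P : Inst σ n) : Str σ where
  carrier := Fin n
  finite := inferInstance
  sort := P.sort
  rel j := {s | (j, s) ∈ P.cons}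
  rel_type j s h := P.typed (j, s) h

/-! Definability of unary relations.  A unary relation has a type, the sort `s`. -/

/-- The unary relation that the structure `A` with the designated element `x` defines in `H`. -/
def Str.definedBy {σ : Sig} (H A : Str σ) (x : A.carrier) : Set H.carrier :=
  {a | ∃ φ, IsHom A H φ ∧ φ x = a}

/-- `U`, of type `s`, is definable in `H` by a structure of treewidth at most `d`. -/
def Str.WidthDefinable {σ : Sig} (H : Str σ) (d : ℕ) (s : Fin σ.sorts) (U : Set H.carrier) : Prop :=
  ∃ (A : Str σ) (x : A.carrier), TreewidthLE A.gaifman d ∧ A.sort x = s ∧ U = H.definedBy A x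

/-- A primitive positive formula with one free variable: typed variables, a conjunction of relational
atoms, a conjunction of equalities between variables of the same type, and the free variable
(all the other variables are existentially quantified). -/
structure PPFormula (σ : Sig) where
  n : ℕ
  atoms : Inst σ n
  eqs : List (Fin n × Fin n)
  eqs_typed : ∀ e ∈ eqs, atoms.sort e.1 = atoms.sort e.2
  free : Fin n

/-- The unary relation that a pp-formula defines in `H`. -/
def Str.ppDefinedBy {σ : Sig} (H : Str σ) (Φ : PPFormula σ) : Set H.carrier :=
  {a | ∃ φ : Fin Φ.n → H.carrier,
    IsSol H Φ.atoms φ ∧ (∀ e ∈ Φ.eqs, φ e.1 = φ e.2) ∧ φ Φ.free = a}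

/-- `U`, of type `s`, is pp-definable in `H`. -/
def Str.PPDefinable {σ : Sig} (H : Str σ) (s : Fin σ.sorts) (U : Set H.carrier) : Prop :=
  ∃ Φ : PPFormula σ, Φ.atoms.sort Φ.free = s ∧ U = H.ppDefinedBy Φ

/-! Refinements of structures. -/

/-- The tuples over `A` of type `τ` that `ξ` maps into the relation `R`. -/
def pullback {α β : Type} {q : ℕ} (sort : α → Fin q) (ξ : α → β) (τ : List (Fin q))
    (R : Set (List β)) : Set (List α) :=
  {a | a.map sort = τ ∧ a.map ξ ∈ R}

/-- A refinement of `H`: a structure `str` over a signature of its own; the map `ξ` restricts, for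
every sort `i` of `str`, to an injective map `ξ_i` from the `i`-th domain to the domain of `H` of sort
`base i`; every relation of `str` is the pullback of a relation of `H` of matching type, on domains
that `ξ` maps into the projections of that relation. -/
structure Refinement {σ : Sig} (H : Str σ) where
  sig : Sig
  str : Str sig
  base : Fin sig.sorts → Fin σ.sorts
  ξ : str.carrier → H.carrier
  sort_ξ : ∀ x, H.sort (ξ x) = base (str.sort x)
  injective : ∀ x y, str.sort x = str.sort y → ξ x = ξ y → x = y
  rel_eq : ∀ j, ∃ j', (sig.type j).map base = σ.type j' ∧
    str.rel j = pullback str.sort ξ (sig.type j) (H.rel j') ∧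
    ∀ r i, (sig.type j)[r]? = some i → ξ '' {x | str.sort x = i} ⊆ H.proj j' r

/-- The set `ξ_i(G_i)`. -/
def Refinement.dom {σ : Sig} {H : Str σ} (G : Refinement H) (i : Fin G.sig.sorts) :
    Set H.carrier :=
  G.ξ '' {x | G.str.sort x = i}

/-- `G` is full with respect to a notion `D` of definability of unary relations:
all its domains are definable, every definable unary relation is one of its domains, and every
restriction of a relation of `H` to domains of `G` contained in the respective projections is
(through `ξ`) a relation of `G` over these domains. -/
def Refinement.IsFullFor {σ : Sig} {H : Str σ} (G : Refinement H)
    (D : Fin σ.sorts → Set H.carrier → Prop) : Prop :=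
  (∀ i, D (G.base i) (G.dom i)) ∧
  (∀ s U, D s U → ∃ i, G.base i = s ∧ G.dom i = U) ∧
  ∀ (j : Fin σ.rels) (τ : List (Fin G.sig.sorts)), τ.map G.base = σ.type j →
    (∀ r i, τ[r]? = some i → G.dom i ⊆ H.proj j r) →
    ∃ j', G.sig.type j' = τ ∧ G.str.rel j' = pullback G.str.sort G.ξ τ (H.rel j)

/-- `G` is the full width `d` definable refinement of `H`. -/
def Refinement.IsFullWidth {σ : Sig} {H : Str σ} (G : Refinement H) (d : ℕ) : Prop :=
  G.IsFullFor (H.WidthDefinable d)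

/-- `G` is the full definable refinement of `H`. -/
def Refinement.IsFull {σ : Sig} {H : Str σ} (G : Refinement H) : Prop :=
  G.IsFullFor H.PPDefinable

/-! Refinements of instances. -/

/-- In the instance `Q` of CSP(`G`), the constraint `c'` is the lift of the constraint `c` of an
instance of CSP(`H`): the same scope, with the pullback of the constraint relation. -/
def Refinement.IsLift {σ : Sig} {H : Str σ} (G : Refinement H) {n : ℕ} (Q : Inst G.sig n)
    (c : Fin σ.rels × List (Fin n)) (c' : Fin G.sig.rels × List (Fin n)) : Prop :=
  c'.2 = c.2 ∧ G.str.rel c'.1 = pullback G.str.sort G.ξ (c.2.map Q.sort) (H.rel c.1)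

/-- The instance `Q` of CSP(`G`) is a refinement for `G` of the instance `P` of CSP(`H`);
its sort function is `Q.sort`, and its constraints are the lifts of those of `P`. -/
def Refinement.IsRefinementOf {σ : Sig} {H : Str σ} (G : Refinement H) {n : ℕ}
    (P : Inst σ n) (Q : Inst G.sig n) : Prop :=
  (∀ v, G.base (Q.sort v) = P.sort v) ∧
  (∀ c ∈ P.cons,
    (∀ r v, c.2[r]? = some v → G.dom (Q.sort v) ⊆ H.proj c.1 r) ∧
    ∃ c' ∈ Q.cons, G.IsLift Q c c') ∧
  ∀ c' ∈ Q.cons, ∃ c ∈ P.cons, G.IsLift Q c c'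

/-- `Q` is a lossless refinement of `P`: for every solution `φ` of `P`, the map `ξ⁻¹ ∘ φ` is a
solution of `Q`. -/
def Refinement.IsLossless {σ : Sig} {H : Str σ} (G : Refinement H) {n : ℕ}
    (P : Inst σ n) (Q : Inst G.sig n) : Prop :=
  G.IsRefinementOf P Q ∧ ∀ φ, IsSol H P φ → ∃ ψ, IsSol G.str Q ψ ∧ ∀ v, G.ξ (ψ v) = φ v

/-- `Q` is a minimal lossless refinement of `P`: the domain of every variable is minimal among
its domains in lossless refinements of `P` for `G`. -/
def Refinement.IsMinimalLossless {σ : Sig} {H : Str σ} (G : Refinement H) {n : ℕ}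
    (P : Inst σ n) (Q : Inst G.sig n) : Prop :=
  G.IsLossless P Q ∧
  ∀ v, Minimal (fun U => ∃ Q', G.IsLossless P Q' ∧ U = G.dom (Q'.sort v)) (G.dom (Q.sort v))

/-- `Q` is a minimal lossless refinement of width `d` of `P`: the domain of every variable `v` is
minimal among the unary relations defined in `H` by structures `A` of treewidth at most `d`, with a
designated element `x`, that have a homomorphism to the structure of `P` taking `x` to `v`. -/
def Refinement.IsMinimalLosslessWidth {σ : Sig} {H : Str σ} (G : Refinement H) (d : ℕ) {n : ℕ}
    (P : Inst σ n) (Q : Inst G.sig n) : Prop :=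
  G.IsLossless P Q ∧
  ∀ v : Fin n, Minimal
    (fun U => ∃ (A : Str σ) (x : A.carrier), TreewidthLE A.gaifman d ∧
      (∃ h : A.carrier → Fin n, IsHom A P.toStr h ∧ h x = v) ∧ U = H.definedBy A x)
    (G.dom (Q.sort v))

/-! Polynomial time, on Mathlib's multi-stack Turing machines. -/

/-- The alphabet used to write instances: a letter for each sort, a letter for each relation symbol,
a unary digit `true`, and an end marker `false` for variable names. -/
abbrev Letter (σ : Sig) : Type := (Fin σ.sorts ⊕ Fin σ.rels) ⊕ Bool

/-- The word for an instance: the sorts of the variables in order, then every constraint as its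
relation symbol followed by the variables of its scope.  The variable `v` is written in unary; as all
`n` variables are listed, this is polynomially related to writing it in binary. -/
def encodeInst {σ : Sig} (P : AnyInst σ) : List (Letter σ) :=
  (List.ofFn P.2.sort).map (fun i => Sum.inl (Sum.inl i)) ++
  P.2.cons.flatMap fun c =>
    Sum.inl (Sum.inr c.1) ::
      c.2.flatMap fun v => List.replicate v.val (Sum.inr true) ++ [Sum.inr false]

/-- `f` is computable in polynomial time, with the given encodings of inputs and outputs. -/
def PolyTime {α β αΓ βΓ : Type} (ea : α → List αΓ) (eb : β → List βΓ) (f : α → β) : Prop :=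
  Nonempty (Turing.TM2ComputableInPolyTime ea eb f)

/-- CSP(`H`) is solvable in polynomial time. -/
def Str.CSPPolyTime {σ : Sig} (H : Str σ) : Prop :=
  ∃ f : AnyInst σ → Bool, PolyTime encodeInst Computability.encodeBool f ∧
    ∀ (n : ℕ) (P : Inst σ n), f ⟨n, P⟩ = true ↔ ∃ φ, IsSol H P φ

/-!
# Minimal lossless refinements in polynomial time

Both algorithms compute, for every variable `v` of an instance `P`, a definable set of values `U v`,
and then write down the refinement of `P` whose domains are the sets `U v`.  Fullness of `G` provides
the sorts with these domains and the relations over them, as long as `U v` is contained in the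
projections of the constraint relations in which `v` occurs (`exists_refinement_algorithm`).

*With a solver.*  Let `U v` be the set of values of `v` in solutions of `P`.  It is pp-definable by `P`
itself, and every lossless refinement has to keep it, so it is the least possible domain.  With the
constant relations, `a ∈ U v` is the solvability of `P` with one more constraint, a question for the
solver (`exists_minimalLossless_algorithm`).

*With bounded width.*  Let `k = d + 1`.  Start with all consistent assignments to `k` variables (with
repetitions), and remove, as long as possible, an assignment `p` for which there are `k` variables such
that no remaining assignment to these variables is compatible with `p`.  Let `U v` be the set of
values of `v` in the remaining assignments (`prunedValues`).  Then `U v` is the least among the relations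
defined by structures `A` of treewidth at most `d`, with a designated element `x`, that map to `P` with
`x ↦ v`:

* `U v` is contained in each of them (`prunedValues_subset_definedBy`): going down a rooted tree
  decomposition of `A`, choose for each bag a remaining assignment compatible with that of the parent
  bag.  They agree on common elements and so give a map to `H`; it is a homomorphism because, by the
  Helly property of subtrees (`exists_bag_of_pairwise`), every tuple of `A` lies in one bag.
* `U v` is one of them (`exists_prunedValues_eq_definedBy`): unravel `P` into the tree of all sequences
  of at most `N` tuples of `k` variables, where consecutive tuples share the copies of their common
  variables.  A homomorphism from this structure to `H` makes, at a node with `t` levels below it, an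
  assignment that survives `t` rounds of pruning (`nodeAssign_mem_iterate`).

Hence a refinement is minimal lossless of width `d` exactly when its domains are the sets `U v`
(`isMinimalLosslessWidth_iff`).  If all arities are at most `d + 1`, a remaining assignment is compatible
with one that satisfies a given constraint, which puts `U v` into the projections.

*Polynomial time.*  The machines are programs on a stack that holds binary trees in prefix notation.
`PT` is the class of functions on encoded data that such programs compute in polynomial time; it is
closed under composition, case distinction, and left folds with polynomially bounded intermediate
results, and this gives the usual functions on lists.  It comes with conversions from and to machines on
words: `polyTime_of_pte`, and `PTE.subroutine`, which makes a given machine available as a subroutine.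
-/


open Turing

/-! ### Program fragments for multi-stack machines -/

/-- A program fragment: a multi-stack program with finitely many labels and an entry label. -/
structure Frag {K : Type} (Γ : K → Type) (V : Type) where
  Λ : Type
  fin : Fintype Λ
  main : Λ
  m : Λ → TM2.Stmt Γ Λ V

section Fragments

variable {K : Type} [DecidableEq K] {Γ : K → Type} {V : Type}

/-- `Steps m t c c'`: the program `m` takes the configuration `c` to `c'` in exactly `t` steps. -/
inductive Steps {Λ : Type} (m : Λ → TM2.Stmt Γ Λ V) :
    ℕ → TM2.Cfg Γ Λ V → TM2.Cfg Γ Λ V → Prop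
  | refl (c) : Steps m 0 c c
  | head {t c c' c''} : TM2.step m c = some c' → Steps m t c' c'' → Steps m (t + 1) c c''

theorem Steps.trans {Λ : Type} {m : Λ → TM2.Stmt Γ Λ V} {t t' : ℕ} {c c' c'' : TM2.Cfg Γ Λ V}
    (h : Steps m t c c') (h' : Steps m t' c' c'') : Steps m (t + t') c c'' := by
  induction h with
  | refl => simpa using h'
  | head hs _ ih =>
    have := Steps.head hs (ih h')
    convert this using 1
    omega

theorem Steps.iterate_eq {Λ : Type} {m : Λ → TM2.Stmt Γ Λ V} {t : ℕ} {c c' : TM2.Cfg Γ Λ V}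
    (h : Steps m t c c') : (flip bind (TM2.step m))^[t] (some c) = some c' := by
  induction h with
  | refl => rfl
  | @head t c c₁ c₂ hs _ ih =>
    rw [Function.iterate_succ_apply]
    have : flip bind (TM2.step m) (some c) = some c₁ := hs
    rw [this, ih]

theorem Steps.of_iterate_eq {Λ : Type} {m : Λ → TM2.Stmt Γ Λ V} {t : ℕ} {c c' : TM2.Cfg Γ Λ V}
    (h : (flip bind (TM2.step m))^[t] (some c) = some c') : Steps m t c c' := by
  induction t generalizing c with
  | zero => cases h; exact .refl _
  | succ t ih =>
    rw [Function.iterate_succ_apply] at h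
    have e : flip bind (TM2.step m) (some c) = TM2.step m c := rfl
    rw [e] at h
    cases hs : TM2.step m c with
    | none =>
      rw [hs] at h
      have : ∀ n, (flip bind (TM2.step m))^[n] none = none := fun n =>
        Function.iterate_fixed rfl n
      rw [this] at h
      cases h
    | some c₁ =>
      rw [hs] at h
      exact .head hs (ih h)

/-- Rename the labels of a statement, and jump to `e` (or halt, if `e` is `none`) instead of
halting. -/
def relabel {Λ Λ' : Type} (f : Λ → Λ') (e : Option Λ') :
    TM2.Stmt Γ Λ V → TM2.Stmt Γ Λ' V
  | .push k g q => .push k g (relabel f e q)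
  | .peek k g q => .peek k g (relabel f e q)
  | .pop k g q => .pop k g (relabel f e q)
  | .load g q => .load g (relabel f e q)
  | .branch g q q' => .branch g (relabel f e q) (relabel f e q')
  | .goto g => .goto fun v => f (g v)
  | .halt => match e with
    | none => .halt
    | some l => .goto fun _ => l

/-- The effect of `relabel` on configurations. -/
def relabelCfg {Λ Λ' : Type} (f : Λ → Λ') (e : Option Λ') (c : TM2.Cfg Γ Λ V) :
    TM2.Cfg Γ Λ' V :=
  ⟨c.l.elim e fun l => some (f l), c.var, c.stk⟩

theorem stepAux_relabel {Λ Λ' : Type} (f : Λ → Λ') (e : Option Λ') (q : TM2.Stmt Γ Λ V) (v : V)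
    (S : ∀ k, List (Γ k)) :
    TM2.stepAux (relabel f e q) v S = relabelCfg f e (TM2.stepAux q v S) := by
  induction q generalizing v S with
  | branch g q q' ih ih' =>
    simp only [relabel, TM2.stepAux]
    cases g v <;> simp [ih, ih']
  | halt => cases e <;> rfl
  | goto g => rfl
  | _ => simp only [relabel, TM2.stepAux, *]

theorem Steps.relabel {Λ Λ' : Type} (f : Λ → Λ') (e : Option Λ') {m : Λ → TM2.Stmt Γ Λ V}
    {m' : Λ' → TM2.Stmt Γ Λ' V} (hm : ∀ l, m' (f l) = relabel f e (m l)) {t : ℕ}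
    {c c' : TM2.Cfg Γ Λ V} (h : Steps m t c c') :
    Steps m' t (relabelCfg f e c) (relabelCfg f e c') := by
  induction h with
  | refl => exact .refl _
  | @head t c c₁ c₂ hs _ ih =>
    refine .head ?_ ih
    obtain ⟨_ | l, v, S⟩ := c
    · cases hs
    · simp only [TM2.step, Option.some.injEq] at hs
      simp [relabelCfg, TM2.step, hm, stepAux_relabel, hs]

variable (v₀ : V)

/-- `M` takes the stacks `S` to the stacks `S'` and halts, in at most `t` steps, with the internal
state `v₀` at both ends. -/
def Frag.Run (M : Frag Γ V) (S S' : ∀ k, List (Γ k)) (t : ℕ) : Prop :=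
  ∃ t' ≤ t, Steps M.m t' ⟨some M.main, v₀, S⟩ ⟨none, v₀, S'⟩

variable {v₀}

theorem Frag.Run.mono {M : Frag Γ V} {S S' : ∀ k, List (Γ k)} {t t' : ℕ}
    (h : M.Run v₀ S S' t) (ht : t ≤ t') : M.Run v₀ S S' t' :=
  let ⟨s, hs, h⟩ := h
  ⟨s, hs.trans ht, h⟩

/-- The fragment that runs a single statement. -/
def Frag.basic (q : TM2.Stmt Γ Unit V) : Frag Γ V := ⟨Unit, inferInstance, (), fun _ => q⟩

theorem Frag.Run.basic {q : TM2.Stmt Γ Unit V} {S S' : ∀ k, List (Γ k)}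
    (h : TM2.stepAux q v₀ S = ⟨none, v₀, S'⟩) : (Frag.basic q).Run v₀ S S' 1 :=
  ⟨1, le_rfl, .head (congrArg some h) (.refl _)⟩

/-- Sequential composition. -/
def Frag.seq (M N : Frag Γ V) : Frag Γ V where
  Λ := M.Λ ⊕ N.Λ
  fin := letI := M.fin; letI := N.fin; inferInstance
  main := .inl M.main
  m := Sum.elim (fun l => relabel Sum.inl (some (.inr N.main)) (M.m l))
    (fun l => relabel Sum.inr none (N.m l))

theorem Frag.Run.seq {M N : Frag Γ V} {S S' S'' : ∀ k, List (Γ k)} {t t' : ℕ}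
    (h : M.Run v₀ S S' t) (h' : N.Run v₀ S' S'' t') : (M.seq N).Run v₀ S S'' (t + t') := by
  obtain ⟨s, hs, h⟩ := h
  obtain ⟨s', hs', h'⟩ := h'
  refine ⟨s + s', by omega, ?_⟩
  have h₁ := h.relabel (m' := (M.seq N).m) Sum.inl (some (.inr N.main)) fun l => rfl
  have h₂ := h'.relabel (m' := (M.seq N).m) Sum.inr none fun l => rfl
  exact h₁.trans h₂

/-- How the symbol popped from the stack `k` is kept in the internal state: `sym` is the information
kept, `put` stores it and `get` reads it. -/
structure Probe (Γ : K → Type) (V : Type) (k : K) where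
  ι : Type
  fin : Fintype ι
  sym : Option (Γ k) → ι
  put : ι → V
  get : V → ι
  get_put : ∀ i, get (put i) = i

/-- Pop the stack `k`, run the fragment chosen by the popped symbol `i`, and start again if `cont i`
holds. -/
def Frag.loop (v₀ : V) {k : K} (p : Probe Γ V k) (M : p.ι → Frag Γ V) (cont : p.ι → Bool) :
    Frag Γ V where
  Λ := Unit ⊕ p.ι ⊕ Σ i, (M i).Λ
  fin := letI := p.fin; letI := fun i => (M i).fin; inferInstance
  main := .inl ()
  m
    | .inl () => .pop k (fun _ o => p.put (p.sym o)) (.goto fun v => .inr (.inl (p.get v)))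
    | .inr (.inl i) => .load (fun _ => v₀) (.goto fun _ => .inr (.inr ⟨i, (M i).main⟩))
    | .inr (.inr ⟨i, l⟩) =>
      relabel (fun l => .inr (.inr ⟨i, l⟩)) (if cont i then some (.inl ()) else none) ((M i).m l)

theorem Frag.loop_steps {k : K} (p : Probe Γ V k) (M : p.ι → Frag Γ V) (cont : p.ι → Bool)
    {S S' : ∀ k, List (Γ k)} {t : ℕ}
    (h : (M (p.sym (S k).head?)).Run v₀ (Function.update S k (S k).tail) S' t) :
    ∃ t' ≤ t + 2, Steps (Frag.loop v₀ p M cont).m t' ⟨some (.inl ()), v₀, S⟩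
      ⟨if cont (p.sym (S k).head?) then some (.inl ()) else none, v₀, S'⟩ := by
  obtain ⟨s, hs, h⟩ := h
  refine ⟨s + 1 + 1, by omega, ?_⟩
  have e : TM2.step (Frag.loop v₀ p M cont).m ⟨some (.inl ()), v₀, S⟩ =
      some ⟨some (.inr (.inl (p.sym (S k).head?))), p.put (p.sym (S k).head?),
        Function.update S k (S k).tail⟩ := by
    simp [Frag.loop, p.get_put]
  refine .head e (.head (t := s) rfl ?_)
  exact h.relabel (m' := (Frag.loop v₀ p M cont).m)
    (fun l => .inr (.inr ⟨_, l⟩)) (if cont (p.sym (S k).head?) then some (.inl ()) else none)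
    fun l => rfl

theorem Frag.Run.loop_exit {k : K} {p : Probe Γ V k} {M : p.ι → Frag Γ V} {cont : p.ι → Bool}
    {S S₁ S' : ∀ k, List (Γ k)} {t : ℕ} (i : p.ι) (hi : p.sym (S k).head? = i)
    (hS : Function.update S k (S k).tail = S₁) (hc : cont i = false)
    (h : (M i).Run v₀ S₁ S' t) : (Frag.loop v₀ p M cont).Run v₀ S S' (t + 2) := by
  subst hi hS
  obtain ⟨s, hs, h⟩ := Frag.loop_steps p M cont h
  rw [hc] at h
  exact ⟨s, hs, h⟩

theorem Frag.Run.loop_cont {k : K} {p : Probe Γ V k} {M : p.ι → Frag Γ V} {cont : p.ι → Bool}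
    {S S₁ S' S'' : ∀ k, List (Γ k)} {t t' : ℕ} (i : p.ι) (hi : p.sym (S k).head? = i)
    (hS : Function.update S k (S k).tail = S₁) (hc : cont i = true)
    (h : (M i).Run v₀ S₁ S' t) (h' : (Frag.loop v₀ p M cont).Run v₀ S' S'' t') :
    (Frag.loop v₀ p M cont).Run v₀ S S'' (t + 2 + t') := by
  subst hi hS
  obtain ⟨s, hs, h⟩ := Frag.loop_steps p M cont h
  obtain ⟨s', hs', h'⟩ := h'
  rw [hc] at h
  exact ⟨s + s', by omega, h.trans h'⟩

end Fragments

/-! ### Binary trees on a stack -/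

/-- Binary trees, the data of the programs below. -/
inductive Dat
  | leaf
  | node (l r : Dat)

/-- The word of a tree, in prefix notation: `false` is a leaf, `true` a node.  It delimits itself,
so that one stack can hold several trees. -/
def Dat.ser : Dat → List Bool
  | .leaf => [false]
  | .node l r => true :: (l.ser ++ r.ser)

/-- The length of the word of a tree. -/
def Dat.size : Dat → ℕ
  | .leaf => 1
  | .node l r => l.size + r.size + 1

@[simp] theorem Dat.length_ser (x : Dat) : x.ser.length = x.size := by
  induction x with
  | leaf => rfl
  | node l r ihl ihr => simp [ser, size, ihl, ihr]

/-- The registers of the machines: `main` holds the data, `aux` and `cnt` are for scratch work,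
`inp` and `out` hold the input and output words. -/
inductive Reg
  | main
  | aux (i : Fin 3)
  | cnt
  | inp
  | out
  deriving DecidableEq, Fintype

section Machine

variable (Lin Lout : Type) (O : FinTM2)

/-- The stack alphabets: those of the registers, and those of a machine `O` that is available as a
subroutine. -/
def Alph : Reg ⊕ O.K → Type
  | .inl .inp => Lin
  | .inl .out => Lout
  | .inl .main => Bool
  | .inl (.aux _) => Bool
  | .inl .cnt => Bool
  | .inr k => O.Γ k

/-- The internal states: a symbol read last, and the internal state of the subroutine. -/
abbrev Var : Type := Option Bool × Option Lin × O.σ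

/-- The resting internal state. -/
abbrev rest : Var Lin O := (none, none, O.initialState)

/-- The contents of all stacks. -/
structure Store where
  main : List Bool
  aux : Fin 3 → List Bool
  cnt : List Bool
  inp : List Lin
  out : List Lout
  orc : ∀ k, List (O.Γ k)

variable {Lin Lout O}

/-- The contents of all stacks, as a function of the stack. -/
def Store.stk (s : Store Lin Lout O) : ∀ k, List (Alph Lin Lout O k)
  | .inl .inp => s.inp
  | .inl .out => s.out
  | .inl .main => s.main
  | .inl (.aux i) => s.aux i
  | .inl .cnt => s.cnt
  | .inr k => s.orc k

theorem Store.update_main (s : Store Lin Lout O) (x : List Bool) :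
    Function.update s.stk (.inl .main) x = { s with main := x }.stk := by
  funext k
  rcases k with (_ | _ | _ | _ | _) | k <;> rfl

theorem Store.update_cnt (s : Store Lin Lout O) (x : List Bool) :
    Function.update s.stk (.inl .cnt) x = { s with cnt := x }.stk := by
  funext k
  rcases k with (_ | _ | _ | _ | _) | k <;> rfl

theorem Store.update_inp (s : Store Lin Lout O) (x : List Lin) :
    Function.update s.stk (.inl .inp) x = { s with inp := x }.stk := by
  funext k
  rcases k with (_ | _ | _ | _ | _) | k <;> rfl

theorem Store.update_out (s : Store Lin Lout O) (x : List Lout) :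
    Function.update s.stk (.inl .out) x = { s with out := x }.stk := by
  funext k
  rcases k with (_ | _ | _ | _ | _) | k <;> rfl

theorem Store.update_aux (s : Store Lin Lout O) (i : Fin 3) (x : List Bool) :
    Function.update s.stk (.inl (.aux i)) x = { s with aux := Function.update s.aux i x }.stk := by
  funext k
  rcases k with (_ | j | _ | _ | _) | k
  · rfl
  · by_cases h : j = i
    · subst h
      refine (Function.update_self _ _ _).trans ?_
      symm
      exact Function.update_self _ _ _
    · exact (Function.update_of_ne (by simpa using h) _ _).trans
        (Function.update_of_ne h _ _).symm
  all_goals rfl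

theorem Store.update_orc (s : Store Lin Lout O) (j : O.K) (x : List (O.Γ j)) :
    Function.update s.stk (.inr j) x = { s with orc := Function.update s.orc j x }.stk := by
  funext k
  rcases k with (_ | _ | _ | _ | _) | k
  · rfl
  · rfl
  · rfl
  · rfl
  · rfl
  · by_cases h : k = j
    · subst h
      refine (Function.update_self _ _ _).trans ?_
      symm
      exact Function.update_self _ _ _
    · exact (Function.update_of_ne (by simpa using h) _ _).trans
        (Function.update_of_ne h _ _).symm

variable (Lin Lout O) in
/-- Fragments over the stacks above. -/
abbrev Prog : Type 1 := Frag (Alph Lin Lout O) (Var Lin O)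

/-- `M` takes the store `s` to the store `s'` in at most `t` steps. -/
def Prog.Does (M : Prog Lin Lout O) (s s' : Store Lin Lout O) (t : ℕ) : Prop :=
  Frag.Run (rest Lin O) M s.stk s'.stk t

theorem Prog.Does.mono {M : Prog Lin Lout O} {s s' : Store Lin Lout O} {t t' : ℕ}
    (h : M.Does s s' t) (ht : t ≤ t') : M.Does s s' t' :=
  Frag.Run.mono h ht

theorem Prog.Does.to {M : Prog Lin Lout O} {s s' s'' : Store Lin Lout O} {t t' : ℕ}
    (h : M.Does s s' t) (hs : s' = s'') (ht : t ≤ t') : M.Does s s'' t' :=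
  hs ▸ h.mono ht

theorem Prog.Does.seq {M N : Prog Lin Lout O} {s s' s'' : Store Lin Lout O} {t t' : ℕ}
    (h : M.Does s s' t) (h' : N.Does s' s'' t') : Prog.Does (M.seq N) s s'' (t + t') :=
  Frag.Run.seq h h'

/-- Read a stack whose symbols carry one bit. -/
def bitProbe (k : Reg ⊕ O.K) (e : Alph Lin Lout O k → Bool) :
    Probe (Alph Lin Lout O) (Var Lin O) k where
  ι := Option Bool
  fin := inferInstance
  sym := Option.map e
  put i := (i, none, O.initialState)
  get v := v.1
  get_put _ := rfl

/-- `Frag.loop` on the register `main`. -/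
def onMain (M : Option Bool → Prog Lin Lout O) (cont : Option Bool → Bool) : Prog Lin Lout O :=
  .loop (rest Lin O) (bitProbe (.inl .main) fun b : Bool => b) M cont

/-- `Frag.loop` on an auxiliary register. -/
def onAux (i : Fin 3) (M : Option Bool → Prog Lin Lout O) (cont : Option Bool → Bool) :
    Prog Lin Lout O :=
  .loop (rest Lin O) (bitProbe (.inl (.aux i)) fun b : Bool => b) M cont

/-- `Frag.loop` on the register `cnt`. -/
def onCnt (M : Option Bool → Prog Lin Lout O) (cont : Option Bool → Bool) : Prog Lin Lout O :=
  .loop (rest Lin O) (bitProbe (.inl .cnt) fun b : Bool => b) M cont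

variable {M : Option Bool → Prog Lin Lout O} {cont : Option Bool → Bool}
  {s s' s'' : Store Lin Lout O} {t t' : ℕ}

theorem onMain_exit {b : Bool} {w : List Bool} (hs : s.main = b :: w) (hc : cont (some b) = false)
    (h : (M (some b)).Does { s with main := w } s' t) : (onMain M cont).Does s s' (t + 2) := by
  refine Frag.Run.loop_exit (some b) ?_ (Store.update_main _ _) hc ?_
  · change Option.map (fun b => b) s.main.head? = _
    simp [hs]
  · change (M (some b)).Does { s with main := s.main.tail } s' t
    simpa [hs] using h

theorem onMain_cont {b : Bool} {w : List Bool} (hs : s.main = b :: w) (hc : cont (some b) = true)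
    (h : (M (some b)).Does { s with main := w } s' t) (h' : (onMain M cont).Does s' s'' t') :
    (onMain M cont).Does s s'' (t + 2 + t') := by
  refine Frag.Run.loop_cont (some b) ?_ (Store.update_main _ _) hc ?_ h'
  · change Option.map (fun b => b) s.main.head? = _
    simp [hs]
  · change (M (some b)).Does { s with main := s.main.tail } s' t
    simpa [hs] using h

theorem onCnt_exit (hs : s.cnt = []) (hc : cont none = false)
    (h : (M none).Does s s' t) : (onCnt M cont).Does s s' (t + 2) := by
  refine Frag.Run.loop_exit none ?_ (Store.update_cnt _ _) hc ?_
  · change Option.map (fun b => b) s.cnt.head? = _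
    simp [hs]
  · change (M none).Does { s with cnt := s.cnt.tail } s' t
    rw [hs, List.tail_nil, ← hs]
    exact h

theorem onCnt_cont {b : Bool} {w : List Bool} (hs : s.cnt = b :: w) (hc : cont (some b) = true)
    (h : (M (some b)).Does { s with cnt := w } s' t) (h' : (onCnt M cont).Does s' s'' t') :
    (onCnt M cont).Does s s'' (t + 2 + t') := by
  refine Frag.Run.loop_cont (some b) ?_ (Store.update_cnt _ _) hc ?_ h'
  · change Option.map (fun b => b) s.cnt.head? = _
    simp [hs]
  · change (M (some b)).Does { s with cnt := s.cnt.tail } s' t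
    simpa [hs] using h

theorem onAux_exit {i : Fin 3} (hs : s.aux i = []) (hc : cont none = false)
    (h : (M none).Does s s' t) : (onAux i M cont).Does s s' (t + 2) := by
  refine Frag.Run.loop_exit none ?_ (Store.update_aux _ _ _) hc ?_
  · change Option.map (fun b => b) (s.aux i).head? = _
    simp [hs]
  · change (M none).Does { s with aux := Function.update s.aux i (s.aux i).tail } s' t
    rw [hs, List.tail_nil, ← hs, Function.update_eq_self]
    exact h

theorem onAux_cont {i : Fin 3} {b : Bool} {w : List Bool} (hs : s.aux i = b :: w)
    (hc : cont (some b) = true)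
    (h : (M (some b)).Does { s with aux := Function.update s.aux i w } s' t)
    (h' : (onAux i M cont).Does s' s'' t') : (onAux i M cont).Does s s'' (t + 2 + t') := by
  refine Frag.Run.loop_cont (some b) ?_ (Store.update_aux _ _ _) hc ?_ h'
  · change Option.map (fun b => b) (s.aux i).head? = _
    simp [hs]
  · change (M (some b)).Does { s with aux := Function.update s.aux i (s.aux i).tail } s' t
    simpa [hs] using h

/-- Do nothing. -/
def skip : Prog Lin Lout O := .basic .halt

theorem skip_does (s : Store Lin Lout O) : skip.Does s s 1 := .basic rfl

/-- Push a bit on `main`. -/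
def pushMain (b : Bool) : Prog Lin Lout O :=
  .basic (.push (.inl .main) (fun _ => (b : Bool)) .halt)

theorem pushMain_does (b : Bool) (s : Store Lin Lout O) :
    (pushMain b).Does s { s with main := b :: s.main } 1 :=
  .basic (congrArg _ (Store.update_main _ _))

/-- Push a bit on `cnt`. -/
def pushCnt (b : Bool) : Prog Lin Lout O :=
  .basic (.push (.inl .cnt) (fun _ => (b : Bool)) .halt)

theorem pushCnt_does (b : Bool) (s : Store Lin Lout O) :
    (pushCnt b).Does s { s with cnt := b :: s.cnt } 1 :=
  .basic (congrArg _ (Store.update_cnt _ _))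

/-- Push a bit on an auxiliary register. -/
def pushAux (b : Bool) (i : Fin 3) : Prog Lin Lout O :=
  .basic (.push (.inl (.aux i)) (fun _ => (b : Bool)) .halt)

theorem pushAux_does (b : Bool) (i : Fin 3) (s : Store Lin Lout O) :
    (pushAux b i).Does s { s with aux := Function.update s.aux i (b :: s.aux i) } 1 :=
  .basic (congrArg _ (Store.update_aux _ _ _))

/-- Remove a bit from `main`. -/
def popMain : Prog Lin Lout O := onMain (fun _ => skip) fun _ => false

theorem popMain_does {b : Bool} {w : List Bool} (hs : s.main = b :: w) :
    popMain.Does s { s with main := w } 3 :=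
  onMain_exit hs rfl (skip_does _)

/-- Push a word on `main`. -/
def pushWord : List Bool → Prog Lin Lout O
  | [] => skip
  | b :: w => (pushWord w).seq (pushMain b)

theorem pushWord_does (w : List Bool) (s : Store Lin Lout O) :
    (pushWord w).Does s { s with main := w ++ s.main } (w.length + 1) := by
  induction w with
  | nil => exact skip_does s
  | cons b w ih => exact ih.seq (pushMain_does b _)

/-- Push a bit on the auxiliary registers listed in `T`. -/
def pushAuxs (b : Bool) : List (Fin 3) → Prog Lin Lout O
  | [] => skip
  | i :: T => (pushAux b i).seq (pushAuxs b T)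

theorem pushAuxs_does (b : Bool) (T : List (Fin 3)) (hT : T.Nodup) (s : Store Lin Lout O) :
    (pushAuxs b T).Does s { s with aux := fun i => if i ∈ T then b :: s.aux i else s.aux i }
      (T.length + 1) := by
  induction T generalizing s with
  | nil => exact (skip_does s).to (by simp) le_rfl
  | cons j T ih =>
    rw [List.nodup_cons] at hT
    refine ((pushAux_does b j s).seq (ih hT.2 _)).to ?_ (by simp; omega)
    simp only [Store.mk.injEq, true_and, and_true]
    funext i
    by_cases h : i = j
    · subst h; simp [hT.1]
    · simp [h]

/-- Move the contents of an auxiliary register to `main`, in reversed order. -/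
def drain (i : Fin 3) : Prog Lin Lout O :=
  onAux i (fun o => o.elim skip pushMain) Option.isSome

theorem drain_does (i : Fin 3) (s : Store Lin Lout O) :
    (drain i).Does s
      { s with main := (s.aux i).reverse ++ s.main, aux := Function.update s.aux i [] }
      (3 * (s.aux i).length + 3) := by
  generalize hx : s.aux i = x
  induction x generalizing s with
  | nil =>
    refine onAux_exit hx rfl ?_
    rw [← hx, Function.update_eq_self, hx]
    exact skip_does s
  | cons b x ih =>
    refine (onAux_cont (M := fun o => o.elim skip pushMain) (cont := Option.isSome)
      hx rfl (pushMain_does b _) (ih _ (by simp))).to (by simp) ?_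
    simp only [List.length_cons]
    omega

/-- Move one bit from `main` to each of the auxiliary registers listed in `T`.  If it is the symbol
of a node, two more trees are to be read. -/
def moveBit (T : List (Fin 3)) : Prog Lin Lout O :=
  onMain (fun o => o.elim skip fun b =>
    (pushAuxs b T).seq (if b then (pushCnt true).seq (pushCnt true) else skip)) fun _ => false

theorem moveBit_does {T : List (Fin 3)} (hT : T.Nodup) {b : Bool} {w : List Bool}
    (hm : s.main = b :: w) :
    (moveBit T).Does s
      { s with
        main := w
        aux := fun i => if i ∈ T then b :: s.aux i else s.aux i
        cnt := if b then true :: true :: s.cnt else s.cnt }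
      (T.length + 5) := by
  cases b with
  | false => exact onMain_exit hm rfl (((pushAuxs_does false T hT _).seq (skip_does _)).mono (by omega))
  | true =>
    exact onMain_exit hm rfl ((pushAuxs_does true T hT _).seq
      ((pushCnt_does true _).seq (pushCnt_does true _)))

/-- Move one tree from `main` to each of the auxiliary registers listed in `T`, in reversed order.
The register `cnt` counts, in unary, the trees still to be read. -/
def moveTree (T : List (Fin 3)) : Prog Lin Lout O :=
  (pushCnt true).seq (onCnt (fun o => o.elim skip fun _ => moveBit T) Option.isSome)

theorem moveTree_does (T : List (Fin 3)) (hT : T.Nodup) {x : Dat} {w : List Bool}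
    (hm : s.main = x.ser ++ w) (hc : s.cnt = []) :
    (moveTree T).Does s
      { s with
        main := w
        aux := fun i => if i ∈ T then x.ser.reverse ++ s.aux i else s.aux i }
      ((T.length + 7) * x.size + 4) := by
  -- The invariant of the loop: one tree is read for each unit of `cnt`.
  have key : ∀ (x : Dat) (w n : List Bool) (s s' : Store Lin Lout O) (t : ℕ),
      s.main = x.ser ++ w → s.cnt = true :: n →
      (onCnt (fun o => o.elim skip fun _ => moveBit T) Option.isSome).Does
        { s with main := w, cnt := n,
                 aux := fun i => if i ∈ T then x.ser.reverse ++ s.aux i else s.aux i } s' t →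
      (onCnt (fun o => o.elim skip fun _ => moveBit T) Option.isSome).Does s s'
        (t + (T.length + 7) * x.size) := by
    intro x
    induction x with
    | leaf =>
      intro w n s s' t hm hc h
      refine (onCnt_cont hc rfl (moveBit_does (s := { s with cnt := n }) (b := false) (w := w) hT hm) h).mono ?_
      simp only [Dat.size]
      omega
    | node l r ihl ihr =>
      intro w n s s' t hm hc h
      have h₁ := ihl (r.ser ++ w) (true :: n)
        { s with main := l.ser ++ (r.ser ++ w), cnt := true :: true :: n,
                 aux := fun i => if i ∈ T then true :: s.aux i else s.aux i } s'
        (t + (T.length + 7) * r.size) rfl rfl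
        (ihr w n _ s' t rfl rfl (by
          refine cast ?_ h
          congr 2
          funext i
          by_cases hi : i ∈ T <;> simp [hi, Dat.ser]))
      refine (onCnt_cont hc rfl (moveBit_does (s := { s with cnt := n }) (b := true)
        (w := l.ser ++ (r.ser ++ w)) hT (by simp [hm, Dat.ser])) h₁).mono ?_
      simp only [Dat.size]
      ring_nf
      omega
  refine ((pushCnt_does true s).seq (t' := 3 + (T.length + 7) * x.size) ?_).mono (by omega)
  refine key x w [] _ _ _ hm (by simp [hc]) ?_
  refine (onCnt_exit rfl rfl (skip_does _)).to ?_ le_rfl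
  simp [hc]

/-- The store with the word `w` in `main` and all other stacks empty. -/
def base (w : List Bool) : Store Lin Lout O := ⟨w, fun _ => [], [], [], [], fun _ => []⟩

/-- Delete the tree on top of `main`. -/
def dropTree : Prog Lin Lout O := moveTree []

theorem dropTree_does (x : Dat) (w : List Bool) :
    (dropTree : Prog Lin Lout O).Does (base (x.ser ++ w)) (base w) (10 * x.size + 10) :=
  (moveTree_does [] (by simp) rfl rfl).to (by simp [base]) (by simp; omega)

/-- Copy the tree on top of `main`. -/
def dupTree : Prog Lin Lout O := (moveTree [0, 1]).seq ((drain 0).seq (drain 1))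

theorem dupTree_does (x : Dat) (w : List Bool) :
    (dupTree : Prog Lin Lout O).Does (base (x.ser ++ w)) (base (x.ser ++ (x.ser ++ w)))
      (20 * x.size + 20) := by
  refine ((moveTree_does [0, 1] (by simp) rfl rfl).seq ((drain_does 0 _).seq
    (drain_does 1 _))).to ?_ ?_
  · simp only [base, Store.mk.injEq, and_true]
    refine ⟨by simp, ?_⟩
    funext i
    fin_cases i <;> simp [Function.update]
  · simp [base]; omega

/-- Exchange the two trees on top of `main`. -/
def swapTree : Prog Lin Lout O :=
  (moveTree [0]).seq ((moveTree [1]).seq ((drain 0).seq (drain 1)))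

theorem swapTree_does (x y : Dat) (w : List Bool) :
    (swapTree : Prog Lin Lout O).Does (base (x.ser ++ (y.ser ++ w))) (base (y.ser ++ (x.ser ++ w)))
      (20 * (x.size + y.size) + 20) := by
  refine ((moveTree_does [0] (by simp) rfl rfl).seq ((moveTree_does [1] (by simp) (x := y) (w := w)
    rfl rfl).seq ((drain_does 0 _).seq (drain_does 1 _)))).to ?_ ?_
  · simp only [base, Store.mk.injEq, and_true]
    refine ⟨by simp, ?_⟩
    funext i
    fin_cases i <;> simp [Function.update]
  · simp [base]; omega

/-- Exchange the second and the third tree from the top of `main`. -/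
def swapBelow : Prog Lin Lout O :=
  (moveTree [0]).seq ((moveTree [1]).seq ((moveTree [2]).seq
    ((drain 1).seq ((drain 2).seq (drain 0)))))

theorem swapBelow_does (x y z : Dat) (w : List Bool) :
    (swapBelow : Prog Lin Lout O).Does (base (x.ser ++ (y.ser ++ (z.ser ++ w))))
      (base (x.ser ++ (z.ser ++ (y.ser ++ w)))) (20 * (x.size + y.size + z.size) + 40) := by
  refine ((moveTree_does [0] (by simp) rfl rfl).seq ((moveTree_does [1] (by simp) (x := y)
    (w := z.ser ++ w) rfl rfl).seq ((moveTree_does [2] (by simp) (x := z) (w := w) rfl rfl).seq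
    ((drain_does 1 _).seq ((drain_does 2 _).seq (drain_does 0 _)))))).to ?_ ?_
  · simp only [base, Store.mk.injEq, and_true]
    refine ⟨by simp, ?_⟩
    funext i
    fin_cases i <;> simp [Function.update]
  · simp [base]; omega

/-- Delete the second tree from the top of `main`. -/
def dropBelow : Prog Lin Lout O := (moveTree [0]).seq ((moveTree []).seq (drain 0))

theorem dropBelow_does (x y : Dat) (w : List Bool) :
    (dropBelow : Prog Lin Lout O).Does (base (x.ser ++ (y.ser ++ w))) (base (x.ser ++ w))
      (20 * (x.size + y.size) + 20) := by
  refine ((moveTree_does [0] (by simp) rfl rfl).seq ((moveTree_does [] (by simp) (x := y) (w := w)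
    rfl rfl).seq (drain_does 0 _))).to ?_ ?_
  · simp only [base, Store.mk.injEq, and_true]
    refine ⟨by simp, ?_⟩
    funext i
    fin_cases i <;> simp [Function.update]
  · simp [base]; omega

end Machine

/-! ### Polynomial-time functions on trees -/

/-- Evaluation of a polynomial with natural coefficients is monotone. -/
theorem eval_mono (p : Polynomial ℕ) : Monotone fun n => p.eval n := by
  intro a b h
  simp only [Polynomial.eval_eq_sum, Polynomial.sum]
  exact Finset.sum_le_sum fun i _ => Nat.mul_le_mul_left _ (Nat.pow_le_pow_left h i)

section PolyTimeOnTrees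

variable (Lin Lout : Type) (O : FinTM2)

/-- `f` is computed in polynomial time, with the encodings `ea` and `eb` by trees, on top of the
register `main`.  The size of the result is also bounded, so that compositions can be timed. -/
def PTE {α β : Type} (ea : α → Dat) (eb : β → Dat) (f : α → β) : Prop :=
  ∃ (M : Prog Lin Lout O) (p : Polynomial ℕ), ∀ a,
    (∀ w, M.Does (base ((ea a).ser ++ w)) (base ((eb (f a)).ser ++ w)) (p.eval (ea a).size)) ∧
    (eb (f a)).size ≤ p.eval (ea a).size

variable {Lin Lout O} {α β γ δ : Type} {ea : α → Dat} {eb : β → Dat} {ec : γ → Dat}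

theorem PTE.comp {g : β → γ} {f : α → β} (hg : PTE Lin Lout O eb ec g)
    (hf : PTE Lin Lout O ea eb f) : PTE Lin Lout O ea ec fun a => g (f a) := by
  obtain ⟨N, q, hq⟩ := hg
  obtain ⟨M, p, hp⟩ := hf
  refine ⟨M.seq N, p + q.comp p, fun a => ⟨fun w => ?_, ?_⟩⟩
  · refine (((hp a).1 w).seq ((hq (f a)).1 w)).mono ?_
    simp only [Polynomial.eval_add, Polynomial.eval_comp]
    exact Nat.add_le_add_left (eval_mono q (hp a).2) _
  · simp only [Polynomial.eval_add, Polynomial.eval_comp]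
    exact ((hq (f a)).2.trans (eval_mono q (hp a).2)).trans (Nat.le_add_left _ _)

theorem PTE.id : PTE Lin Lout O ea ea fun a => a :=
  ⟨skip, Polynomial.X + 1, fun a => ⟨fun w => (skip_does _).mono (by simp), by simp⟩⟩

/-- The relation `PTE` depends on the values only through their encodings. -/
theorem PTE.congr {α' β' : Type} {ea' : α' → Dat} {eb' : β' → Dat} {f : α → β} {f' : α' → β'}
    (hf : PTE Lin Lout O ea eb f)
    (h : ∀ a', ∃ a, ea' a' = ea a ∧ eb' (f' a') = eb (f a)) :
    PTE Lin Lout O ea' eb' f' := by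
  obtain ⟨M, p, hp⟩ := hf
  refine ⟨M, p, fun a' => ?_⟩
  obtain ⟨a, h₁, h₂⟩ := h a'
  rw [h₁, h₂]
  exact hp a

theorem PTE.const (b : β) : PTE Lin Lout O ea eb fun _ => b := by
  refine ⟨dropTree.seq (pushWord (eb b).ser), 10 * Polynomial.X + ((11 + (eb b).size : ℕ) : Polynomial ℕ),
    fun a => ⟨fun w => ?_, ?_⟩⟩
  · refine ((dropTree_does (ea a) w).seq (pushWord_does (eb b).ser _)).to rfl ?_
    simp
    omega
  · simp
    omega

theorem PTE.node {f : α → β} {g : α → γ} (hf : PTE Lin Lout O ea eb f)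
    (hg : PTE Lin Lout O ea ec g) :
    PTE Lin Lout O ea (fun x : β × γ => .node (eb x.1) (ec x.2)) fun a => (f a, g a) := by
  obtain ⟨M, p, hp⟩ := hf
  obtain ⟨N, q, hq⟩ := hg
  refine ⟨dupTree.seq (N.seq (swapTree.seq (M.seq (pushMain true)))),
    20 * Polynomial.X + 20 + q + (20 * (q + Polynomial.X) + 20) + p + 1,
    fun a => ⟨fun w => ?_, ?_⟩⟩
  · refine ((dupTree_does (ea a) w).seq (((hq a).1 _).seq ((swapTree_does _ _ w).seq
      (((hp a).1 _).seq (pushMain_does true _))))).to ?_ ?_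
    · simp [base, Dat.ser]
    · have := (hq a).2
      simp
      omega
  · have := (hq a).2
    have := (hp a).2
    simp [Dat.size]
    omega

/-- The tree of a bit. -/
def Dat.ofBool : Bool → Dat
  | false => .leaf
  | true => .node .leaf .leaf

/-- A function is computed in polynomial time if this holds on each of the two sides of a test. -/
theorem PTE.cases {c : α → Bool} {f : α → β} (hc : PTE Lin Lout O ea Dat.ofBool c)
    (h₁ : PTE Lin Lout O (fun a : {a // c a = true} => ea a) eb fun a => f a)
    (h₂ : PTE Lin Lout O (fun a : {a // c a = false} => ea a) eb fun a => f a) :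
    PTE Lin Lout O ea eb f := by
  obtain ⟨L, r, hr⟩ := hc
  obtain ⟨M, p, hp⟩ := h₁
  obtain ⟨N, q, hq⟩ := h₂
  refine ⟨dupTree.seq (L.seq (onMain (fun o => o.elim skip fun b => if b then
    popMain.seq (popMain.seq M) else N) fun _ => false)),
    20 * Polynomial.X + 20 + r + p + q + 8, fun a => ⟨fun w => ?_, ?_⟩⟩
  · have h := (hr a).1 ((ea a).ser ++ w)
    refine ((dupTree_does (ea a) w).seq (h.seq (t' := p.eval (ea a).size +
      q.eval (ea a).size + 8) ?_)).mono ?_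
    · cases hb : c a with
      | false =>
        refine Prog.Does.mono (onMain_exit (b := false) (w := (ea a).ser ++ w)
          (by simp [base, Dat.ofBool, Dat.ser]) rfl ((hq ⟨a, hb⟩).1 w)) ?_
        dsimp only
        omega
      | true =>
        refine Prog.Does.mono (onMain_exit (b := true) (w := false :: false :: ((ea a).ser ++ w))
          (by simp [base, Dat.ofBool, Dat.ser]) rfl ((popMain_does rfl).seq ((popMain_does rfl).seq
          ((hp ⟨a, hb⟩).1 w)))) ?_
        dsimp only
        omega
    · simp
      omega
  · cases hb : c a
    · have := (hq ⟨a, hb⟩).2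
      simp at this ⊢
      omega
    · have := (hp ⟨a, hb⟩).2
      simp at this ⊢
      omega

theorem PTE.ite {c : α → Bool} {f g : α → β} (hc : PTE Lin Lout O ea Dat.ofBool c)
    (hf : PTE Lin Lout O ea eb f) (hg : PTE Lin Lout O ea eb g) :
    PTE Lin Lout O ea eb fun a => bif c a then f a else g a :=
  .cases hc (hf.congr fun a => ⟨a, rfl, by simp [a.2]⟩) (hg.congr fun a => ⟨a, rfl, by simp [a.2]⟩)

/-- The test for being a leaf. -/
def Dat.isLeaf : Dat → Bool
  | .leaf => true
  | .node _ _ => false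

theorem PTE.isLeaf : PTE Lin Lout O (fun x => x) Dat.ofBool Dat.isLeaf := by
  refine ⟨onMain (fun o => o.elim skip fun b => if b then
    dropTree.seq (dropTree.seq (pushWord (Dat.ofBool false).ser)) else
    pushWord (Dat.ofBool true).ser) fun _ => false,
    20 * Polynomial.X + 30, fun a => ⟨fun w => ?_, ?_⟩⟩
  · cases a with
    | leaf =>
      refine Prog.Does.to (onMain_exit (b := false) (w := w) (by simp [base, Dat.ser]) rfl
        (pushWord_does _ _)) rfl ?_
      simp [Dat.ofBool, Dat.size]
    | node l r =>
      refine Prog.Does.to (onMain_exit (b := true) (w := l.ser ++ (r.ser ++ w))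
        (by simp [base, Dat.ser]) rfl ((dropTree_does l _).seq ((dropTree_does r w).seq
        (pushWord_does _ _)))) rfl ?_
      simp [Dat.ofBool, Dat.size]
      omega
  · cases a <;> simp [Dat.ofBool, Dat.isLeaf, Dat.size]

theorem PTE.left : PTE Lin Lout O (fun x : Dat × Dat => .node x.1 x.2) (fun x => x) Prod.fst := by
  refine ⟨popMain.seq dropBelow, 20 * Polynomial.X + 30, fun a => ⟨fun w => ?_, ?_⟩⟩
  · refine ((popMain_does (b := true) (w := a.1.ser ++ (a.2.ser ++ w)) (by simp [base, Dat.ser])).seq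
      (dropBelow_does _ _ w)).mono ?_
    simp [Dat.size]
    omega
  · simp [Dat.size]
    omega

theorem PTE.right : PTE Lin Lout O (fun x : Dat × Dat => .node x.1 x.2) (fun x => x) Prod.snd := by
  refine ⟨popMain.seq dropTree, 20 * Polynomial.X + 30, fun a => ⟨fun w => ?_, ?_⟩⟩
  · refine ((popMain_does (b := true) (w := a.1.ser ++ (a.2.ser ++ w)) (by simp [base, Dat.ser])).seq
      (dropTree_does _ _)).mono ?_
    simp [Dat.size]
    omega
  · simp [Dat.size]
    omega

open Classical in
/-- Comparison with a fixed tree. -/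
theorem PTE.eqConst (x : Dat) :
    PTE Lin Lout O (fun y => y) Dat.ofBool fun y => decide (y = x) := by
  induction x with
  | leaf => exact PTE.isLeaf.congr fun y => ⟨y, rfl, by cases y <;> simp [Dat.isLeaf]⟩
  | node l r ihl ihr =>
    refine .cases PTE.isLeaf ?_ ?_
    · refine (PTE.const (eb := Dat.ofBool) false).congr fun y => ⟨y, rfl, ?_⟩
      obtain ⟨_ | _, h⟩ := y
      · simp
      · cases h
    · refine ((PTE.ite (ihl.comp PTE.left) (ihr.comp PTE.right) (PTE.const false))).congr ?_
      rintro ⟨_ | ⟨l', r'⟩, h⟩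
      · cases h
      · refine ⟨(l', r'), rfl, ?_⟩
        by_cases h₁ : l' = l <;> simp [h₁]

/-- The tree of a list. -/
def Dat.ofList (e : α → Dat) : List α → Dat
  | [] => .leaf
  | a :: l => .node (e a) (Dat.ofList e l)

theorem Dat.size_mem_ofList {e : α → Dat} {l : List α} {a : α} (h : a ∈ l) :
    (e a).size ≤ (Dat.ofList e l).size := by
  induction l with
  | nil => cases h
  | cons b l ih =>
    simp only [ofList, size]
    rcases List.mem_cons.1 h with rfl | h
    · omega
    · have := ih h
      omega

theorem Dat.length_lt_size_ofList (e : α → Dat) (l : List α) :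
    l.length < (Dat.ofList e l).size := by
  induction l with
  | nil => simp [ofList, size]
  | cons b l ih =>
    simp only [ofList, size, List.length_cons]
    omega

/-- Bounded recursion along a list: if the intermediate results stay polynomially bounded, a
left fold of a polynomial-time function takes polynomial time. -/
theorem PTE.foldl {L : α → List β} {s : α → γ} {g : β × γ → γ}
    (hi : PTE Lin Lout O ea (fun x : List β × γ => .node (Dat.ofList eb x.1) (ec x.2))
      fun a => (L a, s a))
    (hg : PTE Lin Lout O (fun x : β × γ => .node (eb x.1) (ec x.2)) ec g)
    (hb : ∃ q : Polynomial ℕ, ∀ a, ∀ l, l <+: L a →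
      (ec (l.foldl (fun s b => g (b, s)) (s a))).size ≤ q.eval (ea a).size) :
    PTE Lin Lout O ea ec fun a => (L a).foldl (fun s b => g (b, s)) (s a) := by
  obtain ⟨I, r, hr⟩ := hi
  obtain ⟨M, p, hp⟩ := hg
  obtain ⟨q, hq⟩ := hb
  set W : Prog Lin Lout O := onMain (fun o => o.elim skip fun b => if b then
    swapBelow.seq ((pushMain true).seq (M.seq swapTree)) else skip) (fun o => o == some true)
    with hW
  -- One round of the loop takes the list and the state to the tail and the next state.
  have key : ∀ (B Q : ℕ) (l : List β) (c : γ) (w : List Bool), (Dat.ofList eb l).size ≤ B →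
      (∀ l', l' <+: l → (ec (l'.foldl (fun s b => g (b, s)) c)).size ≤ Q) →
      W.Does (base ((Dat.ofList eb l).ser ++ ((ec c).ser ++ w)))
        (base ((ec (l.foldl (fun s b => g (b, s)) c)).ser ++ w))
        (l.length * (40 * B + 60 * Q + p.eval (B + Q + 1) + 70) + 3) := by
    intro B Q l
    induction l with
    | nil =>
      intro c w _ _
      exact Prog.Does.mono (onMain_exit (b := false) rfl rfl (skip_does _)) (by simp)
    | cons b l ih =>
      intro c w hB hQ
      simp only [Dat.ofList, Dat.size] at hB
      have h₀ := hQ [] (by simp)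
      have h₁ := hQ [b] (by simp)
      simp only [List.foldl_nil, List.foldl_cons] at h₀ h₁
      have hr := ih (g (b, c)) w (by omega) fun l' hl => hQ (b :: l') (by simpa using hl)
      have hM : M.Does (base (true :: ((eb b).ser ++ ((ec c).ser ++ ((Dat.ofList eb l).ser ++ w)))))
          (base ((ec (g (b, c))).ser ++ ((Dat.ofList eb l).ser ++ w))) (p.eval (B + Q + 1)) := by
        have := ((hp (b, c)).1 ((Dat.ofList eb l).ser ++ w)).mono
          (eval_mono p (show _ ≤ B + Q + 1 by simp only [Dat.size]; omega))
        simpa [Dat.ser] using this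
      refine Prog.Does.mono (onMain_cont (b := true)
        (w := (eb b).ser ++ ((Dat.ofList eb l).ser ++ ((ec c).ser ++ w)))
        (by simp [base, Dat.ofList, Dat.ser]) rfl
        ((swapBelow_does (eb b) _ _ w).seq ((pushMain_does true _).seq
          (hM.seq (swapTree_does _ _ w)))) hr) ?_
      simp only [List.length_cons]
      ring_nf
      omega
  refine ⟨I.seq (popMain.seq W),
    r + 3 + r * (40 * r + 60 * q + p.comp (r + q + 1) + 70) + 3 + q,
    fun a => ⟨fun w => ?_, ?_⟩⟩
  · have hs := (hr a).2
    simp only [Dat.size] at hs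
    have hl := Dat.length_lt_size_ofList eb (L a)
    refine (((hr a).1 w).seq ((popMain_does (b := true)
      (w := (Dat.ofList eb (L a)).ser ++ ((ec (s a)).ser ++ w)) (by simp [base, Dat.ser])).seq
      (key (r.eval (ea a).size) (q.eval (ea a).size) (L a) (s a) w (by omega) (hq a)))).mono ?_
    simp only [Polynomial.eval_add, Polynomial.eval_mul, Polynomial.eval_comp,
      Polynomial.eval_one, Polynomial.eval_ofNat]
    have := Nat.mul_le_mul_right (40 * r.eval (ea a).size + 60 * q.eval (ea a).size +
      p.eval (r.eval (ea a).size + q.eval (ea a).size + 1) + 70)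
      (show (L a).length ≤ r.eval (ea a).size by omega)
    omega
  · refine (hq a _ List.prefix_rfl).trans ?_
    simp only [Polynomial.eval_add]
    exact Nat.le_add_left _ _

end PolyTimeOnTrees

/-! ### Input, output and subroutines -/

/-- The tree of a number, in unary. -/
def Dat.ofNat : ℕ → Dat
  | 0 => .leaf
  | n + 1 => .node .leaf (Dat.ofNat n)

theorem Dat.size_ofNat (n : ℕ) : (Dat.ofNat n).size = 2 * n + 1 := by
  induction n with
  | zero => rfl
  | succ n ih => simp only [ofNat, size, ih]; omega

theorem Dat.ofNat_injective : Function.Injective Dat.ofNat := by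
  intro m n h
  have := congrArg Dat.size h
  simp only [size_ofNat] at this
  omega

/-- The tree of an element of a finite type: its index in a fixed enumeration of the type. -/
noncomputable def Dat.ofFinite {τ : Type} [Finite τ] (x : τ) : Dat :=
  Dat.ofNat (Finite.equivFin τ x)

theorem Dat.ofFinite_injective {τ : Type} [Finite τ] :
    Function.Injective (Dat.ofFinite : τ → Dat) := fun _ _ h =>
  (Finite.equivFin τ).injective (Fin.val_injective (Dat.ofNat_injective h))

section InputOutput

variable {Lin Lout : Type} {O : FinTM2}

/-- The store with `w` in `main` and `x` in the input register. -/
def withInp (w : List Bool) (x : List Lin) : Store Lin Lout O :=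
  ⟨w, fun _ => [], [], x, [], fun _ => []⟩

/-- The store with `w` in `main` and `x` in the output register. -/
def withOut (w : List Bool) (x : List Lout) : Store Lin Lout O :=
  ⟨w, fun _ => [], [], [], x, fun _ => []⟩

/-- Read the tree of a number `j` from `main` and run `M (i + j)`, if `j < m`. -/
def readNat (M : ℕ → Prog Lin Lout O) (i : ℕ) : ℕ → Prog Lin Lout O
  | 0 => skip
  | m + 1 => onMain (fun o => o.elim skip fun b => if b then popMain.seq (readNat M (i + 1) m)
      else M i) fun _ => false

theorem readNat_does {M : ℕ → Prog Lin Lout O} {i j m : ℕ} (hj : j < m)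
    {s s' : Store Lin Lout O} {w : List Bool} {t : ℕ} (hs : s.main = (Dat.ofNat j).ser ++ w)
    (h : (M (i + j)).Does { s with main := w } s' t) :
    (readNat M i m).Does s s' (t + 5 * j + 2) := by
  induction m generalizing i j s with
  | zero => omega
  | succ m ih =>
    cases j with
    | zero => exact (onMain_exit hs rfl h).mono (by omega)
    | succ j =>
      refine (onMain_exit (b := true) (w := false :: ((Dat.ofNat j).ser ++ w))
        (by simpa [Dat.ofNat, Dat.ser] using hs) rfl ((popMain_does rfl).seq
        (ih (i := i + 1) (j := j) (by omega) rfl ?_))).mono (t := 3 + (t + 5 * j + 2) + 2) ?_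
      · rw [Nat.add_assoc, Nat.add_comm 1 j]
        exact h
      · omega

/-- Read the tree of a list of elements of a finite type from `main`, and run `M` on each of its
elements in order. -/
noncomputable def readList {τ : Type} [Finite τ] (M : τ → Prog Lin Lout O) : Prog Lin Lout O :=
  onMain (fun o => o.elim skip fun b => if b then
      readNat (fun i => if h : i < Nat.card τ then M ((Finite.equivFin τ).symm ⟨i, h⟩) else skip) 0
        (Nat.card τ) else skip)
    fun o => o == some true

theorem readList_does {τ ρ : Type} [Finite τ] {M : τ → Prog Lin Lout O} (u : τ → ρ)
    (T : List Bool → List ρ → Store Lin Lout O) (hT : ∀ w w' x, { T w x with main := w' } = T w' x)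
    (hm : ∀ w x, (T w x).main = w) (hM : ∀ a w x, (M a).Does (T w x) (T w (u a :: x)) 1)
    (l : List τ) (w : List Bool) (x : List ρ) :
    (readList M).Does (T ((Dat.ofList Dat.ofFinite l).ser ++ w) x) (T w ((l.map u).reverse ++ x))
      (10 * (Dat.ofList Dat.ofFinite l).size) := by
  induction l generalizing x with
  | nil =>
    refine Prog.Does.to (onMain_exit (b := false) (w := w) (hm _ _) rfl (skip_does _)) ?_
      (by simp [Dat.ofList, Dat.size])
    simp [hT]
  | cons a l ih =>
    refine Prog.Does.to (onMain_cont (b := true)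
      (w := (Dat.ofFinite a).ser ++ ((Dat.ofList Dat.ofFinite l).ser ++ w))
      (by simp [hm, Dat.ofList, Dat.ser]) rfl (readNat_does (j := Finite.equivFin τ a) (by simp) rfl
      ?_) (ih (u a :: x))) (by simp) (t := 1 + 5 * (Finite.equivFin τ a : ℕ) + 2 + 2 + _) ?_
    · simp only [zero_add, Fin.is_lt, dite_true, Fin.eta, Equiv.symm_apply_apply, hT]
      exact hM a _ _
    · simp only [Dat.ofList, Dat.ofFinite, Dat.size, Dat.size_ofNat]
      omega

/-- Write a letter to the output. -/
def writeOut (ℓ : Lout) : Prog Lin Lout O := .basic (.push (.inl .out) (fun _ => (ℓ : Lout)) .halt)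

theorem writeOut_does (ℓ : Lout) (s : Store Lin Lout O) :
    (writeOut ℓ).Does s { s with out := ℓ :: s.out } 1 :=
  .basic (congrArg _ (Store.update_out _ _))

/-- Push a symbol on a stack of the subroutine. -/
def writeOrc (k : O.K) (x : O.Γ k) : Prog Lin Lout O :=
  .basic (.push (.inr k) (fun _ => (x : O.Γ k)) .halt)

theorem writeOrc_does (k : O.K) (x : O.Γ k) (s : Store Lin Lout O) :
    (writeOrc k x).Does s { s with orc := Function.update s.orc k (x :: s.orc k) } 1 :=
  .basic (congrArg _ (Store.update_orc _ _ _))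

/-- Read the input register. -/
def inpProbe [Fintype Lin] : Probe (Alph Lin Lout O) (Var Lin O) (.inl .inp) where
  ι := Option Lin
  fin := inferInstance
  sym := fun o => o
  put i := (none, i, O.initialState)
  get v := v.2.1
  get_put _ := rfl

/-- Turn the input word into the tree of the reversed word. -/
noncomputable def load [Fintype Lin] : Prog Lin Lout O :=
  (pushMain false).seq (.loop (rest Lin O) inpProbe (fun o : Option Lin =>
    o.elim skip fun ℓ => pushWord (true :: (Dat.ofFinite ℓ).ser)) Option.isSome)

theorem load_does [Fintype Lin] (x : List Lin) :
    (load : Prog Lin Lout O).Does (withInp [] x)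
      (base (Dat.ofList Dat.ofFinite x.reverse).ser)
      ((∑ ℓ : Lin, (Dat.ofFinite ℓ).size + 4) * x.length + 4) := by
  have key : ∀ (x y : List Lin), Prog.Does (.loop (rest Lin O) inpProbe (fun o : Option Lin =>
      o.elim skip fun ℓ => pushWord (true :: (Dat.ofFinite ℓ).ser)) Option.isSome : Prog Lin Lout O)
      (withInp (Dat.ofList Dat.ofFinite y).ser x)
      (base (Dat.ofList Dat.ofFinite (x.reverse ++ y)).ser)
      ((∑ ℓ : Lin, (Dat.ofFinite ℓ).size + 4) * x.length + 3) := by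
    intro x
    induction x with
    | nil =>
      intro y
      exact Prog.Does.mono (Frag.Run.loop_exit none rfl (Store.update_inp _ _) rfl (skip_does _))
        (by simp)
    | cons ℓ x ih =>
      intro y
      refine Prog.Does.to (Frag.Run.loop_cont (some ℓ) rfl (Store.update_inp _ _) rfl
        (pushWord_does (true :: (Dat.ofFinite ℓ).ser) _) (ih (ℓ :: y))) (by simp) ?_
      · have := Finset.single_le_sum (f := fun ℓ : Lin => (Dat.ofFinite ℓ).size)
          (fun _ _ => Nat.zero_le _) (Finset.mem_univ ℓ)
        simp only [List.length_cons, Dat.length_ser] at this ⊢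
        ring_nf
        omega
  refine ((pushMain_does false _).seq (key x [])).to (by simp) (by omega)

/-- A function on words computed on trees is computed by a machine. -/
theorem polyTime_of_pte {α β : Type} [Fintype Lin] [Finite Lout] {ea : α → List Lin}
    {eb : β → List Lout} {f : α → β}
    (h : PTE Lin Lout O (fun a => Dat.ofList Dat.ofFinite (ea a).reverse)
      (fun b => Dat.ofList Dat.ofFinite (eb b).reverse) f) :
    PolyTime ea eb f := by
  obtain ⟨M, p, hp⟩ := h
  let N : Prog Lin Lout O := load.seq (M.seq (readList writeOut))
  set B := ∑ ℓ : Lin, (Dat.ofFinite ℓ).size with hB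
  have hsize : ∀ x : List Lin, (Dat.ofList Dat.ofFinite x.reverse).size ≤ (B + 1) * x.length + 1 := by
    intro x
    rw [← List.length_reverse]
    induction x.reverse with
    | nil => simp [Dat.ofList, Dat.size]
    | cons ℓ x ih =>
      have := Finset.single_le_sum (f := fun ℓ : Lin => (Dat.ofFinite ℓ).size)
        (fun _ _ => Nat.zero_le _) (Finset.mem_univ ℓ)
      simp only [Dat.ofList, Dat.size, List.length_cons] at this ⊢
      rw [Nat.mul_add]
      omega
  let r : Polynomial ℕ := ((B + 1 : ℕ) : Polynomial ℕ) * Polynomial.X + 1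
  have hr : ∀ n, r.eval n = (B + 1) * n + 1 := by
    intro n
    simp only [r, Polynomial.eval_add, Polynomial.eval_mul, Polynomial.eval_natCast,
      Polynomial.eval_X, Polynomial.eval_one]
    simp
  have hN : ∀ a, N.Does (withInp [] (ea a)) (withOut [] (eb (f a)))
      ((((B + 4 : ℕ) : Polynomial ℕ) * Polynomial.X + 4 + (p.comp r + 10 * p.comp r)).eval
        (ea a).length) := by
    intro a
    have h₁ := load_does (Lout := Lout) (O := O) (ea a)
    have h₂ := (hp a).1 []
    have h₃ := readList_does (Lin := Lin) (O := O) (M := writeOut) (fun ℓ => ℓ)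
      withOut
      (fun _ _ _ => rfl) (fun _ _ => rfl) (fun ℓ w x => writeOut_does ℓ (withOut w x)) (eb (f a)).reverse [] []
    simp only [List.append_nil, List.map_id', List.reverse_reverse] at h₂ h₃
    refine (h₁.seq (h₂.seq h₃)).mono ?_
    have h₄ := (hp a).2
    have h₅ := eval_mono p ((hsize (ea a)).trans (hr _).ge)
    simp only [Polynomial.eval_add, Polynomial.eval_mul, Polynomial.eval_natCast,
      Polynomial.eval_X, Polynomial.eval_ofNat, Polynomial.eval_comp] at h₄ h₅ ⊢
    have h₆ : ((B + 4 : ℕ) : ℕ) * (ea a).length = (B + 4) * (ea a).length := rfl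
    simp only [← hB, Nat.cast_id] at *
    omega
  choose t ht hsteps using hN
  let _ := N.fin
  let _ := O.kFin
  let _ := O.σFin
  let tm : FinTM2 :=
    { K := Reg ⊕ O.K
      k₀ := .inl .inp
      k₁ := .inl .out
      Γ := Alph Lin Lout O
      Λ := N.Λ
      main := N.main
      σ := Var Lin O
      initialState := rest Lin O
      Γk₀Fin := (inferInstance : Fintype Lin)
      m := N.m }
  refine ⟨{ tm := tm
            inputAlphabet := Equiv.refl Lin
            outputAlphabet := Equiv.refl Lout
            time := _
            outputsFun := fun a => ⟨⟨t a, ?_⟩, ht a⟩ }⟩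
  have := (hsteps a).iterate_eq
  have e₁ : initList tm (List.map (Equiv.refl Lin).invFun (ea a)) =
      ⟨some N.main, rest Lin O, (withInp [] (ea a)).stk⟩ := by
    refine (congrArg (initList tm) (List.map_id (ea a))).trans ?_
    unfold initList
    congr 1
    funext k
    rcases k with (_ | _ | _ | _ | _) | k <;> rfl
  have e₂ : haltList tm (List.map (Equiv.refl Lout).invFun (eb (f a))) =
      ⟨none, rest Lin O, (withOut [] (eb (f a))).stk⟩ := by
    refine (congrArg (haltList tm) (List.map_id (eb (f a)))).trans ?_
    unfold haltList
    congr 1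
    funext k
    rcases k with (_ | _ | _ | _ | _) | k <;> rfl
  rw [e₁]
  refine this.trans ?_
  exact (congrArg some e₂).symm

/-- The statement of the subroutine, acting on its own stacks and internal state. -/
def liftStmt : TM2.Stmt O.Γ O.Λ O.σ → TM2.Stmt (Alph Lin Lout O) O.Λ (Var Lin O)
  | .push k g q => .push (.inr k) (fun v => g v.2.2) (liftStmt q)
  | .peek k g q => .peek (.inr k) (fun v o => (v.1, v.2.1, g v.2.2 o)) (liftStmt q)
  | .pop k g q => .pop (.inr k) (fun v o => (v.1, v.2.1, g v.2.2 o)) (liftStmt q)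
  | .load g q => .load (fun v => (v.1, v.2.1, g v.2.2)) (liftStmt q)
  | .branch g q q' => .branch (fun v => g v.2.2) (liftStmt q) (liftStmt q')
  | .goto g => .goto fun v => g v.2.2
  | .halt => .halt

/-- The configuration of the subroutine, extended by the store `s`. -/
def liftCfg (s : Store Lin Lout O) (c : TM2.Cfg O.Γ O.Λ O.σ) :
    TM2.Cfg (Alph Lin Lout O) O.Λ (Var Lin O) :=
  ⟨c.l, (none, none, c.var), { s with orc := c.stk }.stk⟩

theorem stepAux_liftStmt (s : Store Lin Lout O) (q : TM2.Stmt O.Γ O.Λ O.σ) (v : O.σ)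
    (S : ∀ k, List (O.Γ k)) :
    TM2.stepAux (liftStmt q) ((none, none, v) : Var Lin O) { s with orc := S }.stk =
      liftCfg s (TM2.stepAux q v S) := by
  induction q generalizing v S with
  | push k g q ih =>
    refine Eq.trans ?_ (ih v (Function.update S k (g v :: S k)))
    exact congrArg _ (Store.update_orc _ _ _)
  | peek k g q ih => exact ih (g v (S k).head?) S
  | pop k g q ih =>
    refine Eq.trans ?_ (ih (g v (S k).head?) (Function.update S k (S k).tail))
    exact congrArg _ (Store.update_orc _ _ _)
  | load g q ih => exact ih (g v) S
  | branch g q q' ih ih' =>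
    simp only [liftStmt, TM2.stepAux]
    cases g v
    · exact ih' v S
    · exact ih v S
  | goto g => rfl
  | halt => rfl

/-- The subroutine as a fragment. -/
def callOrc : Prog Lin Lout O := ⟨O.Λ, O.ΛFin, O.main, fun l => liftStmt (O.m l)⟩

theorem liftCfg_steps (s : Store Lin Lout O) {t : ℕ} {c c' : TM2.Cfg O.Γ O.Λ O.σ}
    (h : Steps O.m t c c') :
    Steps (callOrc : Prog Lin Lout O).m t (liftCfg s c) (liftCfg s c') := by
  induction h with
  | refl => exact .refl _
  | @head t c c₁ c₂ hs _ ih =>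
    refine .head ?_ ih
    obtain ⟨_ | l, v, S⟩ := c
    · cases hs
    · simp only [TM2.step, Option.some.injEq] at hs
      rw [← hs]
      exact congrArg some (stepAux_liftStmt s (O.m l) v S)

/-- The store with `w` in `main` and `x` in the stack `k` of the subroutine. -/
def withOrc (k : O.K) (w : List Bool) (x : List (O.Γ k)) : Store Lin Lout O :=
  ⟨w, fun _ => [], [], [], [], Function.update (fun _ => []) k x⟩

/-- Move a bit from the stack `k` of the subroutine to `main`, as a tree. -/
def readAnswer (k : O.K) (e : O.Γ k → Bool) : Prog Lin Lout O :=
  .loop (rest Lin O) (bitProbe (.inr k) e)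
    (fun o : Option Bool => o.elim skip fun b => pushWord (Dat.ofBool b).ser) fun _ => false

theorem readAnswer_does (k : O.K) (e : O.Γ k → Bool) (w : List Bool) (x : O.Γ k) :
    (readAnswer k e : Prog Lin Lout O).Does (withOrc k w [x])
      (base ((Dat.ofBool (e x)).ser ++ w)) 10 := by
  refine Prog.Does.to (Frag.Run.loop_exit (some (e x)) ?_ (Store.update_orc _ _ _) rfl
    (pushWord_does _ _)) ?_ ?_
  · change Option.map e (Function.update (fun _ => []) k [x] k).head? = _
    rw [Function.update_self]
    rfl
  · simp only [withOrc, base, Store.mk.injEq, true_and]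
    funext j
    by_cases h : j = k
    · subst h
      refine (Function.update_self _ _ _).trans ?_
      change (Function.update (fun _ => []) j [x] j).tail = []
      rw [Function.update_self]
      rfl
    · refine (Function.update_of_ne h _ _).trans ?_
      exact Function.update_of_ne h _ _
  · cases e x <;> simp [Dat.ofBool, Dat.size]

/-- A problem decided by a machine in polynomial time is decided in polynomial time with this machine
as a subroutine. -/
theorem PTE.subroutine {α Lor : Type} [Finite Lor] {ea : α → List Lor} {f : α → Bool}
    (tc : TM2ComputableInPolyTime ea Computability.encodeBool f) :
    PTE Lin Lout tc.tm (fun a => Dat.ofList Dat.ofFinite (ea a).reverse) Dat.ofBool f := by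
  refine ⟨(readList fun ℓ => writeOrc tc.tm.k₀ (tc.inputAlphabet.symm ℓ)).seq
    (callOrc.seq (readAnswer tc.tm.k₁ tc.outputAlphabet)),
    10 * Polynomial.X + tc.time + 10, fun a => ⟨fun w => ?_, ?_⟩⟩
  · have h₁ := readList_does (Lin := Lin) (Lout := Lout)
      (M := fun ℓ => writeOrc tc.tm.k₀ (tc.inputAlphabet.symm ℓ))
      (fun ℓ => tc.inputAlphabet.symm ℓ) (withOrc tc.tm.k₀) (fun _ _ _ => rfl) (fun _ _ => rfl)
      (fun ℓ w x => (writeOrc_does _ _ _).to (by simp [withOrc]) le_rfl) (ea a).reverse w []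
    have e₀ : ∀ w', withOrc tc.tm.k₀ w' [] = (base w' : Store Lin Lout tc.tm) := fun w' => by
      simp only [withOrc, base, Store.mk.injEq, true_and]
      exact Function.update_eq_self _ _
    rw [e₀] at h₁
    have h₂ := liftCfg_steps (Lin := Lin) (Lout := Lout) (base w)
      (Steps.of_iterate_eq (tc.outputsFun a).evals_in_steps)
    have e₁ : liftCfg (Lin := Lin) (Lout := Lout) (base w)
        (initList tc.tm (List.map tc.inputAlphabet.invFun (ea a))) =
        ⟨some tc.tm.main, rest Lin tc.tm, (withOrc tc.tm.k₀ w
          ((((ea a).reverse.map fun ℓ => tc.inputAlphabet.symm ℓ)).reverse ++ [])).stk⟩ := by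
      simp only [liftCfg, initList, withOrc, base, List.map_reverse, List.reverse_reverse,
        List.append_nil]
      congr 3
      funext k
      by_cases h : k = tc.tm.k₀
      · subst h; simp
      · simp [h]
    have e₂ : liftCfg (Lin := Lin) (Lout := Lout) (base w)
        (haltList tc.tm (List.map tc.outputAlphabet.invFun (Computability.encodeBool (f a)))) =
        ⟨none, rest Lin tc.tm, (withOrc tc.tm.k₁ w [tc.outputAlphabet.symm (f a)]).stk⟩ := by
      simp only [liftCfg, haltList, withOrc, base]
      congr 3
      funext k
      by_cases h : k = tc.tm.k₁
      · subst h; simp; rfl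
      · simp [h]
    have h₃ : (callOrc : Prog Lin Lout tc.tm).Does _ _ (tc.time.eval (ea a).length) :=
      ⟨_, (tc.outputsFun a).steps_le_m, e₂ ▸ e₁ ▸ h₂⟩
    refine (Prog.Does.seq (h₁.to rfl le_rfl) (h₃.seq (readAnswer_does _ _ w _))).to
      (congrArg (fun b => base ((Dat.ofBool b).ser ++ w)) (Equiv.apply_symm_apply _ _)) ?_
    have h₄ := Dat.length_lt_size_ofList Dat.ofFinite (ea a).reverse
    rw [List.length_reverse] at h₄
    have h₅ := eval_mono tc.time h₄.le
    simp only [Polynomial.eval_add, Polynomial.eval_mul, Polynomial.eval_X,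
      Polynomial.eval_ofNat] at h₅ ⊢
    omega
  · have : (Dat.ofBool (f a)).size ≤ 10 := by cases f a <;> simp [Dat.ofBool, Dat.size]
    simp
    omega

end InputOutput

/-! ### Polynomial-time functions on lists and numbers -/

/-- A type whose elements are encoded by trees. -/
class Enc (α : Type) where
  enc : α → Dat

open Enc


/-- The size of (the tree of) an element. -/
abbrev esize {α : Type} [Enc α] (a : α) : ℕ := (enc a).size

instance : Enc Bool := ⟨Dat.ofBool⟩
instance : Enc ℕ := ⟨Dat.ofNat⟩
instance : Enc Unit := ⟨fun _ => .leaf⟩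
instance {α β : Type} [Enc α] [Enc β] : Enc (α × β) := ⟨fun x => .node (enc x.1) (enc x.2)⟩
instance {α : Type} [Enc α] : Enc (List α) := ⟨Dat.ofList enc⟩
noncomputable instance {k : ℕ} : Enc (Fin k) := ⟨Dat.ofFinite⟩
noncomputable instance {α β : Type} [Finite α] [Finite β] : Enc (α ⊕ β) := ⟨Dat.ofFinite⟩
noncomputable instance {α : Type} [Finite α] : Enc (Option α) := ⟨Dat.ofFinite⟩
noncomputable instance {α : Type} [Finite α] : Enc (Set α) := ⟨Dat.ofFinite⟩

/-- A finite type with an injective encoding. -/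
class FinEnc (α : Type) [Enc α] : Prop where
  fin : Finite α
  inj : Function.Injective (enc : α → Dat)

instance : FinEnc Bool := ⟨inferInstance, by intro a b; cases a <;> cases b <;> simp [enc, Dat.ofBool]⟩
instance {k : ℕ} : FinEnc (Fin k) := ⟨inferInstance, Dat.ofFinite_injective⟩
instance {α β : Type} [Finite α] [Finite β] : FinEnc (α ⊕ β) := ⟨inferInstance, Dat.ofFinite_injective⟩
instance {α : Type} [Finite α] : FinEnc (Option α) := ⟨inferInstance, Dat.ofFinite_injective⟩
instance {α : Type} [Finite α] : FinEnc (Set α) := ⟨inferInstance, Dat.ofFinite_injective⟩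
instance {α β : Type} [Enc α] [Enc β] [FinEnc α] [FinEnc β] : FinEnc (α × β) where
  fin := have := FinEnc.fin (α := α); have := FinEnc.fin (α := β); inferInstance
  inj := by
    rintro ⟨a, b⟩ ⟨a', b'⟩ h
    simp only [enc, Dat.node.injEq] at h
    rw [FinEnc.inj h.1, FinEnc.inj h.2]

/-- The data that machines refer to: the input and output alphabets and a subroutine. -/
structure Ctx where
  Lin : Type
  Lout : Type
  O : FinTM2

/-- `f` is computed in polynomial time on trees. -/
@[fun_prop]
def PT (C : Ctx) {α β : Type} [Enc α] [Enc β] (f : α → β) : Prop :=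
  PTE C.Lin C.Lout C.O enc enc f

section Library

variable {C : Ctx} {α β γ δ ε : Type} [Enc α] [Enc β] [Enc γ] [Enc δ] [Enc ε]

@[fun_prop]
theorem PT.id : PT C fun a : α => a := PTE.id

@[fun_prop]
theorem PT.const (b : β) : PT C fun _ : α => b := PTE.const b

@[fun_prop]
theorem PT.comp {g : β → γ} {f : α → β} (hg : PT C g) (hf : PT C f) : PT C fun a => g (f a) :=
  PTE.comp hg hf

@[fun_prop]
theorem PT.pair {f : α → β} {g : α → γ} (hf : PT C f) (hg : PT C g) : PT C fun a => (f a, g a) :=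
  PTE.node hf hg

@[fun_prop]
theorem PT.fst : PT C fun x : α × β => x.1 :=
  PTE.left.congr fun x => ⟨(enc x.1, enc x.2), rfl, rfl⟩

@[fun_prop]
theorem PT.snd : PT C fun x : α × β => x.2 :=
  PTE.right.congr fun x => ⟨(enc x.1, enc x.2), rfl, rfl⟩

@[fun_prop]
theorem PT.cond {c : α → Bool} {f g : α → β} (hc : PT C c) (hf : PT C f) (hg : PT C g) :
    PT C fun a => bif c a then f a else g a :=
  PTE.ite hc hf hg

@[fun_prop]
theorem PT.and {f g : α → Bool} (hf : PT C f) (hg : PT C g) : PT C fun a => f a && g a :=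
  (PT.cond hf hg (.const false)).congr fun a => ⟨a, rfl, by cases f a <;> simp⟩

@[fun_prop]
theorem PT.or {f g : α → Bool} (hf : PT C f) (hg : PT C g) : PT C fun a => f a || g a :=
  (PT.cond hf (.const true) hg).congr fun a => ⟨a, rfl, by cases f a <;> simp⟩

@[fun_prop]
theorem PT.not {f : α → Bool} (hf : PT C f) : PT C fun a => !f a :=
  (PT.cond hf (.const false) (.const true)).congr fun a => ⟨a, rfl, by cases f a <;> simp⟩

@[fun_prop]
theorem PT.cons {f : α → β} {g : α → List β} (hf : PT C f) (hg : PT C g) :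
    PT C fun a => f a :: g a :=
  (PT.pair hf hg).congr fun a => ⟨a, rfl, rfl⟩

theorem PT.isEmpty {f : α → List β} (hf : PT C f) : PT C fun a => (f a).isEmpty :=
  (PTE.isLeaf.comp hf : PTE _ _ _ _ _ _).congr fun a => ⟨a, rfl, by cases h : f a <;> rfl⟩

/-- Case distinction on whether a list is empty. -/
theorem PT.listCases {f : α → List β} {n : α → γ} {c : α → β → List β → γ} (hf : PT C f)
    (hn : PT C n) (hc : PT C fun x : α × β × List β => c x.1 x.2.1 x.2.2) :
    PT C fun a => match f a with
      | [] => n a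
      | b :: l => c a b l := by
  refine PTE.cases hf.isEmpty ?_ ?_
  · refine hn.congr fun a => ⟨a, rfl, ?_⟩
    obtain ⟨a, ha⟩ := a
    rw [List.isEmpty_iff] at ha
    simp [ha]
  · have h₁ : PTE C.Lin C.Lout C.O (fun a : {a // (f a).isEmpty = false} => enc (a.1, f a.1)) enc
        fun a => match f a.1 with
          | [] => n a.1
          | b :: l => c a.1 b l := by
      refine hc.congr fun ⟨a, ha⟩ => ?_
      rcases h : f a with _ | ⟨b, l⟩
      · simp [h] at ha
      · exact ⟨(a, b, l), rfl, rfl⟩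
    exact h₁.comp ((PT.pair (C := C) .id hf).congr fun a => ⟨a.1, rfl, rfl⟩)

theorem PT.eqConst [FinEnc α] [DecidableEq α] (t : α) : PT C fun x : α => decide (x = t) :=
  (PTE.eqConst (enc t)).congr fun x => ⟨enc x, rfl,
    congrArg Dat.ofBool (decide_eq_decide.2 FinEnc.inj.eq_iff.symm)⟩

/-- A function of a pair is computed in polynomial time if the first component ranges over a finite
type and this holds for each of its values. -/
theorem PT.finCases [FinEnc α] {f : α × β → γ} (h : ∀ t, PT C fun b => f (t, b)) : PT C f := by
  classical
  have := FinEnc.fin (α := α)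
  have := Fintype.ofFinite α
  have key : ∀ ts : List α, PTE C.Lin C.Lout C.O (fun x : {x : α × β // x.1 ∈ ts} => enc x.1) enc
      fun x => f x := by
    intro ts
    induction ts with
    | nil => exact ⟨skip, 0, fun x => by simpa using x.2⟩
    | cons t ts ih =>
      refine PTE.cases (c := fun x => decide (x.1.1 = t)) (PTE.congr
        ((PT.eqConst (C := C) t).comp (PT.fst (α := α) (β := β))) fun x => ⟨x.1, rfl, rfl⟩) ?_ ?_
      · refine PTE.congr ((h t).comp (PT.snd (α := α) (β := β))) fun x => ⟨x.1.1, rfl, ?_⟩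
        have := x.2
        simp only [decide_eq_true_eq] at this
        exact congrArg (fun t => enc (f (t, x.1.1.2))) this
      · refine ih.congr fun x => ⟨⟨x.1.1, ?_⟩, rfl, rfl⟩
        have h₁ := x.2
        have h₂ := x.1.2
        simp only [decide_eq_false_iff_not] at h₁
        simpa [h₁] using h₂
  exact (key Finset.univ.toList).congr fun x => ⟨⟨x, by simp⟩, rfl, rfl⟩

/-- Every function on a finite type is computed in polynomial time. -/
theorem PT.ofFinite [FinEnc α] (f : α → β) : PT C f :=
  (PT.finCases (f := fun x : α × Unit => f x.1) fun t => .const (f t)).comp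
    (PT.pair .id (.const ()))

/-- Every binary function on finite types is computed in polynomial time. -/
theorem PT.ofFinite₂ [FinEnc β] [FinEnc γ] (F : β → γ → δ) {f : α → β} {g : α → γ} (hf : PT C f)
    (hg : PT C g) : PT C fun a => F (f a) (g a) :=
  (PT.ofFinite fun x : β × γ => F x.1 x.2).comp (PT.pair hf hg)

theorem esize_pair (a : α) (b : β) : esize (a, b) = esize a + esize b + 1 := rfl

theorem esize_nil : esize ([] : List α) = 1 := rfl

theorem esize_cons (a : α) (l : List α) : esize (a :: l) = esize a + esize l + 1 := rfl

theorem esize_bool (b : Bool) : esize b ≤ 3 := by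
  cases b <;> simp [esize, enc, Dat.ofBool, Dat.size]

theorem esize_nat (n : ℕ) : esize n = 2 * n + 1 := Dat.size_ofNat n

theorem esize_list (l : List α) : esize l = (l.map fun a => esize a + 1).sum + 1 := by
  induction l with
  | nil => rfl
  | cons a l ih => rw [esize_cons, ih, List.map_cons, List.sum_cons]; omega

theorem length_lt_esize (l : List α) : l.length < esize l := Dat.length_lt_size_ofList _ l

theorem esize_mem {l : List α} {a : α} (h : a ∈ l) : esize a ≤ esize l := Dat.size_mem_ofList h

theorem esize_sublist {l l' : List α} (h : l.Sublist l') : esize l ≤ esize l' := by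
  rw [esize_list, esize_list]
  exact Nat.add_le_add_right ((h.map _).sum_le_sum fun _ _ => Nat.zero_le _) 1

theorem esize_append (l l' : List α) : esize (l ++ l') + 1 = esize l + esize l' := by
  simp only [esize_list, List.map_append, List.sum_append]
  omega

theorem esize_reverse (l : List α) : esize l.reverse = esize l := by
  simp only [esize_list, List.map_reverse, List.sum_reverse]

theorem esize_le_of_forall {l : List α} {N S : ℕ} (hN : l.length ≤ N) (hS : ∀ a ∈ l, esize a ≤ S) :
    esize l ≤ N * (S + 1) + 1 := by
  rw [esize_list]
  refine Nat.add_le_add_right ((List.sum_le_card_nsmul _ (S + 1) ?_).trans ?_) 1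
  · simpa using hS
  · simpa using Nat.mul_le_mul_right (S + 1) hN

/-- The size of the result of a polynomial-time function is polynomially bounded. -/
theorem PT.bound {f : α → β} (hf : PT C f) : ∃ p : Polynomial ℕ, ∀ a, esize (f a) ≤ p.eval (esize a) :=
  let ⟨_, p, hp⟩ := hf
  ⟨p, fun a => (hp a).2⟩

/-- A left fold with polynomially bounded intermediate results. -/
theorem PT.foldl {L : α → List β} {s : α → γ} {G : α → γ → β → γ} (hL : PT C L) (hs : PT C s)
    (hG : PT C fun x : α × γ × β => G x.1 x.2.1 x.2.2)
    (hb : ∃ q : Polynomial ℕ, ∀ a l, l <+: L a → esize (l.foldl (G a) (s a)) ≤ q.eval (esize a)) :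
    PT C fun a => (L a).foldl (G a) (s a) := by
  obtain ⟨q, hq⟩ := hb
  -- The parameter `a` is carried along with the state of the fold.
  have e : ∀ (a : α) (c : γ) (l : List β),
      l.foldl (fun (s : α × γ) b => (s.1, G s.1 s.2 b)) (a, c) = (a, l.foldl (G a) c) := by
    intro a c l
    induction l generalizing c with
    | nil => rfl
    | cons b l ih => exact ih _
  have h : PT C fun a => (L a).foldl (fun (s : α × γ) b => (s.1, G s.1 s.2 b)) (a, s a) := by
    refine PTE.foldl (g := fun x : β × α × γ => (x.2.1, G x.2.1 x.2.2 x.1)) (PT.pair hL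
      (PT.pair .id hs)) ?_ ⟨Polynomial.X + q + 1, fun a l hl => ?_⟩
    · have : PT C fun x : β × α × γ => (x.2.1, x.2.2, x.1) := by fun_prop
      exact PT.pair (by fun_prop : PT C fun x : β × α × γ => x.2.1) (hG.comp this)
    · rw [e]
      have := hq a l hl
      change esize (a, l.foldl (G a) (s a)) ≤ (Polynomial.X + q + 1).eval (esize a)
      rw [esize_pair]
      simp only [Polynomial.eval_add, Polynomial.eval_X, Polynomial.eval_one]
      omega
  simp only [e] at h
  exact PT.snd.comp h

@[fun_prop]
theorem PT.reverse {L : α → List β} (hL : PT C L) : PT C fun a => (L a).reverse := by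
  have e : ∀ l s : List β, l.foldl (fun acc b => b :: acc) s = l.reverse ++ s := by
    intro l
    induction l with
    | nil => simp
    | cons b l ih => simp [ih]
  have : PT C fun a => (L a).foldl (fun acc b => b :: acc) [] := by
    refine PT.foldl (G := fun _ acc b => b :: acc) hL (.const _) (by fun_prop) ?_
    obtain ⟨p, hp⟩ := hL.bound
    refine ⟨p, fun a l hl => ?_⟩
    rw [e, List.append_nil, esize_reverse]
    exact (esize_sublist hl.sublist).trans (hp a)
  simpa [e] using this

theorem PT.foldr {L : α → List β} {s : α → γ} {G : α → β → γ → γ} (hL : PT C L) (hs : PT C s)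
    (hG : PT C fun x : α × β × γ => G x.1 x.2.1 x.2.2)
    (hb : ∃ q : Polynomial ℕ, ∀ a l, l <:+ L a → esize (l.foldr (G a) (s a)) ≤ q.eval (esize a)) :
    PT C fun a => (L a).foldr (G a) (s a) := by
  obtain ⟨q, hq⟩ := hb
  have : PT C fun a => (L a).reverse.foldl (fun c b => G a b c) (s a) := by
    refine PT.foldl (G := fun a c b => G a b c) hL.reverse hs (hG.comp (f := fun x : α × γ × β =>
      (x.1, x.2.2, x.2.1)) (by fun_prop)) ⟨q, fun a l hl => ?_⟩
    have := hq a l.reverse (by rw [← List.reverse_prefix]; simpa using hl)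
    simpa using this
  simpa using this

theorem PT.map {L : α → List β} {F : α → β → γ} (hL : PT C L)
    (hF : PT C fun x : α × β => F x.1 x.2) : PT C fun a => (L a).map (F a) := by
  have e : ∀ a (l : List β), l.foldr (fun b acc => F a b :: acc) [] = l.map (F a) := by
    intro a l
    induction l with
    | nil => rfl
    | cons b l ih => simp [ih]
  have : PT C fun a => (L a).foldr (fun b acc => F a b :: acc) [] := by
    refine PT.foldr (G := fun a b acc => F a b :: acc) hL (.const _) (PT.cons (hF.comp
      (f := fun x : α × β × List γ => (x.1, x.2.1)) (by fun_prop)) (by fun_prop)) ?_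
    obtain ⟨p, hp⟩ := hL.bound
    obtain ⟨q, hq⟩ := hF.bound
    refine ⟨p * (q.comp (Polynomial.X + p + 1) + 1) + 1, fun a l hl => ?_⟩
    rw [e]
    have h₁ := length_lt_esize (L a)
    have h₂ := hp a
    have h₃ := hl.sublist.length_le
    refine (esize_le_of_forall (N := p.eval (esize a)) (S := q.eval (esize a + p.eval (esize a) + 1))
      (by simp; omega) ?_).trans (by simp)
    intro c hc
    obtain ⟨b, hb, rfl⟩ := List.mem_map.1 hc
    refine (hq (a, b)).trans (eval_mono q ?_)
    have := esize_mem (hl.sublist.subset hb)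
    rw [esize_pair]
    omega
  simpa only [e] using this

theorem PT.filter {L : α → List β} {F : α → β → Bool} (hL : PT C L)
    (hF : PT C fun x : α × β => F x.1 x.2) : PT C fun a => (L a).filter (F a) := by
  have e : ∀ a (l : List β), l.foldr (fun b acc => bif F a b then b :: acc else acc) [] =
      l.filter (F a) := by
    intro a l
    induction l with
    | nil => rfl
    | cons b l ih => cases h : F a b <;> simp [h, ih]
  have : PT C fun a => (L a).foldr (fun b acc => bif F a b then b :: acc else acc) [] := by
    refine PT.foldr (G := fun a b acc => bif F a b then b :: acc else acc) hL (.const _) (PT.cond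
      (hF.comp (f := fun x : α × β × List β => (x.1, x.2.1)) (by fun_prop)) (by fun_prop)
      (by fun_prop)) ?_
    obtain ⟨p, hp⟩ := hL.bound
    refine ⟨p, fun a l hl => ?_⟩
    rw [e]
    exact (esize_sublist (List.filter_sublist.trans hl.sublist)).trans (hp a)
  simpa only [e] using this

theorem PT.any {L : α → List β} {F : α → β → Bool} (hL : PT C L)
    (hF : PT C fun x : α × β => F x.1 x.2) : PT C fun a => (L a).any (F a) := by
  have e : ∀ a (l : List β), l.foldr (fun b acc => F a b || acc) false = l.any (F a) := by
    intro a l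
    induction l with
    | nil => rfl
    | cons b l ih => simp [ih]
  have : PT C fun a => (L a).foldr (fun b acc => F a b || acc) false :=
    PT.foldr (G := fun a b acc => F a b || acc) hL (.const _) (PT.or
      (hF.comp (f := fun x : α × β × Bool => (x.1, x.2.1)) (by fun_prop)) (by fun_prop))
      ⟨3, fun a l _ => by simpa using esize_bool _⟩
  simpa only [e] using this

theorem PT.all {L : α → List β} {F : α → β → Bool} (hL : PT C L)
    (hF : PT C fun x : α × β => F x.1 x.2) : PT C fun a => (L a).all (F a) := by
  have := (PT.any (F := fun a b => !F a b) hL hF.not).not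
  refine this.congr fun a => ⟨a, rfl, ?_⟩
  rw [List.not_any_eq_all_not]
  simp

@[fun_prop]
theorem PT.append {L L' : α → List β} (hL : PT C L) (hL' : PT C L') :
    PT C fun a => L a ++ L' a := by
  have : PT C fun a => (L a).foldr (fun b acc => b :: acc) (L' a) := by
    refine PT.foldr (G := fun _ b acc => b :: acc) hL hL' (by fun_prop) ?_
    obtain ⟨p, hp⟩ := hL.bound
    obtain ⟨q, hq⟩ := hL'.bound
    refine ⟨p + q, fun a l hl => ?_⟩
    rw [show l.foldr (fun b acc => b :: acc) (L' a) = l ++ L' a by simp]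
    have h₁ := esize_append l (L' a)
    have h₂ := esize_sublist hl.sublist
    have h₃ := hp a
    have h₄ := hq a
    simp only [Polynomial.eval_add]
    omega
  simpa using this

theorem esize_flatten (l : List (List α)) : esize l.flatten ≤ esize l := by
  induction l with
  | nil => exact le_rfl
  | cons x l ih =>
    have := esize_append x l.flatten
    rw [List.flatten_cons, esize_cons]
    omega

theorem PT.flatMap {L : α → List β} {F : α → β → List γ} (hL : PT C L)
    (hF : PT C fun x : α × β => F x.1 x.2) : PT C fun a => (L a).flatMap (F a) := by
  have h := PT.map hL hF
  have e : ∀ l : List (List γ), l.foldr (fun x acc => x ++ acc) [] = l.flatten := by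
    intro l
    induction l with
    | nil => rfl
    | cons x l ih => simp [ih]
  have : PT C fun a => ((L a).map (F a)).foldr (fun x acc => x ++ acc) [] := by
    refine PT.foldr (G := fun _ x acc => x ++ acc) h (.const _) (by fun_prop) ?_
    obtain ⟨p, hp⟩ := h.bound
    refine ⟨p, fun a l hl => ?_⟩
    rw [e]
    exact (esize_flatten l).trans ((esize_sublist hl.sublist).trans (hp a))
  simpa only [e, ← List.flatMap_def] using this

@[fun_prop]
theorem PT.tail {L : α → List β} (hL : PT C L) : PT C fun a => (L a).tail := by
  have : PT C fun a => match L a with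
      | [] => []
      | _ :: l => l :=
    PT.listCases (c := fun _ _ l => l) hL (.const []) (by fun_prop)
  convert this using 2 with a
  cases L a <;> rfl

theorem PT.headD {L : α → List β} (hL : PT C L) (d : β) : PT C fun a => (L a).headD d := by
  have : PT C fun a => match L a with
      | [] => d
      | b :: _ => b :=
    PT.listCases (c := fun _ b _ => b) hL (.const d) (by fun_prop)
  convert this using 2 with a
  cases L a <;> rfl

/-- A number, as the list of its units. -/
@[fun_prop]
theorem PT.replicate {f : α → ℕ} (hf : PT C f) : PT C fun a => List.replicate (f a) () := by
  have e : ∀ n, enc n = enc (List.replicate n ()) := by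
    intro n
    induction n with
    | zero => rfl
    | succ n ih =>
      rw [List.replicate_succ]
      exact congrArg (Dat.node .leaf) ih
  exact PTE.congr hf fun a => ⟨a, rfl, (e _).symm⟩

@[fun_prop]
theorem PT.succ {f : α → ℕ} (hf : PT C f) : PT C fun a => f a + 1 :=
  (PT.pair (.const ()) hf).congr fun a => ⟨a, rfl, rfl⟩

theorem PT.isZero {f : α → ℕ} (hf : PT C f) : PT C fun a => decide (f a = 0) :=
  (PT.isEmpty hf.replicate).congr fun a => ⟨a, rfl, by cases f a <;> rfl⟩

theorem PT.pred {f : α → ℕ} (hf : PT C f) : PT C fun a => f a - 1 := by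
  refine (PT.tail hf.replicate).congr fun a => ⟨a, rfl, ?_⟩
  cases f a with
  | zero => rfl
  | succ n =>
    simp only [List.replicate_succ, List.tail_cons, Nat.add_sub_cancel]
    induction n with
    | zero => rfl
    | succ n ih =>
      rw [List.replicate_succ]
      exact congrArg (Dat.node .leaf) ih

theorem foldl_pred (n : ℕ) {ι : Type} (l : List ι) : l.foldl (fun m _ => m - 1) n = n - l.length := by
  induction l generalizing n with
  | nil => rfl
  | cons _ l ih => simp only [List.foldl_cons, ih, List.length_cons]; omega

theorem PT.sub {f g : α → ℕ} (hf : PT C f) (hg : PT C g) : PT C fun a => f a - g a := by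
  have : PT C fun a => (List.replicate (g a) ()).foldl (fun m _ => m - 1) (f a) := by
    refine PT.foldl (G := fun _ m _ => m - 1) hg.replicate hf (PT.pred (by fun_prop)) ?_
    obtain ⟨p, hp⟩ := hf.bound
    refine ⟨p, fun a l _ => ?_⟩
    have := hp a
    rw [foldl_pred]
    rw [esize_nat] at this ⊢
    omega
  simpa [foldl_pred] using this

@[fun_prop]
theorem PT.eqNat {f g : α → ℕ} (hf : PT C f) (hg : PT C g) : PT C fun a => decide (f a = g a) := by
  have := (PT.isZero (PT.sub hf hg)).and (PT.isZero (PT.sub hg hf))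
  convert this using 2 with a
  rw [← Bool.decide_and, decide_eq_decide]
  omega

theorem foldl_tail {ι κ : Type} (n : List κ) (l : List ι) :
    l.foldl (fun m _ => m.tail) n = n.drop l.length := by
  induction l generalizing n with
  | nil => rfl
  | cons _ l ih => simp [ih]

theorem PT.getD {L : α → List β} {f : α → ℕ} (hL : PT C L) (hf : PT C f) (d : β) :
    PT C fun a => (L a).getD (f a) d := by
  have : PT C fun a => (List.replicate (f a) ()).foldl (fun m _ => m.tail) (L a) := by
    refine PT.foldl (G := fun _ m _ => m.tail) hf.replicate hL (PT.tail (by fun_prop)) ?_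
    obtain ⟨p, hp⟩ := hL.bound
    refine ⟨p, fun a l _ => ?_⟩
    rw [foldl_tail]
    exact (esize_sublist (List.drop_sublist _ _)).trans (hp a)
  simp only [foldl_tail, List.length_replicate] at this
  convert PT.headD this d using 2 with a
  simp [List.getD_eq_getElem?_getD, List.headD_eq_head?_getD]

theorem foldr_range {ι : Type} (l : List ι) :
    l.foldr (fun _ acc => 0 :: acc.map (· + 1)) [] = List.range l.length := by
  induction l with
  | nil => rfl
  | cons _ l ih => rw [List.foldr_cons, ih, List.length_cons, List.range_succ_eq_map]

theorem PT.rangeLength {L : α → List β} (hL : PT C L) : PT C fun a => List.range (L a).length := by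
  have : PT C fun a => (L a).foldr (fun _ acc => 0 :: acc.map (· + 1)) [] := by
    refine PT.foldr (G := fun _ _ acc => 0 :: acc.map (· + 1)) hL (.const _)
      (PT.cons (.const 0) (PT.map (F := fun _ n => n + 1) (by fun_prop) (by fun_prop))) ?_
    obtain ⟨p, hp⟩ := hL.bound
    refine ⟨p * (2 * p + 1 + 1) + 1, fun a l hl => ?_⟩
    rw [foldr_range]
    have h₁ := length_lt_esize l
    have h₂ := esize_sublist hl.sublist
    have h₃ := hp a
    refine (esize_le_of_forall (N := p.eval (esize a)) (S := 2 * p.eval (esize a) + 1)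
      (by simp; omega) ?_).trans (by simp)
    intro n hn
    rw [List.mem_range] at hn
    rw [esize_nat]
    omega
  simpa only [foldr_range] using this

end Library

/-! ### Reading an instance -/

instance {σ : Sig} (H : Str σ) : Finite H.carrier := H.finite

/-- An instance is given to programs as its word. -/
noncomputable instance {σ : Sig} : Enc (AnyInst σ) := ⟨fun P => enc (encodeInst P)⟩

theorem esize_ofFinite_le {τ : Type} [Finite τ] (x : τ) :
    (Dat.ofFinite x).size ≤ 2 * Nat.card τ + 1 := by
  rw [Dat.ofFinite, Dat.size_ofNat]
  have := (Finite.equivFin τ x).2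
  omega

section Parse

variable {σ : Sig} {C : Ctx}

/-- What has been read of an instance: sorts of variables, constraints, and the scope of a constraint
whose relation symbol has not been read yet. -/
abbrev Partial (σ : Sig) : Type := List (Fin σ.sorts) × List (Fin σ.rels × List ℕ) × List ℕ

/-- Add a unit to the first number of a list. -/
def incHead : List ℕ → List ℕ
  | [] => []
  | n :: l => (n + 1) :: l

/-- Read one letter; words are read from right to left. -/
def readLetter : Letter σ → Partial σ → Partial σ
  | .inl (.inl i), s => (i :: s.1, s.2)
  | .inl (.inr j), s => (s.1, (j, s.2.2) :: s.2.1, [])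
  | .inr true, s => (s.1, s.2.1, incHead s.2.2)
  | .inr false, s => (s.1, s.2.1, 0 :: s.2.2)

theorem pt_incHead : PT C incHead :=
  (PT.listCases (C := C) (c := fun _ n l => (n + 1) :: l) .id (.const []) (by fun_prop)).congr
    fun a => ⟨a, rfl, by cases a <;> rfl⟩

theorem pt_readLetter : PT C fun x : Letter σ × Partial σ => readLetter x.1 x.2 := by
  refine PT.finCases fun ℓ => ?_
  have := pt_incHead (C := C)
  rcases ℓ with (i | j) | (_ | _) <;> simp only [readLetter] <;> fun_prop

theorem esize_readLetter (ℓ : Letter σ) (s : Partial σ) :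
    esize (readLetter ℓ s) ≤ esize s + (2 * σ.sorts + 2 * σ.rels + 5) := by
  obtain ⟨a, b, c⟩ := s
  rcases ℓ with (i | j) | (_ | _)
  · have : esize i ≤ _ := esize_ofFinite_le i
    rw [Nat.card_fin] at this
    simp only [readLetter, esize_pair, esize_cons]
    omega
  · have : esize j ≤ _ := esize_ofFinite_le j
    rw [Nat.card_fin] at this
    simp only [readLetter, esize_pair, esize_cons, esize_nil]
    omega
  · simp only [readLetter, esize_pair, esize_cons, esize_nat]
    omega
  · cases c with
    | nil => simp [readLetter, incHead]
    | cons n c =>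
      simp only [readLetter, incHead, esize_pair, esize_cons, esize_nat]
      omega

/-- Read a word from right to left. -/
def parse (w : List (Letter σ)) : Partial σ := w.foldr readLetter ([], [], [])

theorem pt_parse : PT C (parse : List (Letter σ) → Partial σ) := by
  refine PT.foldr (G := fun _ ℓ s => readLetter ℓ s) .id (.const ([], [], []))
    (pt_readLetter.comp (f := fun x : List (Letter σ) × Letter σ × Partial σ => x.2) (by fun_prop)) ?_
  refine ⟨((2 * σ.sorts + 2 * σ.rels + 5 : ℕ) : Polynomial ℕ) * Polynomial.X + 5,
    fun w l hl => ?_⟩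
  have h₁ : esize (l.foldr readLetter (([], [], []) : Partial σ)) ≤
      (2 * σ.sorts + 2 * σ.rels + 5) * l.length + 5 := by
    clear hl
    induction l with
    | nil => simp [esize_pair, esize_nil]
    | cons ℓ l ih =>
      have := esize_readLetter ℓ (l.foldr readLetter ([], [], []))
      rw [List.foldr_cons, List.length_cons, Nat.mul_add]
      omega
  refine h₁.trans ?_
  simp only [Polynomial.eval_add, Polynomial.eval_mul, Polynomial.eval_natCast, Polynomial.eval_X,
    Polynomial.eval_ofNat, Nat.cast_id]
  exact Nat.add_le_add_right (Nat.mul_le_mul_left _ (hl.length_le.trans (length_lt_esize w).le)) 5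

theorem foldr_readLetter_var (v : ℕ) (s : Partial σ) :
    (List.replicate v (Sum.inr true) ++ [Sum.inr false]).foldr readLetter s =
      (s.1, s.2.1, v :: s.2.2) := by
  induction v with
  | zero => rfl
  | succ v ih =>
    rw [List.replicate_succ, List.cons_append, List.foldr_cons, ih]
    rfl

theorem foldr_readLetter_scope {n : ℕ} (l : List (Fin n)) (s : Partial σ) :
    (l.flatMap fun v => List.replicate v.val (Sum.inr true) ++ [Sum.inr false]).foldr readLetter s =
      (s.1, s.2.1, l.map Fin.val ++ s.2.2) := by
  induction l with
  | nil => rfl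
  | cons v l ih => rw [List.flatMap_cons, List.foldr_append, ih, foldr_readLetter_var]; rfl

theorem foldr_readLetter_sorts (l : List (Fin σ.sorts)) (s : Partial σ) :
    (l.map fun i => Sum.inl (Sum.inl i)).foldr readLetter s = (l ++ s.1, s.2) := by
  induction l with
  | nil => rfl
  | cons i l ih => rw [List.map_cons, List.foldr_cons, ih]; rfl

/-- The sorts of the variables of an instance. -/
def sortList (P : AnyInst σ) : List (Fin σ.sorts) := List.ofFn P.2.sort

/-- The constraints of an instance, with variables as numbers. -/
def consList (P : AnyInst σ) : List (Fin σ.rels × List ℕ) :=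
  P.2.cons.map fun c => (c.1, c.2.map Fin.val)

theorem parse_encodeInst (P : AnyInst σ) : parse (encodeInst P) = (sortList P, consList P, []) := by
  have : ∀ l : List (Fin σ.rels × List (Fin P.1)), (l.flatMap fun c => Sum.inl (Sum.inr c.1) ::
      c.2.flatMap fun v => List.replicate v.val (Sum.inr true) ++ [Sum.inr false]).foldr readLetter
      (([], [], []) : Partial σ) = ([], l.map fun c => (c.1, c.2.map Fin.val), []) := by
    intro l
    induction l with
    | nil => rfl
    | cons c l ih =>
      rw [List.flatMap_cons, List.foldr_append, ih, List.foldr_cons, foldr_readLetter_scope]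
      simp [readLetter]
  rw [parse, encodeInst, List.foldr_append, this, foldr_readLetter_sorts]
  simp [sortList, consList]

theorem pt_parsed : PT C fun P : AnyInst σ => parse (encodeInst P) :=
  PTE.congr (pt_parse (C := C)) fun P => ⟨encodeInst P, rfl, rfl⟩

@[fun_prop]
theorem pt_sortList : PT C (sortList : AnyInst σ → _) := by
  have := PT.fst.comp (pt_parsed (C := C) (σ := σ))
  simpa only [parse_encodeInst] using this

@[fun_prop]
theorem pt_consList : PT C (consList : AnyInst σ → _) := by
  have := (PT.fst.comp PT.snd).comp (pt_parsed (C := C) (σ := σ))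
  simpa only [parse_encodeInst] using this

end Parse

section MoreLists

variable {C : Ctx} {α β γ : Type} [Enc α] [Enc β] [Enc γ]

theorem PT.getElem? [Finite β] {L : α → List β} {f : α → ℕ} (hL : PT C L) (hf : PT C f)
    [FinEnc β] : PT C fun a => (L a)[f a]? := by
  have := PT.getD (PT.map (F := fun _ b => some b) hL ((PT.ofFinite some).comp PT.snd)) hf none
  convert this using 2 with a
  simp [List.getD_eq_getElem?_getD]
  cases (L a)[f a]? <;> rfl

theorem enc_list_injective [FinEnc α] : Function.Injective (enc : List α → Dat) := by
  intro l
  induction l with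
  | nil => rintro (_ | ⟨b, l'⟩) h <;> simp_all [enc, Dat.ofList]
  | cons a l ih =>
    rintro (_ | ⟨b, l'⟩) h
    · simp [enc, Dat.ofList] at h
    · simp only [enc, Dat.ofList, Dat.node.injEq] at h
      rw [FinEnc.inj h.1, ih h.2]

theorem PT.eqConstList [FinEnc α] [DecidableEq α] (t : List α) : PT C fun x : List α => decide (x = t) :=
  (PTE.eqConst (enc t)).congr fun x => ⟨enc x, rfl,
    congrArg Dat.ofBool (decide_eq_decide.2 enc_list_injective.eq_iff.symm)⟩

end MoreLists

/-! ### Refinements with prescribed domains -/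

section Assemble

variable {σ : Sig} {H : Str σ} (G : Refinement H) {C : Ctx}

open Classical in
/-- A sort of the refinement with base `s` and domain `U`, if there is one. -/
noncomputable def Refinement.pickSort (s : Option (Fin σ.sorts)) (U : Set H.carrier) :
    Option (Fin G.sig.sorts) :=
  if h : ∃ i, some (G.base i) = s ∧ G.dom i = U then some h.choose else none

open Classical in
/-- The first symbol from a list of relation symbols of `G` that has the type `τ` and stands for the
restriction of the relation `j` of `H`. -/
noncomputable def Refinement.pickRelFrom (j : Fin σ.rels) (τ : List (Option (Fin G.sig.sorts))) :
    List (Fin G.sig.rels) → Option (Fin G.sig.rels)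
  | [] => none
  | j' :: l =>
    bif decide (τ = (G.sig.type j').map some) &&
      decide (G.str.rel j' = pullback G.str.sort G.ξ (G.sig.type j') (H.rel j)) then some j'
    else pickRelFrom j τ l

/-- A relation symbol of `G` that has the type `τ` and stands for the restriction of the relation `j`
of `H`, if there is one. -/
noncomputable def Refinement.pickRel (j : Fin σ.rels) (τ : List (Option (Fin G.sig.sorts))) :
    Option (Fin G.sig.rels) :=
  G.pickRelFrom j τ (List.finRange _)

variable {G}

theorem Refinement.pickSort_eq_some {s : Option (Fin σ.sorts)} {U : Set H.carrier}
    {i : Fin G.sig.sorts} (h : G.pickSort s U = some i) : some (G.base i) = s ∧ G.dom i = U := by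
  unfold pickSort at h
  split at h
  case isTrue h' =>
    obtain rfl := Option.some.inj h
    exact h'.choose_spec
  case isFalse => cases h

theorem Refinement.pickSort_isSome {s : Option (Fin σ.sorts)} {U : Set H.carrier}
    (h : ∃ i, some (G.base i) = s ∧ G.dom i = U) : ∃ i, G.pickSort s U = some i :=
  ⟨h.choose, dif_pos h⟩

theorem Refinement.pickRel_eq_some {j : Fin σ.rels} {τ : List (Option (Fin G.sig.sorts))}
    {j' : Fin G.sig.rels} (h : G.pickRel j τ = some j') :
    τ = (G.sig.type j').map some ∧
      G.str.rel j' = pullback G.str.sort G.ξ (G.sig.type j') (H.rel j) := by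
  unfold pickRel at h
  generalize List.finRange G.sig.rels = l at h
  induction l with
  | nil => cases h
  | cons k l ih =>
    rw [pickRelFrom] at h
    cases hk : decide (τ = (G.sig.type k).map some) &&
      decide (G.str.rel k = pullback G.str.sort G.ξ (G.sig.type k) (H.rel j)) with
    | false => rw [hk] at h; exact ih h
    | true =>
      rw [hk] at h
      obtain rfl := Option.some.inj h
      simpa using hk

theorem Refinement.pickRel_isSome {j : Fin σ.rels} {τ : List (Option (Fin G.sig.sorts))}
    (h : ∃ j', τ = (G.sig.type j').map some ∧
      G.str.rel j' = pullback G.str.sort G.ξ (G.sig.type j') (H.rel j)) :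
    ∃ j', G.pickRel j τ = some j' := by
  obtain ⟨j', h₁, h₂⟩ := h
  have hm : j' ∈ List.finRange G.sig.rels := List.mem_finRange j'
  unfold pickRel
  generalize List.finRange G.sig.rels = l at hm ⊢
  induction l with
  | nil => cases hm
  | cons k l ih =>
    rw [pickRelFrom]
    cases hk : decide (τ = (G.sig.type k).map some) &&
      decide (G.str.rel k = pullback G.str.sort G.ξ (G.sig.type k) (H.rel j)) with
    | false =>
      rcases List.mem_cons.1 hm with rfl | hm
      · simp [h₁] at hk
        exact absurd h₂ hk
      · exact ih hm
    | true => exact ⟨k, rfl⟩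

theorem pt_pickRel : PT C fun x : Fin σ.rels × List (Option (Fin G.sig.sorts)) =>
    G.pickRel x.1 x.2 := by
  refine PT.finCases fun j => ?_
  change PT C fun τ => G.pickRel j τ
  unfold Refinement.pickRel
  generalize List.finRange G.sig.rels = l
  induction l with
  | nil => exact .const none
  | cons k l ih =>
    simp only [Refinement.pickRelFrom]
    exact PT.cond (PT.and (PT.eqConstList _) (PT.const _)) (.const _) ih

variable (G) (U : AnyInst σ → ℕ → Set H.carrier)

/-- The sort of the variable `v` in the refinement with domains `U`. -/
noncomputable def newSort (P : AnyInst σ) (v : ℕ) : Option (Fin G.sig.sorts) :=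
  G.pickSort (sortList P)[v]? (U P v)

/-- The relation symbol of the lift of a constraint in the refinement with domains `U`. -/
noncomputable def newRel (P : AnyInst σ) (c : Fin σ.rels × List ℕ) : Option (Fin G.sig.rels) :=
  G.pickRel c.1 (c.2.map (newSort G U P))

/-- The word of the refinement with domains `U`, or the empty word (which stands for the instance
without variables) if there is none. -/
noncomputable def newWord (P : AnyInst σ) : List (Letter G.sig) :=
  bif (List.range (sortList P).length).all (fun v => (newSort G U P v).isSome) &&
      (consList P).all fun c => (newRel G U P c).isSome then
    ((List.range (sortList P).length).flatMap fun v =>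
      (newSort G U P v).toList.map fun i => Sum.inl (Sum.inl i)) ++
    (consList P).flatMap fun c =>
      ((newRel G U P c).toList.map fun j => Sum.inl (Sum.inr j)) ++
        c.2.flatMap fun v => (List.replicate v ()).map (fun _ => Sum.inr true) ++ [Sum.inr false]
  else []

variable {G U}

theorem pt_newSort (hU : PT C fun x : AnyInst σ × ℕ => U x.1 x.2) :
    PT C fun x : AnyInst σ × ℕ => newSort G U x.1 x.2 :=
  PT.ofFinite₂ (f := fun x : AnyInst σ × ℕ => (sortList x.1)[x.2]?) (g := fun x => U x.1 x.2)
    (Refinement.pickSort G) (PT.getElem? (by fun_prop) (by fun_prop)) hU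

theorem pt_newRel (hU : PT C fun x : AnyInst σ × ℕ => U x.1 x.2) :
    PT C fun x : AnyInst σ × Fin σ.rels × List ℕ => newRel G U x.1 x.2 := by
  have h₁ : PT C fun x : AnyInst σ × Fin σ.rels × List ℕ => x.2.2.map (newSort G U x.1) :=
    PT.map (F := fun (x : AnyInst σ × Fin σ.rels × List ℕ) v => newSort G U x.1 v) (by fun_prop)
      ((pt_newSort hU).comp (f := fun x : (AnyInst σ × Fin σ.rels × List ℕ) × ℕ => (x.1.1, x.2))
        (by fun_prop))
  exact pt_pickRel.comp (f := fun x : AnyInst σ × Fin σ.rels × List ℕ =>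
    (x.2.1, x.2.2.map (newSort G U x.1))) (PT.pair (by fun_prop) h₁)

theorem pt_newWord (hU : PT C fun x : AnyInst σ × ℕ => U x.1 x.2) : PT C (newWord G U) := by
  have hr : PT C fun P : AnyInst σ => List.range (sortList P).length := PT.rangeLength (by fun_prop)
  have h₁ : PT C fun P : AnyInst σ =>
      (List.range (sortList P).length).all fun v => (newSort G U P v).isSome :=
    PT.all (F := fun P v => (newSort G U P v).isSome) hr
      ((PT.ofFinite Option.isSome).comp (pt_newSort hU))
  have h₂ : PT C fun P : AnyInst σ => (consList P).all fun c => (newRel G U P c).isSome :=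
    PT.all (F := fun P c => (newRel G U P c).isSome) pt_consList
      ((PT.ofFinite Option.isSome).comp (pt_newRel hU))
  have h₃ : PT C fun P : AnyInst σ => (List.range (sortList P).length).flatMap fun v =>
      ((newSort G U P v).toList.map fun i => Sum.inl (Sum.inl i) : List (Letter G.sig)) :=
    PT.flatMap (F := fun P v => (newSort G U P v).toList.map fun i => Sum.inl (Sum.inl i)) hr
      ((PT.ofFinite fun o : Option (Fin G.sig.sorts) =>
        (o.toList.map fun i => Sum.inl (Sum.inl i) : List (Letter G.sig))).comp (pt_newSort hU))
  have h₄ : PT C fun x : AnyInst σ × Fin σ.rels × List ℕ =>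
      ((newRel G U x.1 x.2).toList.map fun j => Sum.inl (Sum.inr j) : List (Letter G.sig)) :=
    (PT.ofFinite fun o : Option (Fin G.sig.rels) =>
      (o.toList.map fun j => Sum.inl (Sum.inr j) : List (Letter G.sig))).comp (pt_newRel hU)
  have h₅ : PT C fun v : ℕ => ((List.replicate v ()).map (fun _ => Sum.inr true) ++
      [Sum.inr false] : List (Letter G.sig)) :=
    PT.append (PT.map (F := fun _ _ => Sum.inr true) (by fun_prop) (.const _)) (.const _)
  have h₆ : PT C fun x : AnyInst σ × Fin σ.rels × List ℕ =>
      (x.2.2.flatMap fun v => (List.replicate v ()).map (fun _ => Sum.inr true) ++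
        [Sum.inr false] : List (Letter G.sig)) :=
    PT.flatMap (F := fun _ v => (List.replicate v ()).map (fun _ => Sum.inr true) ++
        [Sum.inr false]) (by fun_prop) (h₅.comp PT.snd)
  exact PT.cond (PT.and h₁ h₂) (PT.append h₃ (PT.flatMap (F := fun P c =>
    ((newRel G U P c).toList.map fun j => Sum.inl (Sum.inr j)) ++
        c.2.flatMap fun v => (List.replicate v ()).map (fun _ => Sum.inr true) ++ [Sum.inr false])
    pt_consList (PT.append h₄ h₆))) (.const [])

theorem exists_of_forall₂_mem_right {α β : Type} {R : α → β → Prop} {l : List α} {l' : List β}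
    (h : List.Forall₂ R l l') {b : β} (hb : b ∈ l') : ∃ a ∈ l, R a b := by
  induction h with
  | nil => cases hb
  | cons h₁ _ ih =>
    rcases List.mem_cons.1 hb with rfl | hb
    · exact ⟨_, List.mem_cons_self, h₁⟩
    · obtain ⟨a, ha, h⟩ := ih hb
      exact ⟨a, List.mem_cons_of_mem _ ha, h⟩

theorem exists_of_forall₂_mem_left {α β : Type} {R : α → β → Prop} {l : List α} {l' : List β}
    (h : List.Forall₂ R l l') {a : α} (ha : a ∈ l) : ∃ b ∈ l', R a b :=
  exists_of_forall₂_mem_right (R := fun b a => R a b) h.flip ha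

/-- The word `newWord` stands for an instance, which is the refinement with domains `U` if this
exists. -/
theorem newWord_spec (G : Refinement H) (U : AnyInst σ → ℕ → Set H.carrier) (P : AnyInst σ) :
    (∃ Q : AnyInst G.sig, encodeInst Q = newWord G U P) ∧
    ((∀ v : Fin P.1, (newSort G U P v).isSome) →
      (∀ c ∈ P.2.cons, (newRel G U P (c.1, c.2.map Fin.val)).isSome) →
      ∃ Q : Inst G.sig P.1, encodeInst ⟨P.1, Q⟩ = newWord G U P ∧
        (∀ v : Fin P.1, newSort G U P v = some (Q.sort v)) ∧
        List.Forall₂ (fun c c' => c'.2 = c.2 ∧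
          newRel G U P (c.1, c.2.map Fin.val) = some c'.1) P.2.cons Q.cons) := by
  have key : (∀ v : Fin P.1, (newSort G U P v).isSome) →
      (∀ c ∈ P.2.cons, (newRel G U P (c.1, c.2.map Fin.val)).isSome) →
      ∃ Q : Inst G.sig P.1, encodeInst ⟨P.1, Q⟩ = newWord G U P ∧
        (∀ v : Fin P.1, newSort G U P v = some (Q.sort v)) ∧
        List.Forall₂ (fun c c' => c'.2 = c.2 ∧
          newRel G U P (c.1, c.2.map Fin.val) = some c'.1) P.2.cons Q.cons := by
    intro hs hc
    choose s hs' using fun v => Option.isSome_iff_exists.1 (hs v)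
    have hl : ∀ l : List (Fin σ.rels × List (Fin P.1)),
        (∀ c ∈ l, (newRel G U P (c.1, c.2.map Fin.val)).isSome) → ∃ l',
        List.Forall₂ (fun c (c' : Fin G.sig.rels × List (Fin P.1)) => c'.2 = c.2 ∧
          newRel G U P (c.1, c.2.map Fin.val) = some c'.1) l l' := by
      intro l
      induction l with
      | nil => exact fun _ => ⟨[], .nil⟩
      | cons c l ih =>
        intro h
        obtain ⟨l', hl'⟩ := ih fun c hc => h c (List.mem_cons_of_mem _ hc)
        obtain ⟨j, hj⟩ := Option.isSome_iff_exists.1 (h c List.mem_cons_self)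
        exact ⟨(j, c.2) :: l', .cons ⟨rfl, hj⟩ hl'⟩
    obtain ⟨l', hl'⟩ := hl _ hc
    have ht : ∀ c' ∈ l', c'.2.map s = G.sig.type c'.1 := by
      intro c' hc'
      obtain ⟨c, -, h₁, h₂⟩ := exists_of_forall₂_mem_right hl' hc'
      have h₃ := (Refinement.pickRel_eq_some h₂).1
      rw [h₁]
      simp only [List.map_map] at h₃
      have h₄ : newSort G U P ∘ Fin.val = some ∘ s := funext hs'
      rw [h₄, ← List.map_map] at h₃
      exact List.map_injective_iff.2 (Option.some_injective _) h₃
    refine ⟨⟨s, l', ht⟩, ?_, hs', hl'⟩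
    have e₁ : (List.range (sortList P).length).all (fun v => (newSort G U P v).isSome) = true := by
      rw [List.all_eq_true]
      intro v hv
      rw [List.mem_range, sortList, List.length_ofFn] at hv
      exact hs ⟨v, hv⟩
    have e₂ : ((consList P).all fun c => (newRel G U P c).isSome) = true := by
      rw [List.all_eq_true]
      intro _ h
      obtain ⟨c, hc', rfl⟩ := List.mem_map.1 h
      exact hc c hc'
    rw [newWord, e₁, e₂]
    simp only [Bool.and_self, cond_true]
    rw [encodeInst]
    congr 1
    · rw [sortList, List.length_ofFn, ← List.map_coe_finRange_eq_range, List.flatMap_map,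
        List.ofFn_eq_map, List.map_map, ← List.flatMap_pure_eq_map]
      refine List.flatMap_congr fun v _ => ?_
      rw [hs']
      rfl
    · rw [consList, List.flatMap_map]
      change (l'.flatMap fun c => Sum.inl (Sum.inr c.1) :: c.2.flatMap fun v =>
        List.replicate v.val (Sum.inr true) ++ [Sum.inr false]) = _
      clear ht hc hl e₂
      generalize P.2.cons = l at hl'
      induction hl' with
      | nil => rfl
      | @cons c c' l l' h _ ih =>
        simp only [List.flatMap_cons] at ih ⊢
        rw [ih, h.1, h.2, List.flatMap_map]
        simp
  refine ⟨?_, key⟩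
  by_cases h : (∀ v : Fin P.1, (newSort G U P v).isSome) ∧
      ∀ c ∈ P.2.cons, (newRel G U P (c.1, c.2.map Fin.val)).isSome
  · obtain ⟨Q, hQ, -⟩ := key h.1 h.2
    exact ⟨_, hQ⟩
  · refine ⟨⟨0, Fin.elim0, [], by simp⟩, ?_⟩
    have : ((List.range (sortList P).length).all (fun v => (newSort G U P v).isSome) &&
      (consList P).all (fun c => (newRel G U P c).isSome)) = false := by
      rw [← Bool.not_eq_true, Bool.and_eq_true, List.all_eq_true, List.all_eq_true]
      refine fun h' => h ⟨fun v => h'.1 v ?_, fun c hc => h'.2 _ (List.mem_map_of_mem hc)⟩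
      simp [sortList]
    rw [newWord, this]
    rfl

/-- A polynomial-time assignment of definable domains to the variables gives a polynomial-time
algorithm for refinements. -/
theorem exists_refinement_algorithm {D : Fin σ.sorts → Set H.carrier → Prop}
    (hG : G.IsFullFor D) (O : FinTM2)
    (hU : PT ⟨Letter σ, Letter G.sig, O⟩ fun x : AnyInst σ × ℕ => U x.1 x.2)
    (hD : ∀ n (P : Inst σ n) (v : Fin n), D (P.sort v) (U ⟨n, P⟩ v)) :
    ∃ f : AnyInst σ → AnyInst G.sig, PolyTime encodeInst encodeInst f ∧
      ∀ n (P : Inst σ n),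
        (∀ c ∈ P.cons, ∀ (r : ℕ) v, c.2[r]? = some v → U ⟨n, P⟩ v ⊆ H.proj c.1 r) →
        ∃ Q, f ⟨n, P⟩ = ⟨n, Q⟩ ∧ G.IsRefinementOf P Q ∧ ∀ v, G.dom (Q.sort v) = U ⟨n, P⟩ v := by
  have hex : ∀ P : AnyInst σ, ∃ Q : AnyInst G.sig, encodeInst Q = newWord G U P ∧
      ((∀ c ∈ P.2.cons, ∀ (r : ℕ) v, c.2[r]? = some v → U P v ⊆ H.proj c.1 r) →
        ∃ Q', Q = ⟨P.1, Q'⟩ ∧ G.IsRefinementOf P.2 Q' ∧ ∀ v, G.dom (Q'.sort v) = U P v) := by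
    intro P
    by_cases hP : ∀ c ∈ P.2.cons, ∀ (r : ℕ) v, c.2[r]? = some v → U P v ⊆ H.proj c.1 r
    swap
    · obtain ⟨Q, hQ⟩ := (newWord_spec G U P).1
      exact ⟨Q, hQ, fun h => absurd h hP⟩
    have hsort : ∀ v : Fin P.1, (sortList P)[v.val]? = some (P.2.sort v) := by
      intro v
      simp [sortList]
    have hs : ∀ v : Fin P.1, ∃ i, newSort G U P v = some i := by
      intro v
      obtain ⟨i, h₁, h₂⟩ := hG.2.1 _ _ (hD _ P.2 v)
      exact Refinement.pickSort_isSome ⟨i, by rw [hsort, h₁], h₂⟩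
    choose s hs using hs
    have hs' : ∀ v, G.base (s v) = P.2.sort v ∧ G.dom (s v) = U P v := by
      intro v
      have := Refinement.pickSort_eq_some (hs v)
      rw [hsort] at this
      exact ⟨Option.some.inj this.1, this.2⟩
    have hmap : ∀ l : List (Fin P.1), (l.map Fin.val).map (newSort G U P) = (l.map s).map some := by
      intro l
      simp [hs]
    have hc : ∀ c ∈ P.2.cons, (newRel G U P (c.1, c.2.map Fin.val)).isSome := by
      intro c hc
      obtain ⟨j', h₁, h₂⟩ := hG.2.2 c.1 (c.2.map s) (by
        rw [← P.2.typed c hc, List.map_map]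
        exact List.map_congr_left fun v _ => (hs' v).1) (by
        intro r i hi
        rw [List.getElem?_map, Option.map_eq_some_iff] at hi
        obtain ⟨v, hv, rfl⟩ := hi
        rw [(hs' v).2]
        exact hP c hc r v hv)
      rw [Option.isSome_iff_exists]
      refine Refinement.pickRel_isSome ⟨j', ?_, ?_⟩
      · rw [hmap, h₁]
      · rw [h₂, h₁]
    obtain ⟨Q, hQ, h₁, h₂⟩ := (newWord_spec G U P).2
      (fun v => Option.isSome_iff_exists.2 ⟨_, hs v⟩) hc
    have hQs : Q.sort = s := funext fun v => Option.some.inj ((h₁ v).symm.trans (hs v))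
    have hlift : ∀ c c', (c'.2 = c.2 ∧ newRel G U P (c.1, c.2.map Fin.val) = some c'.1) →
        G.IsLift Q c c' := by
      rintro c c' ⟨h, h'⟩
      have h₃ := Refinement.pickRel_eq_some h'
      rw [hmap] at h₃
      refine ⟨h, ?_⟩
      rw [hQs, List.map_injective_iff.2 (Option.some_injective _) h₃.1]
      exact h₃.2
    refine ⟨⟨P.1, Q⟩, hQ, fun _ => ⟨Q, rfl, ⟨fun v => by rw [hQs]; exact (hs' v).1,
      fun c hc => ⟨fun r v hv => ?_, ?_⟩, fun c' hc' => ?_⟩, fun v => by rw [hQs]; exact (hs' v).2⟩⟩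
    · rw [hQs, (hs' v).2]
      exact hP c hc r v hv
    · obtain ⟨c', hc', h⟩ := exists_of_forall₂_mem_left h₂ hc
      exact ⟨c', hc', hlift c c' h⟩
    · obtain ⟨c, hc, h⟩ := exists_of_forall₂_mem_right h₂ hc'
      exact ⟨c, hc, hlift c c' h⟩
  choose f hf using hex
  refine ⟨f, ?_, fun n P hP => (hf ⟨n, P⟩).2 hP⟩
  refine polyTime_of_pte (Lin := Letter σ) (Lout := Letter G.sig) (O := O) ?_
  have hrev : ∀ τ : Sig, PT ⟨Letter σ, Letter G.sig, O⟩ fun w : List (Letter τ) => w.reverse :=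
    fun _ => .reverse .id
  have h₁ : PTE (Letter σ) (Letter G.sig) O (fun P => Dat.ofList Dat.ofFinite (encodeInst P).reverse)
      (enc : AnyInst σ → Dat) (fun P => P) :=
    PTE.congr (hrev σ) fun P => ⟨(encodeInst P).reverse, rfl,
      congrArg (enc (α := List (Letter σ))) (List.reverse_reverse _).symm⟩
  have h₂ := PTE.comp ((hrev G.sig).comp (pt_newWord hU)) h₁
  exact PTE.congr h₂ fun P => ⟨P, rfl, by rw [(hf P).1]; rfl⟩

theorem isLossless_of_sols {n : ℕ} {P : Inst σ n} {Q : Inst G.sig n} (h : G.IsRefinementOf P Q)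
    (hφ : ∀ φ, IsSol H P φ → ∀ v, φ v ∈ G.dom (Q.sort v)) : G.IsLossless P Q := by
  refine ⟨h, fun φ hs => ?_⟩
  choose ψ h₁ h₂ using hφ φ hs
  refine ⟨ψ, ⟨h₁, fun c' hc' => ?_⟩, h₂⟩
  obtain ⟨c, hc, e₁, e₂⟩ := h.2.2 c' hc'
  rw [e₂, e₁]
  refine ⟨?_, ?_⟩
  · rw [List.map_map]
    exact List.map_congr_left fun v _ => h₁ v
  · rw [List.map_map, funext (f := G.ξ ∘ ψ) h₂]
    exact hs.2 c hc

theorem mem_dom_of_isLossless {n : ℕ} {P : Inst σ n} {Q : Inst G.sig n} (h : G.IsLossless P Q)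
    {φ : Fin n → H.carrier} (hφ : IsSol H P φ) (v : Fin n) : φ v ∈ G.dom (Q.sort v) := by
  obtain ⟨ψ, h₁, h₂⟩ := h.2 φ hφ
  exact ⟨ψ v, h₁.1 v, h₂ v⟩

end Assemble

/-! ### Minimal lossless refinements from a solver -/

section Solver

variable {σ : Sig} {H : Str σ} {C : Ctx}

/-- A function to the subsets of a finite type is computed in polynomial time if, for each element of
the type, membership is. -/
theorem PT.setOf {α β : Type} [Enc α] [Finite β] {b : α → β → Bool} (h : ∀ t, PT C fun a => b a t) :
    PT C fun a => {t | b a t = true} := by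
  have := Fintype.ofFinite β
  have key : ∀ l : List β, PT C fun a => {t | t ∈ l ∧ b a t = true} := by
    intro l
    induction l with
    | nil => simpa using PT.const ∅
    | cons t l ih =>
      refine (PT.ofFinite₂ (fun (c : Bool) (S : Set β) => {t' | t' = t ∧ c = true ∨ t' ∈ S}) (h t)
        ih).congr fun a => ⟨a, rfl, congrArg enc ?_⟩
      ext t'
      simp only [List.mem_cons, Set.mem_ofPred_eq]
      constructor
      · rintro ⟨rfl | h, h'⟩
        exacts [.inl ⟨rfl, h'⟩, .inr ⟨h, h'⟩]
      · rintro (⟨rfl, h⟩ | ⟨h, h'⟩)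
        exacts [⟨.inl rfl, h⟩, ⟨.inr h, h'⟩]
  simpa using key Finset.univ.toList

variable {jc : H.carrier → Fin σ.rels} (hjc : ∀ a, H.rel (jc a) = {[a]})

include hjc in
theorem type_of_rel_eq_singleton (a : H.carrier) : σ.type (jc a) = [H.sort a] :=
  (H.rel_type (jc a) [a] (by rw [hjc]; rfl)).symm

open Classical in
/-- Add to an instance the constraint that the variable `v` has the value `a`, if the sorts match. -/
noncomputable def addConst (P : AnyInst σ) (v : ℕ) (a : H.carrier) : AnyInst σ :=
  if h : ∃ hv : v < P.1, P.2.sort ⟨v, hv⟩ = H.sort a then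
    ⟨P.1, P.2.sort, P.2.cons ++ [(jc a, [⟨v, h.1⟩])], by
      intro c hc
      rcases List.mem_append.1 hc with hc | hc
      · exact P.2.typed c hc
      · rw [List.mem_singleton.1 hc, type_of_rel_eq_singleton hjc]
        simpa using h.2⟩
  else P

theorem getElem?_sortList_eq_some {P : AnyInst σ} {v : ℕ} {s : Fin σ.sorts} :
    (sortList P)[v]? = some s ↔ ∃ hv : v < P.1, P.2.sort ⟨v, hv⟩ = s := by
  rw [List.getElem?_eq_some_iff]
  simp [sortList]

theorem pt_addConst (a : H.carrier) : PT C fun x : AnyInst σ × ℕ => addConst hjc x.1 x.2 a := by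
  have h₀ : PT C fun P : AnyInst σ => encodeInst P := PTE.congr PTE.id fun P => ⟨P, rfl, rfl⟩
  have h₁ : PT C fun x : AnyInst σ × ℕ => decide ((sortList x.1)[x.2]? = some (H.sort a)) :=
    (PT.ofFinite fun o : Option (Fin σ.sorts) => decide (o = some (H.sort a))).comp
      (PT.getElem? (by fun_prop) (by fun_prop))
  have h₂ : PT C fun x : AnyInst σ × ℕ => encodeInst x.1 ++ Sum.inl (Sum.inr (jc a)) ::
      ((List.replicate x.2 ()).map (fun _ => Sum.inr true) ++ [Sum.inr false]) :=
    PT.append (h₀.comp PT.fst) (PT.cons (.const _) (PT.append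
      (PT.map (F := fun _ _ => Sum.inr true) (by fun_prop) (.const _)) (.const _)))
  refine PTE.congr (PT.cond h₁ h₂ (h₀.comp PT.fst)) fun x => ⟨x, rfl, ?_⟩
  change enc (encodeInst _) = enc _
  congr 1
  by_cases h : (sortList x.1)[x.2]? = some (H.sort a)
  · rw [decide_eq_true h, addConst, dif_pos (getElem?_sortList_eq_some.1 h)]
    simp [encodeInst]
  · rw [decide_eq_false h, addConst, dif_neg (mt getElem?_sortList_eq_some.2 h)]
    rfl

variable (f : AnyInst σ → Bool)

/-- The values that the variable `v` has in solutions, as found with a solver `f`. -/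
noncomputable def solvedValues (P : AnyInst σ) (v : ℕ) : Set H.carrier :=
  {a | (decide ((sortList P)[v]? = some (H.sort a)) && f (addConst hjc P v a)) = true}

theorem pt_solvedValues (hf : PT C f) :
    PT C fun x : AnyInst σ × ℕ => solvedValues hjc f x.1 x.2 := by
  refine PT.setOf (b := fun (x : AnyInst σ × ℕ) a =>
    decide ((sortList x.1)[x.2]? = some (H.sort a)) && f (addConst hjc x.1 x.2 a)) fun a => ?_
  have h₁ : PT C fun x : AnyInst σ × ℕ => (sortList x.1)[x.2]? :=
    PT.getElem? (by fun_prop) (by fun_prop)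
  exact PT.and ((PT.ofFinite fun o : Option (Fin σ.sorts) => decide (o = some (H.sort a))).comp h₁)
    (hf.comp (pt_addConst hjc a))

theorem mem_solvedValues (hf : ∀ n (P : Inst σ n), f ⟨n, P⟩ = true ↔ ∃ φ, IsSol H P φ) {n : ℕ}
    (P : Inst σ n) (v : Fin n) (a : H.carrier) :
    a ∈ solvedValues hjc f ⟨n, P⟩ v ↔ ∃ φ, IsSol H P φ ∧ φ v = a := by
  rw [solvedValues, Set.mem_ofPred_eq, Bool.and_eq_true, decide_eq_true_eq,
    getElem?_sortList_eq_some]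
  constructor
  · rintro ⟨h, h'⟩
    rw [addConst, dif_pos h, hf] at h'
    obtain ⟨φ, h₁, h₂⟩ := h'
    refine ⟨φ, ⟨h₁, fun c hc => h₂ c (List.mem_append_left _ hc)⟩, ?_⟩
    have := h₂ (jc a, [v]) (List.mem_append_right _ (List.mem_singleton_self _))
    simp only [hjc] at this
    simpa using this
  · rintro ⟨φ, hφ, rfl⟩
    have h : ∃ hv : v.val < n, P.sort ⟨v, hv⟩ = H.sort (φ v) := ⟨v.2, (hφ.1 v).symm⟩
    refine ⟨h, ?_⟩
    rw [addConst, dif_pos h, hf]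
    refine ⟨φ, hφ.1, fun c hc => ?_⟩
    rcases List.mem_append.1 hc with hc | hc
    · exact hφ.2 c hc
    · rw [List.mem_singleton.1 hc]
      simp only [hjc]
      rfl

theorem IsSol.mem_proj {n : ℕ} {P : Inst σ n} {φ : Fin n → H.carrier} (hφ : IsSol H P φ)
    {c : Fin σ.rels × List (Fin n)} (hc : c ∈ P.cons) {r : ℕ} {v : Fin n} (hv : c.2[r]? = some v) :
    φ v ∈ H.proj c.1 r :=
  ⟨_, hφ.2 c hc, by rw [List.getElem?_map, hv]; rfl⟩

/-- The values of the variables in solutions are the domains of a minimal lossless refinement. -/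
theorem exists_minimalLossless_algorithm (hH : H.HasConstants) (hs : H.CSPPolyTime)
    (G : Refinement H) (hG : G.IsFull) :
    ∃ f : AnyInst σ → AnyInst G.sig, PolyTime encodeInst encodeInst f ∧
      ∀ (n : ℕ) (P : Inst σ n), ∃ Q, f ⟨n, P⟩ = ⟨n, Q⟩ ∧ G.IsMinimalLossless P Q := by
  choose jc hjc using hH
  obtain ⟨f, ⟨tc⟩, hf⟩ := hs
  have hpt : PT ⟨Letter σ, Letter G.sig, tc.tm⟩ f := by
    have h : PTE (Letter σ) (Letter G.sig) tc.tm (enc : AnyInst σ → Dat)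
        (fun P => Dat.ofList Dat.ofFinite (encodeInst P).reverse) fun P => P :=
      PTE.congr (PT.reverse (C := ⟨Letter σ, Letter G.sig, tc.tm⟩) (PT.id (α := List (Letter σ))))
        fun P => ⟨encodeInst P, rfl, rfl⟩
    exact PTE.comp (PTE.subroutine tc) h
  obtain ⟨F, h₁, h₂⟩ := exists_refinement_algorithm (U := solvedValues hjc f) hG tc.tm
    (pt_solvedValues hjc f hpt) (fun n P v => ⟨⟨n, P, [], by simp, v⟩, rfl, by
      ext a
      rw [mem_solvedValues hjc f hf]
      simp [Str.ppDefinedBy]⟩)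
  refine ⟨F, h₁, fun n P => ?_⟩
  obtain ⟨Q, e, hQ, hd⟩ := h₂ n P (by
    intro c hc r v hv a ha
    obtain ⟨φ, hφ, rfl⟩ := (mem_solvedValues hjc f hf P v a).1 ha
    exact hφ.mem_proj hc hv)
  have hl : G.IsLossless P Q := isLossless_of_sols hQ fun φ hφ v => by
    rw [hd, mem_solvedValues hjc f hf]
    exact ⟨φ, hφ, rfl⟩
  refine ⟨Q, e, hl, fun v => ⟨⟨Q, hl, rfl⟩, ?_⟩⟩
  rintro _ ⟨Q', hQ', rfl⟩ - a ha
  rw [hd, mem_solvedValues hjc f hf] at ha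
  obtain ⟨φ, hφ, rfl⟩ := ha
  exact mem_dom_of_isLossless hQ' hφ v

end Solver

/-! ### The consistency algorithm -/

noncomputable instance {σ : Sig} (H : Str σ) : Enc H.carrier := ⟨Dat.ofFinite⟩

instance {σ : Sig} (H : Str σ) : FinEnc H.carrier := ⟨inferInstance, Dat.ofFinite_injective⟩

section Consistency

variable {C : Ctx} {α β : Type} [Enc α] [Enc β]

/-- All lists of length `k` of elements of a list. -/
def tuples {β : Type} : ℕ → List β → List (List β)
  | 0, _ => [[]]
  | k + 1, L => (tuples k L).flatMap fun p => L.map fun x => x :: p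

theorem mem_tuples {β : Type} {k : ℕ} {L p : List β} :
    p ∈ tuples k L ↔ p.length = k ∧ ∀ x ∈ p, x ∈ L := by
  induction k generalizing p with
  | zero =>
    rw [tuples, List.mem_singleton]
    constructor
    · rintro rfl
      simp
    · exact fun h => List.length_eq_zero_iff.1 h.1
  | succ k ih =>
    rw [tuples, List.mem_flatMap]
    constructor
    · rintro ⟨q, hq, hp⟩
      obtain ⟨x, hx, rfl⟩ := List.mem_map.1 hp
      have := ih.1 hq
      simp [this.1, hx]
      exact this.2
    · rintro ⟨h₁, h₂⟩
      rcases p with _ | ⟨x, q⟩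
      · simp at h₁
      · exact ⟨q, ih.2 ⟨by simpa using h₁, fun y hy => h₂ y (List.mem_cons_of_mem _ hy)⟩,
          List.mem_map.2 ⟨x, h₂ x List.mem_cons_self, rfl⟩⟩

theorem pt_tuples (k : ℕ) {L : α → List β} (hL : PT C L) : PT C fun a => tuples k (L a) := by
  induction k with
  | zero => exact .const [[]]
  | succ k ih =>
    have h : PT C fun x : α × List β => (L x.1).map fun y => y :: x.2 :=
      PT.map (F := fun (x : α × List β) y => y :: x.2) (by fun_prop) (by fun_prop)
    exact PT.flatMap (F := fun a p => (L a).map fun x => x :: p) ih h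

variable {σ : Sig} (H : Str σ)

/-- A partial assignment of values to variables, as a list of pairs. -/
abbrev Assign : Type := List (ℕ × H.carrier)

variable {H}

/-- The assignments do not give different values to the same variable. -/
def Compat (p q : Assign H) : Prop := ∀ x ∈ p, ∀ y ∈ q, x.1 = y.1 → x.2 = y.2

/-- The assignment gives values to all the variables in the list. -/
def Covers (p : Assign H) (s : List ℕ) : Prop := ∀ v ∈ s, ∃ y ∈ p, y.1 = v

/-- The assignment satisfies all the constraints of `P` on the variables that it gives values to. -/
def Satisfies (P : AnyInst σ) (p : Assign H) : Prop :=
  ∀ c ∈ consList P, Covers p c.2 → ∃ b ∈ H.rel c.1, ∀ i < c.2.length, ∃ y ∈ p,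
    y.1 = c.2.getD i 0 ∧ b[i]? = some y.2

open Classical in
theorem pt_compat : PT C fun x : Assign H × Assign H => decide (Compat x.1 x.2) := by
  have h₁ : PT C fun x : (ℕ × H.carrier) × ℕ × H.carrier => decide (x.1.2 = x.2.2) :=
    PT.ofFinite₂ (fun a b : H.carrier => decide (a = b)) (by fun_prop) (by fun_prop)
  have h₂ : PT C fun x : (ℕ × H.carrier) × ℕ × H.carrier =>
      !decide (x.1.1 = x.2.1) || decide (x.1.2 = x.2.2) := PT.or (by fun_prop) h₁
  have e : PT C fun x : ((Assign H × Assign H) × ℕ × H.carrier) × ℕ × H.carrier => (x.1.2, x.2) := by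
    fun_prop
  have h₃ : PT C fun x : (Assign H × Assign H) × ℕ × H.carrier =>
      x.1.2.all fun y => !decide (x.2.1 = y.1) || decide (x.2.2 = y.2) :=
    PT.all (by fun_prop) (h₂.comp e)
  have h₄ : PT C fun x : Assign H × Assign H => x.1.all fun y =>
      x.2.all fun z => !decide (y.1 = z.1) || decide (y.2 = z.2) := PT.all (by fun_prop) h₃
  refine h₄.congr fun x => ⟨x, rfl, congrArg enc (Bool.eq_iff_iff.2 ?_)⟩
  simp [Compat, imp_iff_not_or]

open Classical in
theorem pt_covers : PT C fun x : Assign H × List ℕ => decide (Covers x.1 x.2) := by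
  have h₁ : PT C fun x : (Assign H × List ℕ) × ℕ => x.1.1.any fun y => decide (y.1 = x.2) :=
    PT.any (by fun_prop) (by fun_prop)
  have h₂ : PT C fun x : Assign H × List ℕ => x.2.all fun v => x.1.any fun y => decide (y.1 = v) :=
    PT.all (by fun_prop) h₁
  refine h₂.congr fun x => ⟨x, rfl, congrArg enc (Bool.eq_iff_iff.2 ?_)⟩
  simp [Covers]

theorem finite_rel (H : Str σ) (j : Fin σ.rels) : (H.rel j).Finite :=
  (List.finite_length_eq H.carrier (σ.type j).length).subset fun a ha => by
    rw [← H.rel_type j a ha]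
    simp

open Classical in
theorem pt_satisfies : PT C fun x : AnyInst σ × Assign H => decide (Satisfies x.1 x.2) := by
  let relList : Fin σ.rels → List (List H.carrier) := fun j => (finite_rel H j).toFinset.toList
  have hr : PT C relList := PT.ofFinite _
  have h₀ : PT C fun x : (((Assign H × List ℕ) × List H.carrier) × ℕ) × ℕ × H.carrier =>
      decide (x.1.1.2[x.1.2]? = some x.2.2) :=
    PT.ofFinite₂ (fun (o : Option H.carrier) b => decide (o = some b))
      (PT.getElem? (by fun_prop) (by fun_prop)) (by fun_prop)
  have h₀' : PT C fun x : (((Assign H × List ℕ) × List H.carrier) × ℕ) × ℕ × H.carrier =>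
      x.1.1.1.2.getD x.1.2 0 := PT.getD (by fun_prop) (by fun_prop) _
  have h₁ : PT C fun x : ((Assign H × List ℕ) × List H.carrier) × ℕ =>
      x.1.1.1.any fun y => decide (y.1 = x.1.1.2.getD x.2 0) && decide (x.1.2[x.2]? = some y.2) :=
    PT.any (by fun_prop) (PT.and (PT.eqNat (by fun_prop) h₀') h₀)
  have h₂ : PT C fun x : (Assign H × List ℕ) × List H.carrier =>
      (List.range x.1.2.length).all fun i => x.1.1.any fun y =>
        decide (y.1 = x.1.2.getD i 0) && decide (x.2[i]? = some y.2) :=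
    PT.all (PT.rangeLength (by fun_prop)) h₁
  have e₁ : PT C fun x : (AnyInst σ × Assign H) × Fin σ.rels × List ℕ => (x.1.2, x.2.2) := by
    fun_prop
  have e₂ : PT C fun x : ((AnyInst σ × Assign H) × Fin σ.rels × List ℕ) × List H.carrier =>
      ((x.1.1.2, x.1.2.2), x.2) := by fun_prop
  have e₃ : PT C fun x : (AnyInst σ × Assign H) × Fin σ.rels × List ℕ => x.2.1 := by fun_prop
  have h₃ : PT C fun x : (AnyInst σ × Assign H) × Fin σ.rels × List ℕ =>
      (relList x.2.1).any fun b => (List.range x.2.2.length).all fun i => x.1.2.any fun y =>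
          decide (y.1 = x.2.2.getD i 0) && decide (b[i]? = some y.2) :=
    PT.any (hr.comp e₃) (h₂.comp e₂)
  have h₄ : PT C fun x : AnyInst σ × Assign H => (consList x.1).all fun c =>
      !decide (Covers x.2 c.2) || (relList c.1).any fun b =>
        (List.range c.2.length).all fun i => x.2.any fun y =>
          decide (y.1 = c.2.getD i 0) && decide (b[i]? = some y.2) :=
    PT.all (by fun_prop) (PT.or (PT.not (pt_covers.comp e₁)) h₃)
  refine h₄.congr fun x => ⟨x, rfl, congrArg enc (Bool.eq_iff_iff.2 ?_)⟩
  simp [Satisfies, imp_iff_not_or, relList]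

/-- The values of the assignment have the sorts of the variables of `P`. -/
def Typed (P : AnyInst σ) (p : Assign H) : Prop :=
  ∀ x ∈ p, (sortList P)[x.1]? = some (H.sort x.2)

open Classical in
theorem pt_typed : PT C fun x : AnyInst σ × Assign H => decide (Typed x.1 x.2) := by
  have h₁ : PT C fun x : (AnyInst σ × Assign H) × ℕ × H.carrier => (sortList x.1.1)[x.2.1]? :=
    PT.getElem? (by fun_prop) (by fun_prop)
  have h₂ : PT C fun x : (AnyInst σ × Assign H) × ℕ × H.carrier =>
      decide ((sortList x.1.1)[x.2.1]? = some (H.sort x.2.2)) :=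
    PT.ofFinite₂ (fun (o : Option (Fin σ.sorts)) (a : H.carrier) => decide (o = some (H.sort a)))
      h₁ (by fun_prop)
  have h₃ : PT C fun x : AnyInst σ × Assign H => x.2.all fun y =>
      decide ((sortList x.1)[y.1]? = some (H.sort y.2)) := PT.all (by fun_prop) h₂
  refine h₃.congr fun x => ⟨x, rfl, congrArg enc (Bool.eq_iff_iff.2 ?_)⟩
  simp [Typed]

variable (H) (k : ℕ)

open Classical in
/-- The consistent assignments that are lists of length `k`. -/
noncomputable def initial (P : AnyInst σ) : List (Assign H) :=
  (tuples k ((List.range (sortList P).length).flatMap fun v =>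
    (Set.finite_univ (α := H.carrier)).toFinset.toList.map fun a => (v, a))).filter fun p =>
      decide (Compat p p) && (decide (Typed P p) && decide (Satisfies P p))

open Classical in
/-- Remove the assignments that, for some `k` variables, are incompatible with all the assignments
in the list to these variables. -/
noncomputable def prune (P : AnyInst σ) (R : List (Assign H)) : List (Assign H) :=
  R.filter fun p => (tuples k (List.range (sortList P).length)).all fun B =>
    R.any fun q => decide (Covers q B) && decide (Compat p q)

/-- The result of the pruning.  Every round removes an assignment unless the list is already stable, so
that as many rounds as there are assignments suffice. -/
noncomputable def pruned (P : AnyInst σ) : List (Assign H) :=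
  (initial H k P).foldl (fun R _ => prune H k P R) (initial H k P)

/-- The values that the variable `v` has in the assignments that remain. -/
noncomputable def prunedValues (P : AnyInst σ) (v : ℕ) : Set H.carrier :=
  {a | ∃ p ∈ pruned H k P, (v, a) ∈ p}

variable {H k}

theorem mem_initial {P : AnyInst σ} {p : Assign H} :
    p ∈ initial H k P ↔ p.length = k ∧ Compat p p ∧ Typed P p ∧ Satisfies P p := by
  simp only [initial, List.mem_filter, mem_tuples, Bool.and_eq_true, decide_eq_true_eq, and_assoc]
  refine and_congr_right fun _ => ⟨fun h => h.2, fun h => ⟨fun x hx => ?_, h⟩⟩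
  obtain ⟨hv, -⟩ := getElem?_sortList_eq_some.1 (h.2.1 x hx)
  simpa [sortList] using ⟨x.1, hv, x.2, rfl⟩

theorem mem_prune {P : AnyInst σ} {R : List (Assign H)} {p : Assign H} :
    p ∈ prune H k P R ↔ p ∈ R ∧ ∀ B : List ℕ, B.length = k → (∀ v ∈ B, v < P.1) →
      ∃ q ∈ R, Covers q B ∧ Compat p q := by
  simp [prune, mem_tuples, sortList]

theorem foldl_prune {P : AnyInst σ} (R : List (Assign H)) (l : List (Assign H)) :
    l.foldl (fun R _ => prune H k P R) R = (prune H k P)^[l.length] R := by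
  induction l generalizing R with
  | nil => rfl
  | cons _ l ih => rw [List.foldl_cons, ih, List.length_cons, Function.iterate_succ_apply]

theorem iterate_prune_sublist {P : AnyInst σ} (R : List (Assign H)) (t : ℕ) :
    ((prune H k P)^[t] R).Sublist R := by
  induction t generalizing R with
  | zero => exact .refl _
  | succ t ih => exact (ih _).trans List.filter_sublist

theorem pt_initial : PT C (initial H k) := by
  have h₀ : PT C fun x : AnyInst σ × ℕ =>
      (Set.finite_univ (α := H.carrier)).toFinset.toList.map fun a => (x.2, a) :=
    PT.map (.const _) (by fun_prop)
  have h₁ : PT C fun P : AnyInst σ => (List.range (sortList P).length).flatMap fun v =>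
      (Set.finite_univ (α := H.carrier)).toFinset.toList.map fun a => (v, a) :=
    PT.flatMap (PT.rangeLength (by fun_prop)) h₀
  have e : PT C fun x : AnyInst σ × Assign H => (x.2, x.2) := by fun_prop
  exact PT.filter (pt_tuples k h₁) (PT.and (pt_compat.comp e) (PT.and pt_typed pt_satisfies))

open Classical in
theorem pt_prune : PT C fun x : AnyInst σ × List (Assign H) => prune H k x.1 x.2 := by
  have e₁ : PT C fun x : (((AnyInst σ × List (Assign H)) × Assign H) × List ℕ) × Assign H =>
      (x.2, x.1.2) := by fun_prop
  have e₂ : PT C fun x : (((AnyInst σ × List (Assign H)) × Assign H) × List ℕ) × Assign H =>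
      (x.1.1.2, x.2) := by fun_prop
  have h₁ : PT C fun x : ((AnyInst σ × List (Assign H)) × Assign H) × List ℕ =>
      x.1.1.2.any fun q => decide (Covers q x.2) && decide (Compat x.1.2 q) :=
    PT.any (by fun_prop) (PT.and (pt_covers.comp e₁) (pt_compat.comp e₂))
  have h₂ : PT C fun x : (AnyInst σ × List (Assign H)) × Assign H =>
      tuples k (List.range (sortList x.1.1).length) :=
    pt_tuples k (PT.rangeLength (by fun_prop))
  have h₃ : PT C fun x : (AnyInst σ × List (Assign H)) × Assign H =>
      (tuples k (List.range (sortList x.1.1).length)).all fun B =>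
        x.1.2.any fun q => decide (Covers q B) && decide (Compat x.2 q) := PT.all h₂ h₁
  exact PT.filter (by fun_prop) h₃

theorem pt_prune_fst : PT C fun x : AnyInst σ × List (Assign H) × Assign H =>
    prune H k x.1 x.2.1 := by
  have e : PT C fun x : AnyInst σ × List (Assign H) × Assign H => (x.1, x.2.1) := by fun_prop
  have h := PT.comp (pt_prune (C := C) (k := k) (H := H)) e
  exact h

theorem pt_pruned : PT C (pruned H k) := by
  obtain ⟨q, hq⟩ := (pt_initial (C := C) (H := H) (k := k)).bound
  have hb : ∃ q : Polynomial ℕ, ∀ (P : AnyInst σ) (l : List (Assign H)), l <+: initial H k P →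
      esize (l.foldl (fun R _ => prune H k P R) (initial H k P)) ≤ q.eval (esize P) := by
    refine ⟨q, fun P l _ => (esize_sublist ?_).trans (hq P)⟩
    rw [foldl_prune]
    exact iterate_prune_sublist _ _
  exact PT.foldl (G := fun P R _ => prune H k P R) pt_initial pt_initial pt_prune_fst hb

theorem pt_prunedValues : PT C fun x : AnyInst σ × ℕ => prunedValues H k x.1 x.2 := by
  classical
  have h₁ : ∀ a : H.carrier, PT C fun x : (((AnyInst σ × ℕ) × Assign H) × ℕ × H.carrier) =>
      decide (x.2.1 = x.1.1.2) && decide (x.2.2 = a) := fun a => by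
    have : PT C fun x : (((AnyInst σ × ℕ) × Assign H) × ℕ × H.carrier) => decide (x.2.2 = a) :=
      PT.ofFinite₂ (fun x a : H.carrier => decide (x = a)) (by fun_prop) (.const a)
    exact PT.and (by fun_prop) this
  have h₂ : ∀ a : H.carrier, PT C fun x : (AnyInst σ × ℕ) × Assign H =>
      x.2.any fun y => decide (y.1 = x.1.2) && decide (y.2 = a) :=
    fun a => PT.any (by fun_prop) (h₁ a)
  have h₃ : PT C fun x : AnyInst σ × ℕ => pruned H k x.1 := pt_pruned.comp PT.fst
  have h₄ : ∀ a : H.carrier, PT C fun x : AnyInst σ × ℕ => (pruned H k x.1).any fun p =>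
      p.any fun y => decide (y.1 = x.2) && decide (y.2 = a) := fun a => PT.any h₃ (h₂ a)
  refine (PT.setOf h₄).congr fun x => ⟨x, rfl, congrArg enc ?_⟩
  ext a
  simp [prunedValues]

theorem prune_pruned (P : AnyInst σ) : prune H k P (pruned H k P) = pruned H k P := by
  rw [pruned, foldl_prune]
  generalize initial H k P = R
  rw [← Function.iterate_succ_apply' (prune H k P)]
  -- A step that changes the list shortens it.
  have key : ∀ t, (prune H k P)^[t + 1] R = (prune H k P)^[t] R ∨
      ((prune H k P)^[t] R).length + t ≤ R.length := by
    intro t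
    induction t with
    | zero => exact .inr le_rfl
    | succ t ih =>
      have hs : ((prune H k P)^[t + 1] R).Sublist ((prune H k P)^[t] R) := by
        rw [Function.iterate_succ_apply']
        exact List.filter_sublist
      rcases ih with ih | ih
      · left
        rw [Function.iterate_succ_apply' _ (t + 1), ih,
          ← Function.iterate_succ_apply' (prune H k P), ih]
      · rcases hs.length_le.lt_or_eq with h | h
        · right
          omega
        · left
          have := hs.eq_of_length h
          rw [Function.iterate_succ_apply' _ (t + 1), this,
            ← Function.iterate_succ_apply' (prune H k P), this]
  rcases key R.length with h | h
  · exact h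
  · have h₀ : (prune H k P)^[R.length] R = [] := List.length_eq_zero_iff.1 (by omega)
    rw [Function.iterate_succ_apply', h₀]
    rfl

end Consistency

/-! ### Rooted trees -/

section Rooted

/-- Rooting a tree: the parent of `t` is the second vertex of the path from `t` to the root `r`. -/
theorem exists_rooting {V : Type} {T : SimpleGraph V} (hT : T.IsTree) (r : V) :
    ∃ (par : V → V) (depth : V → ℕ), (∀ t ≠ r, depth (par t) < depth t) ∧
      ∀ s t, T.Adj s t → (s ≠ r ∧ t = par s) ∨ (t ≠ r ∧ s = par t) := by
  have huniq : ∀ {s t : V} {p q : T.Walk s t}, p.IsPath → q.IsPath → p = q := fun {s t} p q hp hq =>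
    (hT.existsUnique_path s t).unique hp hq
  choose p hp _ using fun t => hT.existsUnique_path t r
  refine ⟨fun t => (p t).snd, fun t => (p t).length, fun t ht => ?_, fun s t hst => ?_⟩
  · have hn : ¬(p t).Nil := SimpleGraph.Walk.not_nil_of_ne ht
    have h₁ : p (p t).snd = (p t).tail := huniq (hp _) (hp t).tail
    have h₂ := SimpleGraph.Walk.length_tail_add_one hn
    have h₃ := congrArg SimpleGraph.Walk.length h₁
    change (p (p t).snd).length < (p t).length
    omega
  · classical
    by_cases h : t ∈ (p s).support
    · left
      have h₁ : (p s).takeUntil t h = .cons hst .nil :=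
        huniq ((hp s).takeUntil h) (by simpa using hst.ne)
      have h₂ := (p s).take_spec h
      rw [h₁] at h₂
      refine ⟨?_, ?_⟩
      · rintro rfl
        have : p s = .nil := huniq (hp s) .nil
        rw [this] at h
        exact hst.ne (by simpa using Eq.symm (by simpa using h))
      · change t = (p s).snd
        rw [← h₂]
        simp
    · right
      have h₁ : p t = .cons hst.symm (p s) := huniq (hp t) ((hp s).cons h)
      refine ⟨?_, by change s = (p t).snd; rw [h₁]; simp⟩
      rintro rfl
      exact h (p s).end_mem_support

variable {ι : Type} {r : ι} {par : ι → ι} {depth : ι → ℕ} (hd : ∀ t ≠ r, depth (par t) < depth t)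

include hd

/-- Recursion from the root of a tree. -/
theorem exists_forall_eq_ite_parent {X : Type} (x₀ : X) (next : ι → X → X) :
    ∃ q : ι → X, q r = x₀ ∧ ∀ t ≠ r, q t = next t (q (par t)) := by
  classical
  let g : ℕ → ι → X := fun N => N.rec (fun _ => x₀) fun _ gN t =>
    if t = r then x₀ else next t (gN (par t))
  have hg : ∀ M N t, depth t < M → depth t < N → g M t = g N t := by
    intro M
    induction M with
    | zero => exact fun _ _ h => absurd h (Nat.not_lt_zero _)
    | succ M ih =>
      intro N t hM hN
      cases N with
      | zero => exact absurd hN (Nat.not_lt_zero _)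
      | succ N =>
        by_cases ht : t = r
        · simp [g, ht]
        · have := hd t ht
          simp only [g, if_neg ht]
          exact congrArg _ (ih N (par t) (by omega) (by omega))
  refine ⟨fun t => g (depth t + 1) t, by simp [g], fun t ht => ?_⟩
  have := hd t ht
  refine (if_neg ht).trans (congrArg _ (hg _ _ _ this (Nat.lt_succ_self _)))

/-- A parent function defines a tree: every node has a path to the root, and the edges correspond to
the nodes other than the root. -/
theorem isTree_of_parent [Finite ι] :
    (SimpleGraph.fromRel fun s t => s ≠ r ∧ t = par s).IsTree := by
  set T := SimpleGraph.fromRel fun s t => s ≠ r ∧ t = par s with hT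
  have hne : ∀ t ≠ r, t ≠ par t := fun t ht h => by
    have := hd t ht
    rw [← h] at this
    exact lt_irrefl _ this
  have hadj : ∀ t ≠ r, T.Adj t (par t) := fun t ht => by
    rw [hT, SimpleGraph.fromRel_adj]
    exact ⟨hne t ht, .inl ⟨ht, rfl⟩⟩
  rw [SimpleGraph.isTree_iff_connected_and_card]
  constructor
  · have : ∀ N t, depth t ≤ N → T.Reachable t r := by
      intro N
      induction N with
      | zero =>
        intro t ht
        by_cases h : t = r
        · rw [h]
        · have := hd t h
          omega
      | succ N ih =>
        intro t ht
        by_cases h : t = r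
        · rw [h]
        · have := hd t h
          exact (hadj t h).reachable.trans (ih _ (by omega))
    exact (SimpleGraph.connected_iff_exists_forall_reachable _).2 ⟨r, fun t => (this _ t le_rfl).symm⟩
  · have hb : Function.Bijective fun t : {t // t ≠ r} =>
        (⟨s(t.1, par t.1), hadj t.1 t.2⟩ : T.edgeSet) := by
      constructor
      · rintro ⟨s, hs⟩ ⟨t, ht⟩ h
        have h := congrArg Subtype.val h
        simp only [Sym2.eq_iff] at h
        rcases h with h | ⟨h₁, h₂⟩
        · exact Subtype.ext h.1
        · have h₃ := hd s hs
          have h₄ := hd t ht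
          rw [h₂] at h₃
          rw [← h₁] at h₄
          omega
      · rintro ⟨e, he⟩
        induction e with
        | _ s t =>
          have he' := he
          rw [SimpleGraph.mem_edgeSet, hT, SimpleGraph.fromRel_adj] at he'
          rcases he'.2 with ⟨h, rfl⟩ | ⟨h, rfl⟩
          · exact ⟨⟨s, h⟩, rfl⟩
          · exact ⟨⟨t, h⟩, Subtype.ext Sym2.eq_swap⟩
    rw [← Nat.card_eq_of_bijective _ hb]
    have := Fintype.ofFinite ι
    classical
    rw [Nat.card_eq_fintype_card, Nat.card_eq_fintype_card, Fintype.card_subtype_compl,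
      Fintype.card_subtype_eq]
    exact Nat.sub_add_cancel (Fintype.card_pos_iff.2 ⟨r⟩)

variable {V : Type} {Γ : SimpleGraph V} {d : ℕ}

/-- Bags along a rooted tree form a tree decomposition if, for every vertex, there is a unique topmost
bag containing it. -/
theorem treewidthLE_of_parent [Finite ι] (bag : ι → Finset V)
    (hΓ : ∀ u v, Γ.Adj u v → ∃ t, u ∈ bag t ∧ v ∈ bag t)
    (htop : ∀ v, ∃ s, v ∈ bag s ∧ ∀ t, v ∈ bag t → t = s ∨ t ≠ r ∧ v ∈ bag (par t))
    (hcard : ∀ t, (bag t).card ≤ d + 1) : TreewidthLE Γ d := by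
  obtain ⟨m, ⟨e⟩⟩ := Finite.exists_equiv_fin ι
  have hd' : ∀ t ≠ e r, depth (e.symm (e (par (e.symm t)))) < depth (e.symm t) := by
    intro t ht
    rw [e.symm_apply_apply]
    exact hd _ fun h => ht (by rw [← h, e.apply_symm_apply])
  refine ⟨m, _, fun t => bag (e.symm t),
    isTree_of_parent (r := e r) (par := fun t => e (par (e.symm t)))
      (depth := fun t => depth (e.symm t)) hd',
    fun v => ?_, fun u v h => ?_, fun v => ?_, fun t => hcard _⟩
  · obtain ⟨s, hs, -⟩ := htop v
    exact ⟨e s, by simpa using hs⟩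
  · obtain ⟨t, ht⟩ := hΓ u v h
    exact ⟨e t, by simpa using ht⟩
  · obtain ⟨s, hs, h⟩ := htop v
    have hs' : v ∈ bag (e.symm (e s)) := by simpa using hs
    set T := SimpleGraph.fromRel fun s t => s ≠ e r ∧ t = e (par (e.symm s)) with hT
    have key : ∀ N t (ht : v ∈ bag (e.symm t)), depth (e.symm t) ≤ N →
        (T.induce {t | v ∈ bag (e.symm t)}).Reachable ⟨t, ht⟩ ⟨e s, hs'⟩ := by
      intro N
      induction N with
      | zero =>
        intro t ht hN
        rcases h _ ht with h' | ⟨h', -⟩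
        · have : t = e s := by rw [← h', e.apply_symm_apply]
          subst this
          exact .refl _
        · have := hd _ h'
          omega
      | succ N ih =>
        intro t ht hN
        rcases h _ ht with h' | ⟨h', h''⟩
        · have : t = e s := by rw [← h', e.apply_symm_apply]
          subst this
          exact .refl _
        · have h₁ := hd _ h'
          have h₂ : v ∈ bag (e.symm (e (par (e.symm t)))) := by simpa using h''
          refine SimpleGraph.Reachable.trans (SimpleGraph.Adj.reachable ?_)
            (ih _ h₂ (by rw [e.symm_apply_apply]; omega))
          rw [SimpleGraph.comap_adj, hT, SimpleGraph.fromRel_adj]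
          refine ⟨fun h₃ => ?_, .inl ⟨fun h₃ => h' ?_, rfl⟩⟩
          · have h₃ : t = e (par (e.symm t)) := h₃
            rw [← e.symm_apply_eq] at h₃
            rw [← h₃] at h₁
            exact lt_irrefl _ h₁
          · have h₃ : t = e r := h₃
            rw [h₃, e.symm_apply_apply]
    exact fun t t' => (key _ t.1 t.2 le_rfl).trans (key _ t'.1 t'.2 le_rfl).symm

omit hd in
/-- All nodes of a subtree are below any node of it whose parent is not in it. -/
theorem reflTransGen_of_preconnected {T : SimpleGraph ι}
    (hT : ∀ s t, T.Adj s t → (s ≠ r ∧ t = par s) ∨ (t ≠ r ∧ s = par t)) {S : Set ι}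
    (hS : (T.induce S).Preconnected) {s t : ι} (hs : s ∈ S) (ht : t ∈ S)
    (htop : t = r ∨ par t ∉ S) : Relation.ReflTransGen (fun a b => a ≠ r ∧ b = par a) s t := by
  have h := (SimpleGraph.reachable_iff_reflTransGen _ _).1 (hS ⟨t, ht⟩ ⟨s, hs⟩)
  suffices ∀ u : S, Relation.ReflTransGen (T.induce S).Adj ⟨t, ht⟩ u →
      Relation.ReflTransGen (fun a b => a ≠ r ∧ b = par a) u.1 t from this _ h
  intro u hu
  induction hu with
  | refl => exact .refl
  | @tail u w _ huw ih =>
    rcases hT _ _ huw with ⟨h₁, h₂⟩ | ⟨h₁, h₂⟩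
    · rcases ih.cases_head with h₃ | ⟨w', ⟨-, rfl⟩, h₃⟩
      · have h₄ : w.1 = par t := by rw [← h₃]; exact h₂
        rcases htop with rfl | h₅
        · exact absurd h₃ h₁
        · exact absurd (h₄ ▸ w.2) h₅
      · have h₂ : w.1 = par u.1 := h₂
        rw [h₂]
        exact h₃
    · exact .head ⟨h₁, h₂⟩ ih

/-- The Helly property of subtrees: vertices that are pairwise in a common bag are all in a common
bag. -/
theorem exists_bag_of_pairwise {T : SimpleGraph ι}
    (hT : ∀ s t, T.Adj s t → (s ≠ r ∧ t = par s) ∨ (t ≠ r ∧ s = par t)) {bag : ι → Finset V}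
    (hconn : ∀ v, (T.induce {t | v ∈ bag t}).Preconnected) {K : Finset V} (hne : K.Nonempty)
    (hK : ∀ u ∈ K, ∀ v ∈ K, ∃ t, u ∈ bag t ∧ v ∈ bag t) : ∃ t, ∀ v ∈ K, v ∈ bag t := by
  -- Take the vertex of `K` whose topmost bag is deepest; this bag contains all of `K`.
  have hle : ∀ {s t}, Relation.ReflTransGen (fun a b => a ≠ r ∧ b = par a) s t →
      depth t ≤ depth s := by
    intro s t h
    induction h with
    | refl => rfl
    | tail _ h ih =>
      have := hd _ h.1
      rw [h.2]
      omega
  have htop : ∀ v, (∃ t, v ∈ bag t) → ∃ t, v ∈ bag t ∧ (t = r ∨ v ∉ bag (par t)) := by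
    intro v hv
    let N := sInf {N | ∃ t, v ∈ bag t ∧ depth t = N}
    have hne : {N | ∃ t, v ∈ bag t ∧ depth t = N}.Nonempty :=
      let ⟨t, ht⟩ := hv
      ⟨_, t, ht, rfl⟩
    obtain ⟨t, ht, hN⟩ := Nat.sInf_mem hne
    refine ⟨t, ht, or_iff_not_imp_left.2 fun h h' => ?_⟩
    have h₁ := hd t h
    have h₂ := Nat.sInf_le (s := {N | ∃ t, v ∈ bag t ∧ depth t = N}) ⟨par t, h', rfl⟩
    omega
  have hex : ∀ v : K, ∃ t, v.1 ∈ bag t ∧ (t = r ∨ v.1 ∉ bag (par t)) := fun v =>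
    htop v (let ⟨t, ht⟩ := hK v v.2 v v.2; ⟨t, ht.1⟩)
  choose top h₁ h₂ using hex
  obtain ⟨y, -, hy⟩ := Finset.exists_max_image (Finset.univ : Finset K) (fun v => depth (top v))
    (let ⟨v, hv⟩ := hne; ⟨⟨v, hv⟩, Finset.mem_univ _⟩)
  refine ⟨top y, fun z hz => ?_⟩
  obtain ⟨s, hys, hzs⟩ := hK y y.2 z hz
  have hdesc := reflTransGen_of_preconnected hT (hconn y) hys (h₁ y) (h₂ y)
  induction hdesc using Relation.ReflTransGen.head_induction_on with
  | refl => exact hzs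
  | @head s s' hs hs' ih =>
    obtain ⟨hs, rfl⟩ := hs
    by_cases hz' : z ∈ bag (par s)
    · have hy' : y.1 ∈ bag (par s) := by
        by_contra hy'
        have := hle (reflTransGen_of_preconnected hT (hconn y) (h₁ y) hys (.inr hy'))
        have h₃ := hle hs'
        have h₄ := hd s hs
        omega
      exact ih hy' hz'
    · have := hle (reflTransGen_of_preconnected hT (hconn z) (h₁ ⟨z, hz⟩) hzs (.inr hz'))
      have h₃ := hle hs'
      have h₄ := hd s hs
      have h₅ := hy ⟨z, hz⟩ (Finset.mem_univ _)
      omega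

end Rooted

/-! ### Consistency and structures of bounded treewidth -/

section Width

variable {σ : Sig} {H : Str σ} {n : ℕ} {P : Inst σ n} {d : ℕ}

theorem mem_initial_of_mem_pruned {k : ℕ} {P : AnyInst σ} {p : Assign H} (hp : p ∈ pruned H k P) :
    p ∈ initial H k P := by
  rw [pruned, foldl_prune] at hp
  exact (iterate_prune_sublist _ _).subset hp

theorem Compat.symm {p q : Assign H} (h : Compat p q) : Compat q p :=
  fun x hx y hy hxy => (h y hy x hx hxy.symm).symm

/-- An assignment that survives the pruning extends to any `k` further variables. -/
theorem exists_mem_pruned {k : ℕ} {p : Assign H} (hp : p ∈ pruned H k ⟨n, P⟩) {S : Finset (Fin n)}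
    (hS : S.card ≤ k) (v : Fin n) :
    ∃ q ∈ pruned H k ⟨n, P⟩, (∀ w ∈ S, ∃ y ∈ q, y.1 = w.val) ∧ Compat p q := by
  have hp' := hp
  rw [← prune_pruned, mem_prune] at hp'
  obtain ⟨q, hq, h₁, h₂⟩ := hp'.2
    (S.toList.map Fin.val ++ List.replicate (k - S.card) v.val) (by simp; omega) (by
      intro w hw
      rcases List.mem_append.1 hw with hw | hw
      · obtain ⟨w, -, rfl⟩ := List.mem_map.1 hw
        exact w.2
      · rw [List.eq_of_mem_replicate hw]
        exact v.2)
  exact ⟨q, hq, fun w hw => h₁ w (List.mem_append_left _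
    (List.mem_map_of_mem (Finset.mem_toList.2 hw))), h₂⟩

/-- Every structure of treewidth at most `d` that maps to the instance defines a relation that contains
the remaining values: the assignments for the bags are combined to a homomorphism. -/
theorem prunedValues_subset_definedBy (A : Str σ) (x : A.carrier) (hA : TreewidthLE A.gaifman d)
    (h : A.carrier → Fin n) (hh : IsHom A P.toStr h) :
    prunedValues H (d + 1) ⟨n, P⟩ (h x) ⊆ H.definedBy A x := by
  classical
  rintro a ⟨p, hp, ha⟩
  obtain ⟨m, T, bag, hT, hcov, hedge, hconn, hcard⟩ := hA
  obtain ⟨r, hr⟩ := hcov x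
  obtain ⟨par, depth, hd, hpar⟩ := exists_rooting hT r
  -- Choose an assignment for each bag, going down from the root.
  have hnext : ∀ t (q : {q // q ∈ pruned H (d + 1) ⟨n, P⟩}),
      ∃ q' : {q // q ∈ pruned H (d + 1) ⟨n, P⟩},
        (∀ y ∈ bag t, ∃ z ∈ q'.1, z.1 = (h y).val) ∧ Compat q.1 q'.1 := by
    rintro t ⟨q, hq⟩
    obtain ⟨q', h₁, h₂, h₃⟩ := exists_mem_pruned hq (S := (bag t).image h)
      (Finset.card_image_le.trans (hcard t)) (h x)
    exact ⟨⟨q', h₁⟩, fun y hy => h₂ _ (Finset.mem_image_of_mem h hy), h₃⟩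
  choose next hn₁ hn₂ using hnext
  obtain ⟨q, hq₀, hq₁⟩ := exists_forall_eq_ite_parent hd (next r ⟨p, hp⟩) next
  have hcover : ∀ t, ∀ y ∈ bag t, ∃ z ∈ (q t).1, z.1 = (h y).val := by
    intro t y hy
    by_cases ht : t = r
    · subst ht
      rw [hq₀]
      exact hn₁ _ _ y hy
    · rw [hq₁ t ht]
      exact hn₁ _ _ y hy
  have hcompat : ∀ s t, T.Adj s t → Compat (q s).1 (q t).1 := by
    have : ∀ t ≠ r, Compat (q (par t)).1 (q t).1 := fun t ht => by
      rw [hq₁ t ht]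
      exact hn₂ _ _
    intro s t hst
    rcases hpar s t hst with ⟨h₁, rfl⟩ | ⟨h₁, rfl⟩
    · exact (this _ h₁).symm
    · exact this _ h₁
  have hinit := fun t => mem_initial.1 (mem_initial_of_mem_pruned (q t).2)
  -- The assignments for the bags with a given element agree on it.
  have hex : ∀ y, ∃ b, ∀ t, y ∈ bag t → ((h y).val, b) ∈ (q t).1 := by
    intro y
    obtain ⟨t₀, ht₀⟩ := hcov y
    obtain ⟨⟨w, b⟩, hb, hw⟩ := hcover t₀ y ht₀
    obtain rfl : w = (h y).val := hw
    refine ⟨b, fun t ht => ?_⟩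
    have hreach := (SimpleGraph.reachable_iff_reflTransGen _ _).1 (hconn y ⟨t₀, ht₀⟩ ⟨t, ht⟩)
    suffices ∀ u : {t | y ∈ bag t}, Relation.ReflTransGen
        (T.induce {t | y ∈ bag t}).Adj ⟨t₀, ht₀⟩ u → ((h y).val, b) ∈ (q u.1).1 from this _ hreach
    intro u hu
    induction hu with
    | refl => exact hb
    | @tail u w _ huw ih =>
      obtain ⟨⟨w', b'⟩, hb', hw'⟩ := hcover w.1 y w.2
      obtain rfl : w' = (h y).val := hw'
      have e : b = b' := hcompat u.1 w.1 huw _ ih _ hb' rfl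
      rwa [e]
  choose φ hφ using hex
  refine ⟨φ, ⟨fun y => ?_, fun j w hw => ?_⟩, ?_⟩
  · obtain ⟨t, ht⟩ := hcov y
    obtain ⟨_, h₁⟩ := getElem?_sortList_eq_some.1 ((hinit t).2.2.1 _ (hφ y t ht))
    rw [← hh.1 y]
    exact h₁.symm
  · have hlen : w.length = (σ.type j).length := by rw [← A.rel_type j w hw, List.length_map]
    have hne : w.toFinset.Nonempty := by
      rw [List.toFinset_nonempty_iff]
      rintro rfl
      exact σ.type_ne_nil j (List.length_eq_zero_iff.1 hlen.symm)
    -- The elements of a tuple are pairwise adjacent in the Gaifman graph, so a bag contains them all.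
    obtain ⟨t, ht⟩ := exists_bag_of_pairwise hd hpar hconn hne (by
      intro y hy z hz
      rw [List.mem_toFinset] at hy hz
      by_cases hyz : y = z
      · subst hyz
        obtain ⟨t, ht⟩ := hcov y
        exact ⟨t, ht, ht⟩
      · exact hedge y z ((SimpleGraph.fromRel_adj _ _ _).2 ⟨hyz, .inl ⟨j, w, hw, hy, hz⟩⟩))
    have hc : (j, w.map h) ∈ P.cons := hh.2 j w hw
    obtain ⟨b, hb, hb'⟩ := (hinit t).2.2.2 (j, (w.map h).map Fin.val)
      (List.mem_map.2 ⟨_, hc, rfl⟩) (by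
        intro v hv
        simp only [List.map_map, List.mem_map, Function.comp] at hv
        obtain ⟨y, hy, rfl⟩ := hv
        exact ⟨_, hφ y t (ht y (List.mem_toFinset.2 hy)), rfl⟩)
    suffices w.map φ = b by rwa [this]
    have hlen' : b.length = w.length := by
      rw [hlen, ← H.rel_type j b hb, List.length_map]
    refine List.ext_getElem (by simpa using hlen'.symm) fun i hi _ => ?_
    rw [List.length_map] at hi
    obtain ⟨z, hz, h₁, h₂⟩ := hb' i (by simpa using hi)
    have h₃ := hφ w[i] t (ht _ (List.mem_toFinset.2 (List.getElem_mem hi)))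
    have h₄ := (hinit t).2.1 _ h₃ z hz (by simp [h₁, hi])
    rw [List.getElem?_eq_getElem (by omega)] at h₂
    rw [List.getElem_map, Option.some.inj h₂]
    exact h₄
  · have h₁ := hφ x r hr
    rw [hq₀] at h₁
    exact (hn₂ r ⟨p, hp⟩ _ ha _ h₁ rfl).symm

end Width

/-! ### Unravelling an instance -/

section Unravel

variable {σ : Sig} {H : Str σ} {n k : ℕ} (P : Inst σ n) (X₀ : Fin k → Fin n) (N : ℕ)

/-- A node of the tree of all sequences of at most `N` tuples of `k` variables; the last tuple is the
head of the list, and the parent of a node is its tail. -/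
abbrev Node (n k N : ℕ) : Type := {w : List (Fin k → Fin n) // w.length ≤ N}

instance : Finite (Node n k N) := (List.finite_length_le (Fin k → Fin n) N).to_subtype

open Classical in
/-- The topmost node of those where the copy of the variable `v` at the node `w` is present. -/
noncomputable def owner : List (Fin k → Fin n) → Fin n → List (Fin k → Fin n)
  | [], _ => []
  | X :: w, v => if v ∈ Set.range (w.headD X₀) then owner w v else X :: w

theorem length_owner_le (w : List (Fin k → Fin n)) (v : Fin n) :
    (owner X₀ w v).length ≤ w.length := by
  induction w with
  | nil => exact le_rfl
  | cons X w ih =>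
    rw [owner]
    split
    · exact ih.trans (Nat.le_succ _)
    · exact le_rfl

theorem mem_range_owner {w : List (Fin k → Fin n)} {v : Fin n} (h : v ∈ Set.range (w.headD X₀)) :
    v ∈ Set.range ((owner X₀ w v).headD X₀) := by
  induction w with
  | nil => exact h
  | cons X w ih =>
    rw [owner]
    split
    · exact ih ‹_›
    · exact h

theorem owner_owner (w : List (Fin k → Fin n)) (v : Fin n) :
    owner X₀ (owner X₀ w v) v = owner X₀ w v := by
  induction w with
  | nil => rfl
  | cons X w ih =>
    by_cases h : v ∈ Set.range (w.headD X₀)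
    · rw [owner, if_pos h, ih]
    · rw [owner, if_neg h, owner, if_neg h]

theorem owner_cons {X : Fin k → Fin n} {w : List (Fin k → Fin n)} {v : Fin n}
    (h : v ∈ Set.range (w.headD X₀)) : owner X₀ (X :: w) v = owner X₀ w v := by
  rw [owner, if_pos h]

theorem owner_eq_or (w : List (Fin k → Fin n)) (v : Fin n) :
    owner X₀ w v = w ∨
      w ≠ [] ∧ v ∈ Set.range (w.tail.headD X₀) ∧ owner X₀ w.tail v = owner X₀ w v := by
  cases w with
  | nil => exact .inl rfl
  | cons X w =>
    by_cases h : v ∈ Set.range (w.headD X₀)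
    · exact .inr ⟨List.cons_ne_nil _ _, h, (owner_cons X₀ h).symm⟩
    · exact .inl (by rw [owner, if_neg h])

/-- Copies of variables at the nodes; the copies at a node and at its parent are the same. -/
abbrev Copy : Type :=
  {y : Node n k N × Fin n // ∃ w : Node n k N, y.2 ∈ Set.range (w.1.headD X₀) ∧
    y.1.1 = owner X₀ w.1 y.2}

variable {X₀ N}

/-- The copy of the `i`-th variable of a node. -/
noncomputable def copyAt (w : Node n k N) (i : Fin k) : Copy X₀ N :=
  ⟨(⟨owner X₀ w.1 (w.1.headD X₀ i), (length_owner_le _ _ _).trans w.2⟩, w.1.headD X₀ i), w, ⟨i, rfl⟩,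
    rfl⟩

theorem copyAt_eq_iff {w : Node n k N} {i : Fin k} {y : Copy X₀ N} :
    copyAt w i = y ↔ w.1.headD X₀ i = y.1.2 ∧ owner X₀ w.1 y.1.2 = y.1.1.1 := by
  constructor
  · rintro rfl
    exact ⟨rfl, rfl⟩
  · rintro ⟨h₁, h₂⟩
    refine Subtype.ext (Prod.ext (Subtype.ext ?_) h₁)
    rw [← h₂, ← h₁]
    rfl

variable (X₀ N)

/-- The structure that unravels the instance `P`: a tree of overlapping copies of its restrictions to
`k` variables. -/
noncomputable def unravel : Str σ where
  carrier := Copy X₀ N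
  finite := inferInstance
  sort y := P.sort y.1.2
  rel j := {a | (∃ w : Node n k N, ∀ y ∈ a, ∃ i, copyAt w i = y) ∧
    (j, a.map fun y => y.1.2) ∈ P.cons}
  rel_type j a h := by
    rw [← P.typed _ h.2, List.map_map]
    rfl

theorem isHom_unravel : IsHom (unravel P X₀ N) P.toStr fun y : Copy X₀ N => y.1.2 :=
  ⟨fun _ => rfl, fun _ _ h => h.2⟩

theorem treewidthLE_unravel {d : ℕ} (X₀ : Fin (d + 1) → Fin n) :
    TreewidthLE (unravel P X₀ N).gaifman d := by
  let bag : Node n (d + 1) N → Finset (Copy X₀ N) := fun w => Finset.univ.image (copyAt w)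
  have hbag : ∀ w y, y ∈ bag w ↔ ∃ i, copyAt w i = y := fun w y => by simp [bag]
  refine treewidthLE_of_parent (r := (⟨[], Nat.zero_le _⟩ : Node n (d + 1) N))
    (par := fun w => ⟨w.1.tail, by simpa using w.2.trans (Nat.le_succ _)⟩)
    (depth := fun w => w.1.length) ?_ bag ?_ ?_ ?_
  · rintro ⟨w, hw⟩ h
    cases w with
    | nil => exact absurd rfl h
    | cons X w => exact Nat.lt_succ_self _
  · intro u v h
    rcases ((SimpleGraph.fromRel_adj _ _ _).1 h).2 with ⟨j, a, ⟨⟨w, hw⟩, -⟩, hu, hv⟩ |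
      ⟨j, a, ⟨⟨w, hw⟩, -⟩, hv, hu⟩
    all_goals exact ⟨w, (hbag _ _).2 (hw _ hu), (hbag _ _).2 (hw _ hv)⟩
  · intro y
    refine ⟨y.1.1, ?_, fun t ht => ?_⟩
    · obtain ⟨w, h₁, h₂⟩ := y.2
      have h₃ := mem_range_owner X₀ h₁
      rw [← h₂] at h₃
      obtain ⟨i, hi⟩ := h₃
      exact (hbag _ _).2 ⟨i, copyAt_eq_iff.2 ⟨hi, by rw [h₂, owner_owner]⟩⟩
    · obtain ⟨i, hi⟩ := (hbag _ _).1 ht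
      obtain ⟨h₁, h₂⟩ := copyAt_eq_iff.1 hi
      rcases owner_eq_or X₀ t.1 y.1.2 with h | ⟨h₃, ⟨i', h₄⟩, h₅⟩
      · exact .inl (Subtype.ext (h.symm.trans h₂))
      · refine .inr ⟨fun h => h₃ (congrArg Subtype.val h), (hbag _ _).2 ⟨i', ?_⟩⟩
        exact copyAt_eq_iff.2 ⟨h₄, h₅.trans h₂⟩
  · intro w
    have h : (bag w).card ≤ _ := Finset.card_image_le (f := (copyAt w : Fin (d + 1) → Copy X₀ N))
    exact h.trans (by simp)

variable {P X₀ N}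

/-- The assignment that a homomorphism from the unravelling makes at a node. -/
noncomputable def nodeAssign (φ : Copy X₀ N → H.carrier) (w : Node n k N) : Assign H :=
  List.ofFn fun i : Fin k => ((w.1.headD X₀ i).val, φ (copyAt w i))

theorem mem_nodeAssign {φ : Copy X₀ N → H.carrier} {w : Node n k N} {x : ℕ × H.carrier} :
    x ∈ nodeAssign φ w ↔ ∃ i, ((w.1.headD X₀ i).val, φ (copyAt w i)) = x := by
  rw [nodeAssign, List.mem_ofFn]

/-- The assignments made by a homomorphism from the unravelling survive as many rounds of pruning as
there are levels below the node. -/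
theorem nodeAssign_mem_iterate {φ : Copy X₀ N → H.carrier} (hφ : IsHom (unravel P X₀ N) H φ)
    (t : ℕ) (w : Node n k N) (hw : w.1.length + t ≤ N) :
    nodeAssign φ w ∈ (prune H k ⟨n, P⟩)^[t] (initial H k ⟨n, P⟩) := by
  induction t generalizing w with
  | zero =>
    refine mem_initial.2 ⟨by simp [nodeAssign], ?_, ?_, ?_⟩
    · intro x hx y hy hxy
      obtain ⟨i, rfl⟩ := mem_nodeAssign.1 hx
      obtain ⟨j, rfl⟩ := mem_nodeAssign.1 hy
      have h : w.1.headD X₀ i = w.1.headD X₀ j := Fin.ext hxy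
      exact congrArg φ (copyAt_eq_iff.2 ⟨h, rfl⟩)
    · intro x hx
      obtain ⟨i, rfl⟩ := mem_nodeAssign.1 hx
      exact getElem?_sortList_eq_some.2 ⟨Fin.is_lt _, (hφ.1 (copyAt w i)).symm⟩
    · intro c hc hcov
      obtain ⟨⟨j, s⟩, hs, rfl⟩ := List.mem_map.1 hc
      have hs' : s ∈ Set.range (List.map (w.1.headD X₀)) := by
        rw [Set.range_list_map]
        intro v hv
        obtain ⟨y, hy, hyv⟩ := hcov v.val (List.mem_map_of_mem hv)
        obtain ⟨i, rfl⟩ := mem_nodeAssign.1 hy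
        exact ⟨i, Fin.ext hyv⟩
      obtain ⟨l, rfl⟩ := hs'
      refine ⟨(l.map (copyAt w)).map φ, hφ.2 j _ ⟨⟨w, ?_⟩, ?_⟩, fun i hi => ?_⟩
      · intro y hy
        obtain ⟨i, -, hi⟩ := List.mem_map.1 hy
        exact ⟨i, hi⟩
      · rw [List.map_map]
        exact hs
      · have hi' : i < l.length := by simpa using hi
        exact ⟨_, mem_nodeAssign.2 ⟨l[i], rfl⟩, by simp [hi'], by simp [hi']⟩
  | succ t ih =>
    rw [Function.iterate_succ_apply', mem_prune]
    refine ⟨ih w (by omega), fun B hB hlt => ?_⟩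
    -- The variables `B` are those of a child of `w`, which shares with `w` their common copies.
    let X : Fin k → Fin n := fun i => ⟨B[i.val]'(by rw [hB]; exact i.2), hlt _ (List.getElem_mem _)⟩
    let w' : Node n k N := ⟨X :: w.1, by rw [List.length_cons]; omega⟩
    refine ⟨nodeAssign φ w', ih w' (by rw [List.length_cons]; omega), fun v hv => ?_, ?_⟩
    · obtain ⟨i, hi, rfl⟩ := List.getElem_of_mem hv
      exact ⟨_, mem_nodeAssign.2 ⟨⟨i, by omega⟩, rfl⟩, rfl⟩
    · intro x hx y hy hxy
      obtain ⟨i, rfl⟩ := mem_nodeAssign.1 hx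
      obtain ⟨j, rfl⟩ := mem_nodeAssign.1 hy
      have h : w.1.headD X₀ i = w'.1.headD X₀ j := Fin.ext hxy
      refine congrArg φ (copyAt_eq_iff.2 ⟨h, ?_⟩)
      exact (owner_cons X₀ ⟨i, h⟩).symm

end Unravel

/-! ### The minimal refinement of width `d` -/

section Minimal

variable {σ : Sig} {H : Str σ} {n d : ℕ} {P : Inst σ n}

/-- The remaining values of a variable form a relation defined by a structure of treewidth at most `d`
that maps to the instance. -/
theorem exists_prunedValues_eq_definedBy (P : Inst σ n) (v : Fin n) :
    ∃ (A : Str σ) (x : A.carrier), TreewidthLE A.gaifman d ∧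
      (∃ h : A.carrier → Fin n, IsHom A P.toStr h ∧ h x = v) ∧
      prunedValues H (d + 1) ⟨n, P⟩ v = H.definedBy A x := by
  let X₀ : Fin (d + 1) → Fin n := fun _ => v
  let N := (initial H (d + 1) ⟨n, P⟩).length
  let r : Node n (d + 1) N := ⟨[], Nat.zero_le _⟩
  refine ⟨unravel P X₀ N, copyAt r 0, treewidthLE_unravel P N X₀, ⟨_, isHom_unravel P X₀ N, rfl⟩, ?_⟩
  refine (prunedValues_subset_definedBy (unravel P X₀ N) (copyAt r 0) (treewidthLE_unravel P N X₀) _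
    (isHom_unravel P X₀ N)).antisymm ?_
  rintro _ ⟨φ, hφ, rfl⟩
  have h := nodeAssign_mem_iterate hφ N r (by simp [r])
  rw [← foldl_prune] at h
  exact ⟨_, h, mem_nodeAssign.2 ⟨0, rfl⟩⟩

/-- The remaining values are the least relation, so they are the only minimal one. -/
theorem minimal_prunedValues_iff {v : Fin n} {U : Set H.carrier} :
    Minimal (fun U => ∃ (A : Str σ) (x : A.carrier), TreewidthLE A.gaifman d ∧
      (∃ h : A.carrier → Fin n, IsHom A P.toStr h ∧ h x = v) ∧ U = H.definedBy A x) U ↔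
    U = prunedValues H (d + 1) ⟨n, P⟩ v := by
  have hmem := exists_prunedValues_eq_definedBy (H := H) (d := d) P v
  constructor
  · rintro ⟨⟨A, x, hA, ⟨h, hh, rfl⟩, rfl⟩, hmin⟩
    have hle := prunedValues_subset_definedBy (H := H) A x hA h hh
    exact (hmin hmem hle).antisymm hle
  · rintro rfl
    refine ⟨hmem, ?_⟩
    rintro _ ⟨A, x, hA, ⟨h, hh, rfl⟩, rfl⟩ -
    exact prunedValues_subset_definedBy A x hA h hh

theorem IsSol.mem_prunedValues {φ : Fin n → H.carrier} (hφ : IsSol H P φ) (v : Fin n) :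
    φ v ∈ prunedValues H (d + 1) ⟨n, P⟩ v := by
  obtain ⟨A, x, -, ⟨h, hh, rfl⟩, e⟩ := exists_prunedValues_eq_definedBy (H := H) (d := d) P v
  rw [e]
  refine ⟨φ ∘ h, ⟨fun y => (hφ.1 _).trans (hh.1 y), fun j a ha => ?_⟩, rfl⟩
  rw [← List.map_map]
  exact hφ.2 _ (hh.2 j a ha)

/-- A remaining assignment is compatible with one that gives values to the whole scope of a short
constraint, and hence satisfies it. -/
theorem prunedValues_subset_proj {c : Fin σ.rels × List (Fin n)} (hc : c ∈ P.cons)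
    (hlen : (σ.type c.1).length ≤ d + 1) {r : ℕ} {v : Fin n} (hv : c.2[r]? = some v) :
    prunedValues H (d + 1) ⟨n, P⟩ v ⊆ H.proj c.1 r := by
  rintro a ⟨p, hp, ha⟩
  have hl : c.2.length ≤ d + 1 := by rwa [← P.typed c hc, List.length_map] at hlen
  obtain ⟨q, hq, h₁, h₂⟩ := exists_mem_pruned hp (S := c.2.toFinset)
    ((List.toFinset_card_le _).trans hl) v
  obtain ⟨b, hb, h₃⟩ := (mem_initial.1 (mem_initial_of_mem_pruned hq)).2.2.2
    (c.1, c.2.map Fin.val) (List.mem_map_of_mem hc) (by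
      intro w hw
      obtain ⟨w, hw', rfl⟩ := List.mem_map.1 hw
      exact h₁ w (List.mem_toFinset.2 hw'))
  obtain ⟨hr, hr'⟩ := List.getElem?_eq_some_iff.1 hv
  obtain ⟨y, hy, h₄, h₅⟩ := h₃ r (by simpa using hr)
  refine ⟨b, hb, ?_⟩
  have e : a = y.2 := h₂ _ ha y hy (by simp [h₄, hr, hr'])
  rw [h₅, e]

variable {G : Refinement H}

theorem isMinimalLosslessWidth_iff {Q : Inst G.sig n} : G.IsMinimalLosslessWidth d P Q ↔
    G.IsRefinementOf P Q ∧ ∀ v, G.dom (Q.sort v) = prunedValues H (d + 1) ⟨n, P⟩ v := by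
  simp only [Refinement.IsMinimalLosslessWidth, minimal_prunedValues_iff]
  refine ⟨fun h => ⟨h.1.1, h.2⟩, fun h => ⟨isLossless_of_sols h.1 fun φ hφ v => ?_, h.2⟩⟩
  rw [h.2]
  exact hφ.mem_prunedValues v

/-- The algorithm calls no subroutine, so the machine `O` is arbitrary. -/
theorem exists_minimalLosslessWidth_algorithm (O : Turing.FinTM2) (hG : G.IsFullWidth d) :
    ∃ f : AnyInst σ → AnyInst G.sig, PolyTime encodeInst encodeInst f ∧
      ∀ n (P : Inst σ n),
        (∀ c ∈ P.cons, ∀ (r : ℕ) v, c.2[r]? = some v →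
          prunedValues H (d + 1) ⟨n, P⟩ v ⊆ H.proj c.1 r) →
        ∃ Q, f ⟨n, P⟩ = ⟨n, Q⟩ ∧ G.IsMinimalLosslessWidth d P Q := by
  obtain ⟨f, h₁, h₂⟩ := exists_refinement_algorithm (U := prunedValues H (d + 1)) hG O
    pt_prunedValues fun n P v => by
      obtain ⟨A, x, hA, ⟨h, hh, rfl⟩, e⟩ := exists_prunedValues_eq_definedBy (H := H) (d := d) P v
      exact ⟨A, x, hA, (hh.1 x).symm, e⟩
  exact ⟨f, h₁, fun n P hP => (h₂ n P hP).imp fun Q hQ =>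
    ⟨hQ.1, isMinimalLosslessWidth_iff.2 hQ.2⟩⟩

end Minimal

theorem mainTheorem8 {σ : Sig} (H : Str σ) :
    -- (1)
    (∀ (d : ℕ) (G : Refinement H), G.IsFullWidth d →
      (∃ f : AnyInst σ → AnyInst G.sig, PolyTime encodeInst encodeInst f ∧
        ∀ (n : ℕ) (P : Inst σ n), (∃ Q, G.IsMinimalLosslessWidth d P Q) →
          ∃ Q, f ⟨n, P⟩ = ⟨n, Q⟩ ∧ G.IsMinimalLosslessWidth d P Q) ∧
      ((∀ j, (σ.type j).length ≤ d + 1) →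
        ∀ (n : ℕ) (P : Inst σ n), ∃ Q, G.IsMinimalLosslessWidth d P Q)) ∧
    -- (2)
    (H.HasConstants → H.CSPPolyTime → ∀ G : Refinement H, G.IsFull →
      ∃ f : AnyInst σ → AnyInst G.sig, PolyTime encodeInst encodeInst f ∧
        ∀ (n : ℕ) (P : Inst σ n), ∃ Q, f ⟨n, P⟩ = ⟨n, Q⟩ ∧ G.IsMinimalLossless P Q) := by
  refine ⟨fun d G hG => ?_, exists_minimalLossless_algorithm⟩
  obtain ⟨f, h₁, h₂⟩ := exists_minimalLosslessWidth_algorithm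
    (Turing.idComputer Bool) hG
  refine ⟨⟨f, h₁, fun n P ⟨Q, hQ⟩ => h₂ n P fun c hc r v hv => ?_⟩, fun hlen n P => ?_⟩
  · obtain ⟨hQ, hd⟩ := isMinimalLosslessWidth_iff.1 hQ
    rw [← hd]
    exact (hQ.2.1 c hc).1 r v hv
  · obtain ⟨Q, -, hQ⟩ := h₂ n P fun c hc r v hv => prunedValues_subset_proj hc (hlen _) hv
    exact ⟨Q, hQ⟩
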